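/- **Setting.** Let $n\ge 1$, let $\omega$ be the standard symplectic form on $\mathbb R^{2n}$, and let $H(n)=\mathbb R^{2n}\times\mathbb R$ be the Heisenberg group with $(x,\bar x)(y,\bar y)=(x+y,\bar x+\bar y+\tfrac12\omega(x,y))$, dilations $\delta_\varepsilon(x,\bar x)=(\varepsilon x,\varepsilon^2\bar x)$, projection $\pi(x,\bar x)=x$, Lebesgue measure, and the Carnot–Carathéodory distance $d$. That is, $d(p,q)$ is the infimum of $\int_0^1|\dot x|\,dt$ over absolutely continuous curves $(x(t),\bar x(t))$, $t\in[0,1]$, from $p$ to $q$ that are horizontal: $\dot{\bar x}=\tfrac12\omega(x,\dot x)$ almost everywhere. Fix a regularity $r\in\{0,1,2,\dots,\infty\}$; for $r=0$ the $C^r$ conditions below add nothing. * $\mathrm{Diff}(H(n),vol,bracket)$ is the group of homeomorphisms $f$ of $H(n)$ that preserve volume and such that $f$ and $f^{-1}$ are locally Lipschitz (in the Euclidean sense), of class $C^r$, and bracket derivable: at every $p$ the map $y\mapsto f(p)^{-1}f(py)$ is differentiable at $0$ and its differential is a morphism of $H(n)$. * $\mathrm{Diff}(H(n),vol)$ is the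 subgroup of $\mathrm{Diff}(H(n),vol,bracket)$ of the $f$ such that $f$ and $f^{-1}$ are also locally Lipschitz for $d$. $\mathrm{Diff}(H(n),vert)$ is the subgroup of $\mathrm{Diff}(H(n),vol,bracket)$ consisting of the maps of the form $(x,\bar x)\mapsto(x,\bar x+F(x))$. * The index $c$ on these groups denotes the subgroup of the maps that are the identity outside $K\times\mathbb R$ for some compact $K\subset\mathbb R^{2n}$. * $\mathrm{Sympl}(\mathbb R^{2n})$ is the group of homeomorphisms $\phi$ of $\mathbb R^{2n}$ such that $\phi$ and $\phi^{-1}$ are locally Lipschitz, of class $C^r$, and differentiable everywhere with symplectic differentials (for $r\ge1$ these are the $C^r$ symplectomorphisms). $\mathrm{Sympl}(\mathbb R^{2n})_c$ is the subgroup of those that are the identity outside a compact set. * $\mathrm{HAM}(H(n))_c=\mathrm{Diff}(H(n),vol)_c\times\mathrm{Diff}(H(n),vert)_c$ has the group law $(f,v)(g,w)=(fg,\;v f w f^{-1})$ and acts on $H(n)$ by $(f,v)p=v(f(p))$. The subgroup $\{\mathrm{id}\}\times\mathrm{Diff}(H(n),vert)_c$ is normal. For $r\ge2$ let moreover: * A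 *horizontal curve* in $\mathrm{HAM}(H(n))_c$ be a curve $t\in[0,1]\mapsto(f_t,v_t)$, jointly $C^r$ in time and space, with all $f_t,v_t$ equal to the identity outside one common $K\times\mathbb R$, $K$ compact, such that $t\mapsto f_t(v_t(p))$ is horizontal for every $p$. Its length is $\int_0^1\|\dot v_t\|_\infty\,dt$; $dist(A,B)$ is the infimum of the lengths of the horizontal curves from $A$ to $B$ ($+\infty$ if there are none). * The *Hofer distance* $d_H(\phi,\psi)$ on $\mathrm{Sympl}(\mathbb R^{2n})_c$ be the infimum of $\int_0^1\|h_t\|_\infty\,dt$ over curves $\phi_t$ in $\mathrm{Sympl}(\mathbb R^{2n})_c$ from $\phi$ to $\psi$, jointly $C^r$ on $[0,1]\times\mathbb R^{2n}$, generated by a Hamiltonian $h$ vanishing outside $[0,1]\times K$ for some compact $K$: $\omega(\dot\phi_t(x),w)=dh_t(\phi_t(x))w$ ($+\infty$ if there are none). * $\mathrm{Sympl}_0$ be the identity component of $\mathrm{Sympl}(\mathbb R^{2n})_c$, i.e. the set of its elements joined to the identity by a jointly $C^r$ isotopy in $\mathrm{Sympl}(\mathbb R^{2n})_c$ with support in a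 common compact set. **Theorem 9.1.** 1. The orbits in $H(n)$ of $\mathrm{Diff}(H(n),vert)$, of $\mathrm{Diff}(H(n),vert)_c$ and of $\{\mathrm{id}\}\times\mathrm{Diff}(H(n),vert)_c$ are the fibres of $\pi$, and $\pi$ induces a homeomorphism $H(n)/\mathrm{Diff}(H(n),vert)\cong\mathbb R^{2n}$. There is a group isomorphism $$\Psi:\ \mathrm{HAM}(H(n))_c\big/\big(\{\mathrm{id}\}\times\mathrm{Diff}(H(n),vert)_c\big)\ \longrightarrow\ \mathrm{Sympl}(\mathbb R^{2n})_c$$ with $\pi(g\,p)=\Psi([g])(\pi(p))$ for all $g\in \mathrm{HAM}(H(n))_c$ and $p\in H(n)$. So the action of $\mathrm{HAM}(H(n))_c$ on $H(n)$ descends to the action of $\mathrm{Sympl}(\mathbb R^{2n})_c$ on $\mathbb R^{2n}$. 2. Let $r\ge2$. For all cosets $a,b$: $\ \inf\{dist(A,B): A\in a,\ B\in b\}=d_H(\Psi(a),\Psi(b))$, and already $\inf\{dist(A,B):B\in b\}=d_H(\Psi(a),\Psi(b))$ for each fixed $A\in a$. Moreover $d_H(\mathrm{id},\phi)<\infty$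 if and only if $\phi\in\mathrm{Sympl}_0$, and $d_H$ is finite on $\mathrm{Sympl}_0\times \mathrm{Sympl}_0$. So $dist$ descends to the Hofer distance on the identity component. 3. Let $\tilde c$ be a function on the subsets of $H(n)$ with values in any set. * If $\tilde c(f(\tilde A))=\tilde c(\tilde A)$ for all $f\in\mathrm{Diff}(H(n),vol)$ and all Borel $\tilde A$, then $c(A)=\tilde c(\pi^{-1}(A))$ satisfies $c(\phi(A))=c(A)$ for all $\phi\in\mathrm{Sympl}(\mathbb R^{2n})$ and all Borel $A$. * If $\tilde c$ is so invariant on bounded Borel sets, then the set of values $V_{\tilde c}(A)=\{\tilde c(\tilde A):\tilde A\text{ bounded Borel},\ \pi(\tilde A)=A\}$ satisfies $V_{\tilde c}(\phi(A))=V_{\tilde c}(A)$ for all $\phi\in\mathrm{Sympl}(\mathbb R^{2n})$ and all bounded Borel $A$. * Both assertions also hold with $\mathrm{Diff}(H(n),vol)_c$ and $\mathrm{Sympl}(\mathbb R^{2n})_c$ in place of the full groups. * Let $\tilde c$ have values in $[0,\infty]$ and satisfy, on Borel sets (respectively on bounded Borel sets), $\tilde c(\tilde A)\le\tilde c(\tilde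 B)$ whenever $f(\tilde A)\subset\tilde B$ for some $f\in\mathrm{Diff}(H(n),vol)$, and $\tilde c(\delta_\varepsilon\tilde A)=\varepsilon^2\tilde c(\tilde A)$ for $\varepsilon>0$. Then $c(A)=\tilde c(\pi^{-1}(A))$ (respectively $c(A)=\inf V_{\tilde c}(A)$) satisfies, on Borel (respectively bounded Borel) sets, $c(A)\le c(B)$ whenever $\phi(A)\subset B$ for some $\phi\in\mathrm{Sympl}(\mathbb R^{2n})$, and $c(\varepsilon A)=\varepsilon^2c(A)$ for real $\varepsilon\ne0$. -/

import Mathlib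

open Set Topology MeasureTheory
open scoped ENNReal NNReal ContDiff

noncomputable section

namespace Heis

/-! ### The Heisenberg group -/

/-- `ℝ^{2n}` with its Euclidean norm; the coordinates are `(q, p)`. -/
abbrev E (n : ℕ) : Type := EuclideanSpace ℝ (Fin n ⊕ Fin n)

/-- The underlying space `ℝ^{2n} × ℝ` of the Heisenberg group (identified with its Lie algebra). -/
abbrev H (n : ℕ) : Type := E n × ℝ

/-- The standard symplectic form on `ℝ^{2n}`. -/
def omega {n : ℕ} (x y : E n) : ℝ :=
  ∑ i : Fin n, (x (Sum.inl i) * y (Sum.inr i) - x (Sum.inr i) * y (Sum.inl i))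

/-- The group operation of the Heisenberg group. -/
def hmul {n : ℕ} (p q : H n) : H n := (p.1 + q.1, p.2 + q.2 + (1 / 2) * omega p.1 q.1)

/-- The inverse in the Heisenberg group. -/
def hinv {n : ℕ} (p : H n) : H n := (-p.1, -p.2)

/-- The dilations of the Heisenberg group. -/
def dil {n : ℕ} (ε : ℝ) (p : H n) : H n := (ε • p.1, ε ^ 2 * p.2)

/-- A tangent vector `w` at `p` is horizontal when `p⁻¹ w` (left translation to the identity)
lies in `ℝ^{2n} × {0}`. -/
def IsHorizontalVec {n : ℕ} (p w : H n) : Prop := w.2 = (1 / 2) * omega p.1 w.1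

/-- Horizontal curves: absolutely continuous curves on `[0,1]` which are tangent to the left
invariant distribution at almost every time. -/
def IsHorizontalCurve {n : ℕ} (c : ℝ → H n) : Prop :=
  AbsolutelyContinuousOnInterval c 0 1 ∧
    ∀ᵐ t ∂(volume.restrict (Icc (0 : ℝ) 1)), IsHorizontalVec (c t) (deriv c t)

/-- The Carnot-Caratheodory distance. For a horizontal curve the left translate of the velocity is
`(ẋ, 0)`, of Euclidean norm `‖ẋ‖`. -/
def ccDist {n : ℕ} (p q : H n) : ℝ≥0∞ :=
  ⨅ (c : ℝ → H n) (_ : IsHorizontalCurve c) (_ : c 0 = p) (_ : c 1 = q),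
    ∫⁻ t in Icc (0 : ℝ) 1, ‖(deriv c t).1‖ₑ

/-- Locally Lipschitz with respect to the Carnot-Caratheodory distance. -/
def CCLocallyLipschitz {n : ℕ} (f : H n → H n) : Prop :=
  ∀ p, ∃ K : ℝ≥0, ∃ U ∈ 𝓝 p, ∀ x ∈ U, ∀ y ∈ U, ccDist (f x) (f y) ≤ K * ccDist x y

/-- Pansu derivability at every point with respect to the dilations `y ↦ ε y` (for which the left
invariant distribution is the whole tangent space): as `t → 0`, the maps
`y ↦ t⁻¹ (f(p)⁻¹ f(p (t y)))` converge, uniformly on the unit ball, to a linear map which is a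
morphism of the Heisenberg group (equivalently, preserves the bracket). The convergence says exactly
that `y ↦ f(p)⁻¹ f(p y)` has this linear map as its Fréchet derivative at the neutral element. -/
def BracketDerivable {n : ℕ} (f : H n → H n) : Prop :=
  ∀ p, ∃ L : H n →L[ℝ] H n, (∀ u v, L (hmul u v) = hmul (L u) (L v)) ∧
    HasFDerivAt (fun y => hmul (hinv (f p)) (f (hmul p y))) L 0

/-! ### Elementary facts -/

section basic
variable {n : ℕ}

theorem omega_self (x : E n) : omega x x = 0 := by
  simp [omega, mul_comm]

theorem omega_add_right (x y z : E n) : omega x (y + z) = omega x y + omega x z := by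
  simp only [omega, PiLp.add_apply, ← Finset.sum_add_distrib]
  exact Finset.sum_congr rfl fun i _ => by ring

theorem omega_add_left (x y z : E n) : omega (x + y) z = omega x z + omega y z := by
  simp only [omega, PiLp.add_apply, ← Finset.sum_add_distrib]
  exact Finset.sum_congr rfl fun i _ => by ring

theorem omega_smul_right (a : ℝ) (x y : E n) : omega x (a • y) = a * omega x y := by
  simp only [omega, PiLp.smul_apply, smul_eq_mul, Finset.mul_sum]
  exact Finset.sum_congr rfl fun i _ => by ring

theorem omega_swap (x y : E n) : omega x y = -omega y x := by
  simp only [omega, ← Finset.sum_neg_distrib]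
  exact Finset.sum_congr rfl fun i _ => by ring

theorem omega_neg_left (x y : E n) : omega (-x) y = -omega x y := by
  simp only [omega, PiLp.neg_apply, ← Finset.sum_neg_distrib]
  exact Finset.sum_congr rfl fun i _ => by ring

theorem omega_zero_right (x : E n) : omega x 0 = 0 := by
  simp [omega]

theorem hmul_zero_right (p : H n) : hmul p 0 = p := by
  simp [hmul, omega_zero_right]

theorem hmul_hinv_self (p : H n) : hmul (hinv p) p = 0 := by
  simp [hmul, hinv, omega_neg_left, omega_self]

theorem hmul_hinv_cancel (p q : H n) : hmul p (hmul (hinv p) q) = q := by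
  ext1
  · simp [hmul, hinv]
  · simp only [hmul, hinv, omega_neg_left, omega_self, omega_add_right,
      omega_swap p.1 (-p.1)]
    ring

theorem BracketDerivable.comp {f g : H n → H n} (hf : BracketDerivable f)
    (hg : BracketDerivable g) : BracketDerivable (f ∘ g) := by
  intro p
  obtain ⟨L, hL, hL'⟩ := hg p
  obtain ⟨M, hM, hM'⟩ := hf (g p)
  refine ⟨M.comp L, fun u v => by simp [hL, hM], ?_⟩
  have h0 : hmul (hinv (g p)) (g (hmul p 0)) = 0 := by rw [hmul_zero_right, hmul_hinv_self]
  have h := HasFDerivAt.comp (g := fun y => hmul (hinv (f (g p))) (f (hmul (g p) y)))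
    (f := fun y => hmul (hinv (g p)) (g (hmul p y))) (0 : H n) (by rw [h0]; exact hM') hL'
  have heq : ((fun y => hmul (hinv (f (g p))) (f (hmul (g p) y))) ∘
      fun y => hmul (hinv (g p)) (g (hmul p y))) =
      fun y => hmul (hinv ((f ∘ g) p)) ((f ∘ g) (hmul p y)) := by
    funext y
    simp [Function.comp, hmul_hinv_cancel]
  rw [heq] at h
  exact h

theorem BracketDerivable.id : BracketDerivable (fun p : H n => p) := by
  intro p
  refine ⟨ContinuousLinearMap.id ℝ _, fun u v => rfl, ?_⟩
  have : (fun y : H n => hmul (hinv p) (hmul p y)) = fun y => y := by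
    funext y
    ext1
    · simp [hmul, hinv]
    · simp only [hmul, hinv, omega_neg_left, omega_self, omega_add_right]
      ring
  rw [this]
  exact hasFDerivAt_id _

theorem CCLocallyLipschitz.comp {f g : H n → H n} (hf : CCLocallyLipschitz f)
    (hg : CCLocallyLipschitz g) (hc : Continuous g) : CCLocallyLipschitz (f ∘ g) := by
  intro p
  obtain ⟨K, U, hU, h⟩ := hg p
  obtain ⟨K', U', hU', h'⟩ := hf (g p)
  refine ⟨K' * K, U ∩ g ⁻¹' U', Filter.inter_mem hU (hc.continuousAt hU'), ?_⟩
  intro x hx y hy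
  calc ccDist (f (g x)) (f (g y)) ≤ K' * ccDist (g x) (g y) := h' _ hx.2 _ hy.2
    _ ≤ K' * (K * ccDist x y) := by gcongr; exact h _ hx.1 _ hy.1
    _ = _ := by push_cast; ring

end basic

/-! ### Groups of transformations of `H(n)` -/

/-- Homeomorphisms of a space act on it by evaluation. -/
instance homeoAction (X : Type*) [TopologicalSpace X] : MulAction (X ≃ₜ X) X where
  smul f x := f x
  one_smul _ := rfl
  mul_smul _ _ _ := rfl

/-- `Diff(H(n), vol, bracket)`: volume preserving, locally bi-Lipschitz (for the Riemannian, hence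
for the Euclidean distance) homeomorphisms which, with their inverse, are Pansu derivable with
respect to the dilations `y ↦ ε y`; moreover of classical regularity `C^r` in both directions
(no additional condition when `r = 0`). -/
def bracketDiff (r : ℕ∞) (n : ℕ) : Subgroup (H n ≃ₜ H n) where
  carrier := {f | MeasurePreserving f volume volume ∧
    (LocallyLipschitz f ∧ LocallyLipschitz f.symm) ∧
    (BracketDerivable f ∧ BracketDerivable f.symm) ∧
    (ContDiff ℝ r f ∧ ContDiff ℝ r f.symm)}
  one_mem' := ⟨MeasurePreserving.id _, ⟨LocallyLipschitz.id, LocallyLipschitz.id⟩,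
    ⟨BracketDerivable.id, BracketDerivable.id⟩, ⟨contDiff_id, contDiff_id⟩⟩
  mul_mem' := by
    rintro f g ⟨f1, ⟨f2, f3⟩, ⟨f4, f5⟩, f6, f7⟩ ⟨g1, ⟨g2, g3⟩, ⟨g4, g5⟩, g6, g7⟩
    exact ⟨f1.comp g1, ⟨f2.comp g2, g3.comp f3⟩, ⟨f4.comp g4, g5.comp f5⟩,
      ⟨f6.comp g6, g7.comp f7⟩⟩
  inv_mem' := by
    rintro f ⟨f1, ⟨f2, f3⟩, ⟨f4, f5⟩, f6, f7⟩
    exact ⟨MeasurePreserving.symm f.toMeasurableEquiv f1, ⟨f3, f2⟩, ⟨f5, f4⟩, ⟨f7, f6⟩⟩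

/-- `Diff(H(n), vol, Lip)`: volume preserving homeomorphisms of `H(n)` which are locally
bi-Lipschitz for the Carnot-Caratheodory distance. -/
def lipDiff (n : ℕ) : Subgroup (H n ≃ₜ H n) where
  carrier := {f | MeasurePreserving f volume volume ∧
    (CCLocallyLipschitz f ∧ CCLocallyLipschitz f.symm)}
  one_mem' := by
    have : CCLocallyLipschitz (fun p : H n => p) := fun p =>
      ⟨1, Set.univ, Filter.univ_mem, fun x _ y _ => by simp⟩
    exact ⟨MeasurePreserving.id _, this, this⟩
  mul_mem' := by
    rintro f g ⟨f1, f2, f3⟩ ⟨g1, g2, g3⟩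
    exact ⟨f1.comp g1, f2.comp g2 g.continuous, g3.comp f3 f.symm.continuous⟩
  inv_mem' := by
    rintro f ⟨f1, f2, f3⟩
    exact ⟨MeasurePreserving.symm f.toMeasurableEquiv f1, f3, f2⟩

/-- `Diff(H(n), vol) = Diff(H(n), vol, bracket) ∩ Diff(H(n), vol, Lip)`, with regularity `C^r`. -/
def volDiff (r : ℕ∞) (n : ℕ) : Subgroup (H n ≃ₜ H n) := bracketDiff r n ⊓ lipDiff n

/-- `Diff(H(n), vert)`: the elements of `Diff(H(n), vol, bracket)` of the form
`(x, x̄) ↦ (x, x̄ + F(x))`, with regularity `C^r`. -/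
def vertDiff (r : ℕ∞) (n : ℕ) : Subgroup (H n ≃ₜ H n) where
  carrier := {f | f ∈ bracketDiff r n ∧ ∃ F : E n → ℝ, ∀ p, f p = (p.1, p.2 + F p.1)}
  one_mem' := ⟨one_mem _, fun _ => 0, fun p => by simp⟩
  mul_mem' := by
    rintro f g ⟨hf, F, hF⟩ ⟨hg, G, hG⟩
    refine ⟨mul_mem hf hg, fun x => G x + F x, fun p => ?_⟩
    change f (g p) = _
    rw [hG, hF]
    ext1
    · rfl
    · simp [add_assoc]
  inv_mem' := by
    rintro f ⟨hf, F, hF⟩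
    refine ⟨inv_mem hf, fun x => -F x, fun p => ?_⟩
    change f.symm p = _
    rw [Homeomorph.symm_apply_eq, hF]
    ext1
    · rfl
    · simp

/-- Homeomorphisms of `H(n)` of compact support modulo the vertical direction: they are the
identity outside `K × ℝ` for some compact `K ⊆ ℝ^{2n}`. -/
def cylSupport (n : ℕ) : Subgroup (H n ≃ₜ H n) where
  carrier := {f | ∃ K : Set (E n), IsCompact K ∧ ∀ p : H n, p.1 ∉ K → f p = p}
  one_mem' := ⟨∅, isCompact_empty, fun _ _ => rfl⟩
  mul_mem' := by
    rintro f g ⟨K, hK, h⟩ ⟨K', hK', h'⟩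
    refine ⟨K ∪ K', hK.union hK', fun p hp => ?_⟩
    change f (g p) = p
    rw [h' p fun hh => hp (Or.inr hh), h p fun hh => hp (Or.inl hh)]
  inv_mem' := by
    rintro f ⟨K, hK, h⟩
    refine ⟨K, hK, fun p hp => ?_⟩
    change f.symm p = p
    rw [Homeomorph.symm_apply_eq, h p hp]

/-- `Diff(H(n), vol)_c`. -/
def volDiffC (r : ℕ∞) (n : ℕ) : Subgroup (H n ≃ₜ H n) := volDiff r n ⊓ cylSupport n

/-- `Diff(H(n), vert)_c`. -/
def vertDiffC (r : ℕ∞) (n : ℕ) : Subgroup (H n ≃ₜ H n) := vertDiff r n ⊓ cylSupport n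

/-! ### Vertical maps are normalised -/

section conj
variable {n : ℕ}

/-- The derivative along the left translates of `s ↦ s u`. -/
theorem hasDerivAt_along {f : H n → H n} {p : H n} {L : H n →L[ℝ] H n}
    (hL : HasFDerivAt (fun y => hmul (hinv (f p)) (f (hmul p y))) L 0) (u : H n) :
    HasDerivAt (fun s : ℝ => hmul (hinv (f p)) (f (hmul p (s • u)))) (L u) 0 := by
  have h1 : HasDerivAt (fun s : ℝ => s • u) u 0 := by
    simpa using (hasDerivAt_id (0 : ℝ)).smul_const u
  have h2 : HasFDerivAt (fun y => hmul (hinv (f p)) (f (hmul p y))) L ((0 : ℝ) • u) := by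
    simpa using hL
  exact h2.comp_hasDerivAt (0 : ℝ) h1

theorem hasDerivAt_along_fst {f : H n → H n} {p : H n} {L : H n →L[ℝ] H n}
    (hL : HasFDerivAt (fun y => hmul (hinv (f p)) (f (hmul p y))) L 0) (u : H n) :
    HasDerivAt (fun s : ℝ => (f p).1 + (hmul (hinv (f p)) (f (hmul p (s • u)))).1) (L u).1 0 :=
  HasDerivAt.const_add _ ((ContinuousLinearMap.fst ℝ (E n) ℝ).hasFDerivAt.comp_hasDerivAt (0 : ℝ)
    (hasDerivAt_along hL u))

theorem hasDerivAt_along_snd {f : H n → H n} {p : H n} {L : H n →L[ℝ] H n}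
    (hL : HasFDerivAt (fun y => hmul (hinv (f p)) (f (hmul p y))) L 0) (u : H n) :
    HasDerivAt (fun s : ℝ => (f p).2 + (hmul (hinv (f p)) (f (hmul p (s • u)))).2) (L u).2 0 :=
  HasDerivAt.const_add _ ((ContinuousLinearMap.snd ℝ (E n) ℝ).hasFDerivAt.comp_hasDerivAt (0 : ℝ)
    (hasDerivAt_along hL u))

theorem fst_center {L : H n →L[ℝ] H n} [NeZero n]
    (hL : ∀ u v, L (hmul u v) = hmul (L u) (L v)) : (L (0, 1)).1 = 0 := by
  let u : H n := (EuclideanSpace.single (Sum.inl (0 : Fin n)) 1, 0)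
  let v : H n := (EuclideanSpace.single (Sum.inr (0 : Fin n)) 1, 0)
  have huv : hmul u v = u + v + (1 / 2 : ℝ) • ((0, 1) : H n) := by
    ext1
    · simp [hmul, u, v]
    · simp [hmul, u, v, omega]
  have h := congrArg Prod.fst (hL u v)
  rw [huv] at h
  simp only [map_add, map_smul, hmul, Prod.fst_add, Prod.smul_fst] at h
  simpa using h

theorem snd_center {L : H n →L[ℝ] H n} [NeZero n]
    (hL : ∀ u v, L (hmul u v) = hmul (L u) (L v)) :
    (L (0, 1)).2 = omega (L (EuclideanSpace.single (Sum.inl (0 : Fin n)) 1, 0)).1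
      (L (EuclideanSpace.single (Sum.inr (0 : Fin n)) 1, 0)).1 := by
  set u : H n := (EuclideanSpace.single (Sum.inl (0 : Fin n)) 1, 0) with hu
  set v : H n := (EuclideanSpace.single (Sum.inr (0 : Fin n)) 1, 0) with hv
  have huv : hmul u v = u + v + (1 / 2 : ℝ) • ((0, 1) : H n) := by
    ext1
    · simp [hmul, u, v]
    · simp [hmul, u, v, omega]
  have h := congrArg Prod.snd (hL u v)
  rw [huv] at h
  simp only [map_add, map_smul, hmul, Prod.snd_add, Prod.smul_snd, smul_eq_mul] at h
  linarith

/-- A bracket preserving map sends vertical lines to vertical lines. -/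
theorem BracketDerivable.fst_eq [NeZero n] {f : H n → H n} (hf : BracketDerivable f)
    (x : E n) (s t : ℝ) : (f (x, s)).1 = (f (x, t)).1 := by
  have key : ∀ s : ℝ, HasDerivAt (fun s : ℝ => (f (x, s)).1) 0 s := by
    intro s
    obtain ⟨L, hL, hL'⟩ := hf (x, s)
    have h := hasDerivAt_along_fst hL' (0, 1)
    rw [fst_center hL] at h
    have h' : HasDerivAt (fun y : ℝ => (f (x, s + y)).1) 0 0 := by
      refine h.congr_of_eventuallyEq (Filter.Eventually.of_forall fun y => ?_)
      simp [hmul, hinv, omega_zero_right]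
    have h3 := HasDerivAt.comp_sub_const s s (by rw [sub_self]; exact h')
    simpa only [add_sub_cancel] using h3
  exact is_const_of_deriv_eq_zero (fun s => (key s).differentiableAt)
    (fun s => (key s).deriv) s t

/-- On each vertical line a bracket preserving map is affine. -/
theorem BracketDerivable.snd_eq [NeZero n] {f : H n → H n} (hf : BracketDerivable f)
    (x : E n) : ∃ a : ℝ, ∀ s t : ℝ, (f (x, s + t)).2 = (f (x, s)).2 + a * t := by
  have hor : ∀ (e : E n) (s : ℝ) (L : H n →L[ℝ] H n),
      HasFDerivAt (fun y => hmul (hinv (f (x, s))) (f (hmul (x, s) y))) L 0 →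
      HasDerivAt (fun t : ℝ => (f (x + t • e, 0)).1) (L (e, 0)).1 0 := by
    intro e s L hL
    have h := hasDerivAt_along_fst hL (e, 0)
    refine h.congr_of_eventuallyEq (Filter.Eventually.of_forall fun t => ?_)
    simp only [hmul, hinv, Prod.smul_mk, add_neg_cancel_left]
    exact hf.fst_eq _ _ _
  obtain ⟨L₀, hL₀, hL₀'⟩ := hf (x, 0)
  refine ⟨(L₀ (0, 1)).2, ?_⟩
  have key : ∀ s : ℝ, HasDerivAt (fun s : ℝ => (f (x, s)).2) (L₀ (0, 1)).2 s := by
    intro s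
    obtain ⟨L, hL, hL'⟩ := hf (x, s)
    have heq : (L (0, 1)).2 = (L₀ (0, 1)).2 := by
      rw [snd_center hL, snd_center hL₀, (hor _ s L hL').unique (hor _ 0 L₀ hL₀'),
        (hor _ s L hL').unique (hor _ 0 L₀ hL₀')]
    have h := hasDerivAt_along_snd hL' (0, 1)
    rw [heq] at h
    have h' : HasDerivAt (fun y : ℝ => (f (x, s + y)).2) (L₀ (0, 1)).2 0 := by
      refine h.congr_of_eventuallyEq (Filter.Eventually.of_forall fun y => ?_)
      have h1 := hf.fst_eq x (s + y) s
      have h2 : hmul (x, s) (y • ((0, 1) : H n)) = (x, s + y) := by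
        simp [hmul, omega_zero_right]
      simp only [h2]
      simp [hmul, hinv, omega_neg_left, h1, omega_self]
    have h3 := HasDerivAt.comp_sub_const s s (by rw [sub_self]; exact h')
    simpa only [add_sub_cancel] using h3
  have key2 : ∀ s : ℝ, HasDerivAt (fun s : ℝ => (f (x, s)).2 - (L₀ (0, 1)).2 * s) 0 s := by
    intro s
    have h := (key s).sub ((hasDerivAt_id s).const_mul (L₀ (0, 1)).2)
    rw [mul_one, sub_self] at h
    exact h
  intro s t
  have := is_const_of_deriv_eq_zero (fun s => (key2 s).differentiableAt)
    (fun s => (key2 s).deriv) (s + t) s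
  linarith

theorem conj_mem_vertDiff [NeZero n] {r : ℕ∞} {f v : H n ≃ₜ H n} (hf : f ∈ bracketDiff r n)
    (hv : v ∈ vertDiff r n) : f * v * f⁻¹ ∈ vertDiff r n := by
  refine ⟨mul_mem (mul_mem hf hv.1) (inv_mem hf), ?_⟩
  obtain ⟨F, hF⟩ := hv.2
  choose a ha using fun x => hf.2.2.1.1.snd_eq x
  refine ⟨fun y => a (f.symm (y, 0)).1 * F (f.symm (y, 0)).1, fun q => ?_⟩
  change f (v (f.symm q)) = _
  have h1 : (f.symm (q.1, 0)).1 = (f.symm q).1 := hf.2.2.1.2.fst_eq q.1 0 q.2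
  change _ = (q.1, q.2 + a (f.symm (q.1, 0)).1 * F (f.symm (q.1, 0)).1)
  rw [h1, hF]
  ext1
  · change (f ((f.symm q).1, (f.symm q).2 + F (f.symm q).1)).1 = q.1
    rw [hf.2.2.1.1.fst_eq _ _ (f.symm q).2]
    simp
  · rw [ha]
    simp

theorem conj_mem_cylSupport {f v : H n ≃ₜ H n} (hf : f ∈ cylSupport n)
    (hv : v ∈ cylSupport n) : f * v * f⁻¹ ∈ cylSupport n :=
  mul_mem (mul_mem hf hv) (inv_mem hf)

theorem conj_mem_vertDiffC [NeZero n] {r : ℕ∞} {f v : H n ≃ₜ H n} (hf : f ∈ volDiffC r n)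
    (hv : v ∈ vertDiffC r n) : f * v * f⁻¹ ∈ vertDiffC r n :=
  ⟨conj_mem_vertDiff hf.1.1 hv.1, conj_mem_cylSupport hf.2 hv.2⟩

end conj

/-! ### The group `HAM(H(n))_c` -/

/-- Pairs of homeomorphisms with the operation `(f, v)(g, w) = (f g, v f w f⁻¹)`: here `f, g` are
the components `.right` and `v, w` the components `.left`. -/
abbrev PairGroup (n : ℕ) : Type :=
  SemidirectProduct (H n ≃ₜ H n) (H n ≃ₜ H n) MulAut.conj

/-- `HAM(H(n))_c = Diff(H(n), vol)_c × Diff(H(n), vert)_c`, with the operation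
`(f, v)(g, w) = (f g, v f w f⁻¹)`. -/
def HAMc (r : ℕ∞) (n : ℕ) [NeZero n] : Subgroup (PairGroup n) where
  carrier := {g | g.right ∈ volDiffC r n ∧ g.left ∈ vertDiffC r n}
  one_mem' := ⟨one_mem _, one_mem _⟩
  mul_mem' := by
    rintro g h ⟨g1, g2⟩ ⟨h1, h2⟩
    refine ⟨mul_mem g1 h1, ?_⟩
    rw [SemidirectProduct.mul_left]
    exact mul_mem g2 (conj_mem_vertDiffC g1 h2)
  inv_mem' := by
    rintro g ⟨g1, g2⟩
    refine ⟨inv_mem g1, ?_⟩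
    rw [SemidirectProduct.inv_left]
    exact conj_mem_vertDiffC (inv_mem g1) (inv_mem g2)

/-- `HAM(H(n))_c` acts on `H(n)` by `(f, v) p = v (f p)`. -/
instance hamAction (r : ℕ∞) (n : ℕ) [NeZero n] : MulAction (HAMc r n) (H n) where
  smul g p := g.1.left (g.1.right p)
  one_smul _ := rfl
  mul_smul g h p := by
    change g.1.left (g.1.right (h.1.left (g.1.right.symm (g.1.right (h.1.right p))))) =
      g.1.left (g.1.right (h.1.left (h.1.right p)))
    rw [Homeomorph.symm_apply_apply]

/-- The normal subgroup `{id} × Diff(H(n), vert)_c` of `HAM(H(n))_c`: the pairs whose first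
component is the identity. -/
def vertInHAMc (r : ℕ∞) (n : ℕ) [NeZero n] : Subgroup (HAMc r n) :=
  (SemidirectProduct.rightHom.comp (HAMc r n).subtype).ker

instance vertInHAMc_normal (r : ℕ∞) (n : ℕ) [NeZero n] : (vertInHAMc r n).Normal := by
  unfold vertInHAMc
  infer_instance

/-! ### Symplectomorphisms of `ℝ^{2n}` -/

/-- A map of `ℝ^{2n}` preserves the symplectic form when it is derivable at every point and all its
differentials are in `Sp(n)`. -/
def PreservesOmega {n : ℕ} (φ : E n → E n) : Prop :=
  ∀ x, ∃ L : E n →L[ℝ] E n, HasFDerivAt φ L x ∧ ∀ u v, omega (L u) (L v) = omega u v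

theorem PreservesOmega.comp {n : ℕ} {φ ψ : E n → E n} (hφ : PreservesOmega φ)
    (hψ : PreservesOmega ψ) : PreservesOmega (φ ∘ ψ) := by
  intro x
  obtain ⟨L, hL, hL'⟩ := hψ x
  obtain ⟨M, hM, hM'⟩ := hφ (ψ x)
  exact ⟨M.comp L, hM.comp x hL, fun u v => by simp [hL', hM']⟩

/-- `Sympl(ℝ^{2n})`: locally bi-Lipschitz symplectomorphisms, of classical regularity `C^r` in both
directions (for `r ≥ 1` these are the `C^r` symplectomorphisms). -/
def sympl (r : ℕ∞) (n : ℕ) : Subgroup (E n ≃ₜ E n) where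
  carrier := {φ | (LocallyLipschitz φ ∧ LocallyLipschitz φ.symm) ∧
    (PreservesOmega φ ∧ PreservesOmega φ.symm) ∧ (ContDiff ℝ r φ ∧ ContDiff ℝ r φ.symm)}
  one_mem' := by
    have : PreservesOmega (fun x : E n => x) := fun x =>
      ⟨ContinuousLinearMap.id ℝ _, hasFDerivAt_id x, fun _ _ => rfl⟩
    exact ⟨⟨LocallyLipschitz.id, LocallyLipschitz.id⟩, ⟨this, this⟩, contDiff_id, contDiff_id⟩
  mul_mem' := by
    rintro f g ⟨⟨f2, f3⟩, ⟨f4, f5⟩, f6, f7⟩ ⟨⟨g2, g3⟩, ⟨g4, g5⟩, g6, g7⟩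
    exact ⟨⟨f2.comp g2, g3.comp f3⟩, ⟨f4.comp g4, g5.comp f5⟩, ⟨f6.comp g6, g7.comp f7⟩⟩
  inv_mem' := by
    rintro f ⟨⟨f2, f3⟩, ⟨f4, f5⟩, f6, f7⟩
    exact ⟨⟨f3, f2⟩, ⟨f5, f4⟩, ⟨f7, f6⟩⟩

/-- `Sympl(ℝ^{2n})_c`: symplectomorphisms which are the identity outside a compact set. -/
def symplC (r : ℕ∞) (n : ℕ) : Subgroup (E n ≃ₜ E n) where
  carrier := {φ | φ ∈ sympl r n ∧ ∃ K : Set (E n), IsCompact K ∧ ∀ x, x ∉ K → φ x = x}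
  one_mem' := ⟨one_mem _, ∅, isCompact_empty, fun _ _ => rfl⟩
  mul_mem' := by
    rintro f g ⟨hf, K, hK, h⟩ ⟨hg, K', hK', h'⟩
    refine ⟨mul_mem hf hg, K ∪ K', hK.union hK', fun p hp => ?_⟩
    change f (g p) = p
    rw [h' p fun hh => hp (Or.inr hh), h p fun hh => hp (Or.inl hh)]
  inv_mem' := by
    rintro f ⟨hf, K, hK, h⟩
    refine ⟨inv_mem hf, K, hK, fun p hp => ?_⟩
    change f.symm p = p
    rw [Homeomorph.symm_apply_eq, h p hp]

/-! ### The Hofer distance -/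

/-- A curve of transformations is `C^r` on `[0,1]`, jointly in time and space. -/
def IsSmoothCurve {X : Type*} [NormedAddCommGroup X] [NormedSpace ℝ X] (r : ℕ∞)
    (c : ℝ → X → X) : Prop :=
  ContDiffOn ℝ r (fun q : ℝ × X => c q.1 q.2) (Icc (0 : ℝ) 1 ×ˢ univ)

/-- The velocity at time `t ∈ [0,1]` of the curve `s ↦ c s x` (one sided at `t = 0, 1`). -/
def velocity {X Y : Type*} [NormedAddCommGroup Y] [NormedSpace ℝ Y]
    (c : ℝ → X → Y) (t : ℝ) (x : X) : Y :=
  derivWithin (fun s => c s x) (Icc (0 : ℝ) 1) t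

/-- `c` is, on `[0,1]`, a Hamiltonian flow of symplectomorphisms, generated by the compactly
supported time dependent Hamiltonian `h`: `ω(ċ_t(x), v) = dh_t(c_t(x)) v`. -/
def IsHamiltonianFlow {r : ℕ∞} {n : ℕ} (c : ℝ → symplC r n) (h : ℝ → E n → ℝ) : Prop :=
  IsSmoothCurve r (fun t x => (c t).1 x) ∧
  (∃ K : Set (E n), IsCompact K ∧ ∀ t ∈ Icc (0 : ℝ) 1, ∀ x, x ∉ K → h t x = 0) ∧
  ∀ t ∈ Icc (0 : ℝ) 1, ∀ x, ∃ L : E n →L[ℝ] ℝ, HasFDerivAt (h t) L ((c t).1 x) ∧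
    ∀ v, L v = omega (velocity (fun s y => (c s).1 y) t x) v

/-- The Hofer distance: the infimum of `∫₀¹ ‖h_t‖_∞ dt` over the Hamiltonian flows from `φ` to `ψ`
(`∞` when there are none). -/
def hoferDist {r : ℕ∞} {n : ℕ} (φ ψ : symplC r n) : ℝ≥0∞ :=
  ⨅ (c : ℝ → symplC r n) (h : ℝ → E n → ℝ) (_ : IsHamiltonianFlow c h)
    (_ : c 0 = φ) (_ : c 1 = ψ), ∫⁻ t in Icc (0 : ℝ) 1, ⨆ x, ‖h t x‖ₑ

/-- The connected component of the identity in `Sympl(ℝ^{2n})_c`: the symplectomorphisms joined to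
the identity by a `C^r` isotopy of symplectomorphisms supported in a common compact set. -/
def symplC0 (r : ℕ∞) (n : ℕ) : Set (symplC r n) :=
  {φ | ∃ c : ℝ → symplC r n, IsSmoothCurve r (fun t x => (c t).1 x) ∧
    (∃ K : Set (E n), IsCompact K ∧ ∀ t ∈ Icc (0 : ℝ) 1, ∀ x, x ∉ K → (c t).1 x = x) ∧
    c 0 = 1 ∧ c 1 = φ}

/-! ### The path distance on `HAM(H(n))_c` -/

/-- A `C^r` curve `t ↦ (f_t, v_t)` in `HAM(H(n))_c`, with supports in a common cylinder over a
compact set, is horizontal when for every `p` the curve `t ↦ f_t (v_t p)` is horizontal in `H(n)`. -/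
def IsHorizontalHAMCurve {r : ℕ∞} {n : ℕ} [NeZero n] (g : ℝ → HAMc r n) : Prop :=
  IsSmoothCurve r (fun t p => (g t).1.right p) ∧
  IsSmoothCurve r (fun t p => (g t).1.left p) ∧
  (∃ K : Set (E n), IsCompact K ∧ ∀ t ∈ Icc (0 : ℝ) 1, ∀ p : H n, p.1 ∉ K →
    (g t).1.right p = p ∧ (g t).1.left p = p) ∧
  ∀ t ∈ Icc (0 : ℝ) 1, ∀ p : H n, IsHorizontalVec ((g t).1.right ((g t).1.left p))
    (velocity (fun s q => (g s).1.right ((g s).1.left q)) t p)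

/-- The length `∫₀¹ ‖v̇_t‖_∞ dt` of a curve `t ↦ (f_t, v_t)`. -/
def hamLength {r : ℕ∞} {n : ℕ} [NeZero n] (g : ℝ → HAMc r n) : ℝ≥0∞ :=
  ∫⁻ t in Icc (0 : ℝ) 1, ⨆ p : H n, ‖velocity (fun s q => (g s).1.left q) t p‖ₑ

/-- The path distance `dist` on `HAM(H(n))_c` (`∞` when no horizontal curve joins the points). -/
def hamDist {r : ℕ∞} {n : ℕ} [NeZero n] (A B : HAMc r n) : ℝ≥0∞ :=
  ⨅ (g : ℝ → HAMc r n) (_ : IsHorizontalHAMCurve g) (_ : g 0 = A) (_ : g 1 = B), hamLength g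

/-- The distance induced by `dist` on the factor group: the distance of two cosets. -/
def hamQuotDist {r : ℕ∞} {n : ℕ} [NeZero n] (a b : HAMc r n ⧸ vertInHAMc r n) : ℝ≥0∞ :=
  ⨅ (A : HAMc r n) (B : HAMc r n) (_ : (A : HAMc r n ⧸ vertInHAMc r n) = a)
    (_ : (B : HAMc r n ⧸ vertInHAMc r n) = b), hamDist A B

/-! ### Invariants -/

/-- The Borel sets. -/
def borelSets (X : Type*) [MeasurableSpace X] : Set (Set X) := {A | MeasurableSet A}

/-- The bounded Borel sets. -/
def bddBorelSets (X : Type*) [MeasurableSpace X] [Bornology X] : Set (Set X) :=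
  {A | MeasurableSet A ∧ Bornology.IsBounded A}

/-- `c`, as a function on the sets of the class `D`, is invariant under the group `G`. -/
def IsInvariant {X Y : Type*} [TopologicalSpace X] (G : Subgroup (X ≃ₜ X)) (D : Set (Set X))
    (c : Set X → Y) : Prop :=
  ∀ f ∈ G, ∀ A ∈ D, c (f '' A) = c A

/-- Monotonicity: `c A ≤ c B` if some `f ∈ G` maps `A` into `B`. -/
def IsMonotoneUnder {X : Type*} [TopologicalSpace X] (G : Subgroup (X ≃ₜ X)) (D : Set (Set X))
    (c : Set X → ℝ≥0∞) : Prop :=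
  ∀ f ∈ G, ∀ A ∈ D, ∀ B ∈ D, f '' A ⊆ B → c A ≤ c B

/-- Conformality on `H(n)`: `c (δ_ε A) = ε² c A` for the dilations `δ_ε`, `ε > 0`. -/
def IsConformalH {n : ℕ} (D : Set (Set (H n))) (c : Set (H n) → ℝ≥0∞) : Prop :=
  ∀ ε : ℝ, 0 < ε → ∀ A ∈ D, c (dil ε '' A) = ENNReal.ofReal (ε ^ 2) * c A

/-- Conformality on `ℝ^{2n}`: `c (ε A) = ε² c A` for `ε ≠ 0`. -/
def IsConformalE {n : ℕ} (D : Set (Set (E n))) (c : Set (E n) → ℝ≥0∞) : Prop :=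
  ∀ ε : ℝ, ε ≠ 0 → ∀ A ∈ D, c ((fun x => ε • x) '' A) = ENNReal.ofReal (ε ^ 2) * c A

/-- The function induced by `c` on the subsets of the orbit space `ℝ^{2n}`: a subset `A` of the
orbit space is the same as the union `A × ℝ` of the corresponding orbits. -/
def descend {n : ℕ} {Y : Type*} (c : Set (H n) → Y) (A : Set (E n)) : Y :=
  c (Prod.fst ⁻¹' A)

/-- The set of values of `c` on the bounded Borel sets of `H(n)` which project onto `A`. -/
def fibreValues {n : ℕ} {Y : Type*} (c : Set (H n) → Y) (A : Set (E n)) : Set Y :=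
  {y | ∃ B ∈ bddBorelSets (H n), Prod.fst '' B = A ∧ c B = y}

end Heis

end

open Heis

noncomputable section

namespace Heis

/-! ### The symplectic form as a continuous bilinear map -/

section symplectic
variable {n : ℕ}

/-! Everything rests on contact lifts. Put `λ_x = ½ω(x, ·)`, so that horizontal curves are those
with `dx̄ = λ` along them. For a symplectic map `φ`, the map `(x, x̄) ↦ (φ x, x̄ + F x)` carries
horizontal curves to horizontal curves as soon as `dF = φ*λ - λ`, which is `IsContactLift`. The form
`φ*λ - λ` is formally closed because `φ` preserves `ω`. When `r = 0` the differential of `φ` need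
not be continuous, so the Poincaré lemma does not apply. It is replaced by Goursat's argument:
`locallyAlmostExact_contactForm` shows that the form is exact up to a small error near each point,
and repeated subdivision of a triangle then forces its boundary integral to vanish
(`triInt_eq_zero`, `exists_primitive_of_locallyAlmostExact`). For `φ` with compact support `F` is
constant on the connected exterior of a ball, so it can be normalised to vanish there. Contact lifts
multiply the length of horizontal curves by at most a local Lipschitz constant of `φ`, hence are
locally Lipschitz for the Carnot-Caratheodory distance.

Conversely, let `f` be in `Diff(H(n), vol)_c`. Bracket derivability makes `f` map vertical lines to
vertical lines, affinely, with a slope `a(x)`. A horizontal segment of length `s` has an image whose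
end points are `O(s)` apart, and two points at Carnot-Caratheodory distance `d` differ in height,
after left translation, by `O(d²)`. So the differential of `f` preserves horizontal directions.
Comparing this at two heights over the same point gives `da = 0`, and `a = 1` by the support
condition. Hence `f` is the contact lift of a symplectic map (`volDiffC_structure`), and the support
condition makes the lift unique. So `hamToSympl` is onto with kernel the vertical subgroup, which
gives `Ψ`.

For the distances, let `f_t` lift `φ_t` with vertical part `F_t` and let `v_t` be the shift by
`G_t`. Horizontality of `t ↦ f_t(v_t p)` says `Ġ + Ḟ = ½ω(φ, φ̇)`. Differentiating `dF = φ*λ - λ` in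
time (Cartan's formula, `hasFDerivAt_sub_half_omega`) shows that `k = Ḟ - ½ω(φ, φ̇)` satisfies `dk =
ω(φ̇, Dφ ·)`, that is, `k = h ∘ φ` for the Hamiltonian `h`. So horizontality means `Ġ = -h ∘ φ`, and
`‖v̇_t‖_∞ = ‖h_t‖_∞`. A horizontal curve thus projects to a Hamiltonian flow with no greater length
(`hoferDist_le_hamLength`). A Hamiltonian flow lifts from any prescribed starting point by
integrating `Ġ = -k` (`exists_horizontal_lift`). Both infima therefore agree. The same `k` shows
that every compactly supported isotopy is Hamiltonian, which identifies the elements at finite Hofer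
distance from the identity.

For the invariants, a lift `f` of `φ` satisfies `π ∘ f = φ ∘ π`, so it carries sets over `A` to sets
over `φ(A)`. The dilations of `H(n)` cover the positive homotheties, and `-id`, being symplectic,
takes care of the negative ones. -/

theorem omega_smul_left (a : ℝ) (x y : E n) : omega (a • x) y = a * omega x y := by
  rw [omega_swap, omega_smul_right, omega_swap y x]; ring

theorem omega_neg_right (x y : E n) : omega x (-y) = -omega x y := by
  rw [omega_swap, omega_neg_left, omega_swap y x, neg_neg]

theorem omega_sub_left (x y z : E n) : omega (x - y) z = omega x z - omega y z := by
  rw [sub_eq_add_neg, omega_add_left, omega_neg_left, sub_eq_add_neg]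

theorem omega_sub_right (x y z : E n) : omega x (y - z) = omega x y - omega x z := by
  rw [sub_eq_add_neg, omega_add_right, omega_neg_right, sub_eq_add_neg]

/-- The symplectic form as a bilinear map. -/
def omegaLin (n : ℕ) : E n →ₗ[ℝ] E n →ₗ[ℝ] ℝ :=
  LinearMap.mk₂ ℝ omega omega_add_left omega_smul_left omega_add_right omega_smul_right

/-- The symplectic form as a continuous bilinear map. -/
def omegaL (n : ℕ) : E n →L[ℝ] E n →L[ℝ] ℝ := (omegaLin n).toContinuousBilinearMap

@[simp] theorem omegaL_apply (x y : E n) : omegaL n x y = omega x y := rfl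

theorem abs_omega_le (x y : E n) : |omega x y| ≤ ‖omegaL n‖ * ‖x‖ * ‖y‖ :=
  (omegaL n).le_opNorm₂ x y

theorem omega_single_inr (x : E n) (i : Fin n) :
    omega x (EuclideanSpace.single (Sum.inr i) 1) = x (Sum.inl i) := by
  simp [omega]

theorem omega_single_inl (x : E n) (i : Fin n) :
    omega x (EuclideanSpace.single (Sum.inl i) 1) = -x (Sum.inr i) := by
  simp [omega]

theorem eq_zero_of_omega_eq_zero {x : E n} (h : ∀ y, omega x y = 0) : x = 0 := by
  ext i
  rcases i with i | i
  · simpa [omega_single_inr] using h (EuclideanSpace.single (Sum.inr i) 1)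
  · simpa [omega_single_inl] using h (EuclideanSpace.single (Sum.inl i) 1)

/-- In a basis the hypothesis reads `LᵀJL = J`. Nondegeneracy makes `J` invertible, so the square of
the determinant of `L` is 1. -/
theorem abs_det_of_symplectic {L : E n →L[ℝ] E n} (hL : ∀ u v, omega (L u) (L v) = omega u v) :
    |L.det| = 1 := by
  let b := (EuclideanSpace.basisFun (Fin n ⊕ Fin n) ℝ).toBasis
  have h0 : (LinearMap.toMatrix₂ b b (omegaLin n)).det ≠ 0 := by
    rw [← LinearMap.separatingLeft_iff_det_ne_zero]
    exact fun x hx => eq_zero_of_omega_eq_zero hx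
  have h1 : (omegaLin n).compl₁₂ (L : E n →ₗ[ℝ] E n) (L : E n →ₗ[ℝ] E n) = omegaLin n :=
    LinearMap.ext₂ fun u v => hL u v
  have h2 := congrArg Matrix.det (LinearMap.toMatrix₂_compl₁₂ b b b b (omegaLin n)
    (L : E n →ₗ[ℝ] E n) (L : E n →ₗ[ℝ] E n))
  rw [h1, Matrix.det_mul, Matrix.det_mul, Matrix.det_transpose, LinearMap.det_toMatrix] at h2
  have h3 : L.det * L.det = 1 := by
    have : LinearMap.det (L : E n →ₗ[ℝ] E n) = L.det := rfl
    rw [this] at h2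
    apply mul_left_cancel₀ h0
    linarith
  rw [← sq_eq_sq₀ (abs_nonneg _) zero_le_one, sq_abs, sq, h3, one_pow]

/-- The change of variables formula for injective maps needs only differentiability at every point,
so no continuity of the differential enters and `r = 0` is covered. -/
theorem measurePreserving_of_preservesOmega (φ : E n ≃ₜ E n) (h : PreservesOmega φ) :
    MeasurePreserving φ volume volume := by
  choose L hL hL' using h
  have key : ∀ s : Set (E n), MeasurableSet s → volume (φ '' s) = volume s := by
    intro s hs
    rw [← lintegral_abs_det_fderiv_eq_addHaar_image volume hs
      (fun x _ => (hL x).hasFDerivWithinAt) φ.injective.injOn]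
    simp [abs_det_of_symplectic (hL' _)]
  refine ⟨φ.continuous.measurable, ?_⟩
  ext s hs
  rw [Measure.map_apply φ.continuous.measurable hs, ← key _ (φ.continuous.measurable hs),
    image_preimage_eq _ φ.surjective]

end symplectic

/-! ### Lifts of homeomorphisms of `ℝ^{2n}` to `H(n)` -/

section lift
variable {n : ℕ}

/-- The homeomorphism `(x, x̄) ↦ (φ x, x̄ + F x)`. -/
def liftHomeo (φ : E n ≃ₜ E n) (F : E n → ℝ) (hF : Continuous F) : H n ≃ₜ H n where
  toFun p := (φ p.1, p.2 + F p.1)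
  invFun q := (φ.symm q.1, q.2 + -F (φ.symm q.1))
  left_inv p := by simp
  right_inv q := by simp
  continuous_toFun := by fun_prop
  continuous_invFun := by fun_prop

@[simp] theorem liftHomeo_apply (φ : E n ≃ₜ E n) (F : E n → ℝ) (hF : Continuous F) (p : H n) :
    liftHomeo φ F hF p = (φ p.1, p.2 + F p.1) := rfl

theorem liftHomeo_symm (φ : E n ≃ₜ E n) (F : E n → ℝ) (hF : Continuous F) :
    (liftHomeo φ F hF).symm =
      liftHomeo φ.symm (fun x => -F (φ.symm x)) (hF.comp φ.symm.continuous).neg :=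
  Homeomorph.ext fun _ => rfl

theorem locallyLipschitz_lift {φ : E n → E n} {F : E n → ℝ} (hφ : LocallyLipschitz φ)
    (hF : LocallyLipschitz F) : LocallyLipschitz (fun p : H n => (φ p.1, p.2 + F p.1)) := by
  have h1 : LocallyLipschitz (fun p : H n => p.1) := LipschitzWith.prod_fst.locallyLipschitz
  have h2 : LocallyLipschitz (fun p : H n => p.2) := LipschitzWith.prod_snd.locallyLipschitz
  exact (hφ.comp h1).prodMk (h2.add (hF.comp h1))

/-- Only the symplectic differential of `φ` matters: the shift by `F` contributes a linear form in
the first coordinate with values in the centre, which does not affect brackets. So `F` may be any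
differentiable function, and taking `φ = id` covers the vertical maps. -/
theorem bracketDerivable_lift {φ : E n → E n} {F : E n → ℝ} (hφ : PreservesOmega φ)
    (hF : Differentiable ℝ F) : BracketDerivable (fun p : H n => (φ p.1, p.2 + F p.1)) := by
  intro p
  obtain ⟨L, hL, hL'⟩ := hφ p.1
  let fst := ContinuousLinearMap.fst ℝ (E n) ℝ
  let snd := ContinuousLinearMap.snd ℝ (E n) ℝ
  -- The three terms come from the product `p y`, from `F`, and from the left translation by the
  -- inverse of the image of `p`. Their sum vanishes exactly when `F` satisfies the contact equation
  -- at `p.1`.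
  let ell : E n →L[ℝ] ℝ := (1 / 2 : ℝ) • omegaL n p.1 + fderiv ℝ F p.1 -
    (1 / 2 : ℝ) • (omegaL n (φ p.1)).comp L
  refine ⟨(L.comp fst).prod (snd + ell.comp fst), fun u v => ?_, ?_⟩
  · ext1
    · simp [hmul, fst]
    · simp [hmul, fst, snd, hL']
      ring
  · have h1 : HasFDerivAt (fun y : H n => p.1 + y.1) fst 0 :=
      (ContinuousLinearMap.hasFDerivAt fst).const_add _
    have hL1 : HasFDerivAt (fun y : H n => φ (p.1 + y.1)) (L.comp fst) 0 :=
      HasFDerivAt.comp (g := φ) (0 : H n) (by simpa using hL) h1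
    have hF1 : HasFDerivAt (fun y : H n => F (p.1 + y.1)) ((fderiv ℝ F p.1).comp fst) 0 :=
      HasFDerivAt.comp (g := F) (0 : H n) (by simpa using (hF p.1).hasFDerivAt) h1
    have e1 : HasFDerivAt (fun y : H n => -φ p.1 + φ (p.1 + y.1)) (L.comp fst) 0 :=
      hL1.const_add _
    have e2 : HasFDerivAt (fun y : H n => -(p.2 + F p.1) + (p.2 + y.2 + (1 / 2) * omega p.1 y.1 +
        F (p.1 + y.1)) + (1 / 2) * omega (-φ p.1) (φ (p.1 + y.1))) (snd + ell.comp fst) 0 := by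
      have a1 : HasFDerivAt (fun y : H n => p.2 + y.2) snd 0 :=
        (ContinuousLinearMap.hasFDerivAt snd).const_add _
      have a2 : HasFDerivAt (fun y : H n => (1 / 2) * omega p.1 y.1)
          ((1 / 2 : ℝ) • (omegaL n p.1).comp fst) 0 :=
        (((omegaL n p.1).comp fst).hasFDerivAt).const_mul _
      have a3 : HasFDerivAt (fun y : H n => (1 / 2) * omega (-φ p.1) (φ (p.1 + y.1)))
          ((1 / 2 : ℝ) • (omegaL n (-φ p.1)).comp (L.comp fst)) 0 :=
        (((omegaL n (-φ p.1)).hasFDerivAt).comp (0 : H n) hL1).const_mul _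
      refine ((((a1.add a2).add hF1).const_add _).add a3).congr_fderiv ?_
      ext v <;> simp [ell, fst, snd] <;> ring
    exact e1.prodMk e2

/-- Fubini: the base map preserves volume and every fibre is translated. -/
theorem measurePreserving_liftHomeo (φ : E n ≃ₜ E n) (F : E n → ℝ) (hF : Continuous F)
    (hφ : PreservesOmega φ) : MeasurePreserving (liftHomeo φ F hF) volume volume := by
  refine MeasurePreserving.skew_product (g := fun x s => s + F x)
    (measurePreserving_of_preservesOmega φ hφ) (by fun_prop) (Filter.Eventually.of_forall fun x => ?_)
  exact map_add_right_eq_self volume (F x)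

theorem liftHomeo_mem_bracketDiff {r : ℕ∞} {φ : E n ≃ₜ E n} {F : E n → ℝ} (hφ : φ ∈ sympl r n)
    (hL : LocallyLipschitz F) (hd : Differentiable ℝ F) (hr : ContDiff ℝ r F) :
    liftHomeo φ F hL.continuous ∈ bracketDiff r n := by
  obtain ⟨⟨a1, a2⟩, ⟨a3, a4⟩, a5, a6⟩ := hφ
  have d : Differentiable ℝ φ.symm := fun x => by
    obtain ⟨L, hL, -⟩ := a4 x
    exact hL.differentiableAt
  refine ⟨measurePreserving_liftHomeo φ F _ a3, ⟨locallyLipschitz_lift a1 hL, ?_⟩,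
    ⟨bracketDerivable_lift a3 hd, ?_⟩, ?_, ?_⟩
  · rw [liftHomeo_symm]
    exact locallyLipschitz_lift a2 (hL.comp a2).neg
  · rw [liftHomeo_symm]
    exact bracketDerivable_lift a4 (hd.comp d).neg
  · exact (a5.comp contDiff_fst).prodMk (contDiff_snd.add (hr.comp contDiff_fst))
  · rw [liftHomeo_symm]
    exact (a6.comp contDiff_fst).prodMk (contDiff_snd.add ((hr.comp a6).neg.comp contDiff_fst))

/-- `F` is the vertical part of a contact lift of the symplectic map `φ`: its differential is the
difference of the pull back by `φ` of the primitive `½ω(x, ·)` of `ω` and of this primitive. -/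
def IsContactLift (φ : E n → E n) (F : E n → ℝ) : Prop :=
  ∀ x, ∃ L : E n →L[ℝ] E n, HasFDerivAt φ L x ∧ (∀ u v, omega (L u) (L v) = omega u v) ∧
    HasFDerivAt F ((1 / 2 : ℝ) • ((omegaL n (φ x)).comp L - omegaL n x)) x

theorem IsContactLift.preservesOmega {φ : E n → E n} {F : E n → ℝ} (h : IsContactLift φ F) :
    PreservesOmega φ := fun x => by
  obtain ⟨L, h1, h2, -⟩ := h x
  exact ⟨L, h1, h2⟩

theorem IsContactLift.differentiable {φ : E n → E n} {F : E n → ℝ} (h : IsContactLift φ F) :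
    Differentiable ℝ F := fun x => by
  obtain ⟨L, -, -, h⟩ := h x
  exact h.differentiableAt

/-- Pulling `dF = φ*λ - λ` back by the inverse of `φ` and changing the sign gives the contact
equation of the inverse. -/
theorem IsContactLift.symm {φ : E n ≃ₜ E n} {F : E n → ℝ} (h : IsContactLift φ F)
    (h' : PreservesOmega φ.symm) : IsContactLift φ.symm (fun x => -F (φ.symm x)) := by
  intro x
  obtain ⟨L, hL, hL', hF⟩ := h (φ.symm x)
  obtain ⟨M, hM, hM'⟩ := h' x
  refine ⟨M, hM, hM', ?_⟩
  have hLM : ∀ u, L (M u) = u := by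
    have h1 : HasFDerivAt (φ ∘ φ.symm) (L.comp M) x := hL.comp x hM
    have h2 : φ ∘ φ.symm = id := by funext y; simp
    rw [h2] at h1
    exact fun u => congrArg (fun T : E n →L[ℝ] E n => T u) (h1.unique (hasFDerivAt_id x))
  refine ((hF.comp x hM).neg).congr_fderiv ?_
  ext u
  simp [hLM]
  ring

theorem IsContactLift.fderiv_eq {φ : E n → E n} {F : E n → ℝ} (h : IsContactLift φ F) (x : E n) :
    fderiv ℝ F x = (1 / 2 : ℝ) • ((omegaL n (φ x)).comp (fderiv ℝ φ x) - omegaL n x) := by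
  obtain ⟨L, hL, -, hF⟩ := h x
  rw [hF.fderiv, hL.fderiv]

/-- Closed balls are compact, so one Lipschitz constant serves a whole ball and bounds the
derivative inside. This boundedness replaces continuity of the derivative when `r = 0`. -/
theorem _root_.LocallyLipschitz.exists_norm_fderiv_le {X Y : Type*} [NormedAddCommGroup X]
    [NormedSpace ℝ X] [ProperSpace X] [NormedAddCommGroup Y] [NormedSpace ℝ Y] {f : X → Y}
    (hf : LocallyLipschitz f) (x : X) (R : ℝ) :
    ∃ K : ℝ≥0, LipschitzOnWith K f (Metric.closedBall x R) ∧
      ∀ y ∈ Metric.ball x R, ‖fderiv ℝ f y‖ ≤ K := by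
  obtain ⟨K, hK⟩ := hf.locallyLipschitzOn.exists_lipschitzOnWith_of_compact
    (isCompact_closedBall x R)
  refine ⟨K, hK, fun y hy => ?_⟩
  exact norm_fderiv_le_of_lipschitzOn ℝ
    (Filter.mem_of_superset (Metric.isOpen_ball.mem_nhds hy) Metric.ball_subset_closedBall) hK

theorem _root_.locallyLipschitz_of_bounded_fderiv {X Y : Type*} [NormedAddCommGroup X]
    [NormedSpace ℝ X] [NormedAddCommGroup Y] [NormedSpace ℝ Y] {f : X → Y}
    (hf : Differentiable ℝ f) (hb : ∀ x, ∃ C : ℝ, ∀ y ∈ Metric.ball x 1, ‖fderiv ℝ f y‖ ≤ C) :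
    LocallyLipschitz f := by
  intro x
  obtain ⟨C, hC⟩ := hb x
  refine ⟨C.toNNReal, Metric.ball x 1, Metric.ball_mem_nhds x one_pos, ?_⟩
  exact (convex_ball x 1).lipschitzOnWith_of_nnnorm_fderiv_le (fun y _ => hf y) fun y hy => by
    rw [← NNReal.coe_le_coe]
    exact (hC y hy).trans (Real.le_coe_toNNReal C)

/-- The contact equation expresses `dF` through `φ` and its differential, both of which are locally
bounded. -/
theorem IsContactLift.locallyLipschitz {φ : E n → E n} {F : E n → ℝ} (h : IsContactLift φ F)
    (hφ : LocallyLipschitz φ) : LocallyLipschitz F := by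
  refine locallyLipschitz_of_bounded_fderiv h.differentiable fun x => ?_
  obtain ⟨K, hK, hK'⟩ := hφ.exists_norm_fderiv_le x 1
  refine ⟨(1 / 2) * (‖omegaL n‖ * (‖φ x‖ + K) * K + ‖omegaL n‖ * (‖x‖ + 1)), fun y hy => ?_⟩
  have hy' := Metric.mem_ball.1 hy
  have n1 : ‖φ y‖ ≤ ‖φ x‖ + K := by
    have := hK.dist_le_mul y (Metric.ball_subset_closedBall hy) x (Metric.mem_closedBall_self zero_le_one)
    have h2 : dist (φ y) (φ x) ≤ K := this.trans (by nlinarith [K.2, hy'.le])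
    have := norm_le_norm_add_norm_sub' (φ y) (φ x)
    rw [dist_eq_norm] at h2
    linarith
  have n2 : ‖y‖ ≤ ‖x‖ + 1 := by
    have := norm_le_norm_add_norm_sub' y x
    rw [dist_eq_norm] at hy'
    linarith
  rw [h.fderiv_eq, norm_smul, Real.norm_of_nonneg (by norm_num)]
  gcongr
  refine (norm_sub_le _ _).trans ?_
  gcongr
  · refine (ContinuousLinearMap.opNorm_comp_le _ _).trans ?_
    gcongr
    · exact ((omegaL n).le_opNorm _).trans (by gcongr)
    · exact hK' y hy
  · exact ((omegaL n).le_opNorm _).trans (by gcongr)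

/-- The differential of `F` involves only first derivatives of `φ`, so `F` is at least as regular as
`φ`. For `r = 0` only continuity is asked, and differentiability gives it. -/
theorem IsContactLift.contDiff {r : ℕ∞} {φ : E n → E n} {F : E n → ℝ} (h : IsContactLift φ F)
    (hφ : ContDiff ℝ r φ) : ContDiff ℝ r F := by
  rcases eq_or_ne r 0 with rfl | hr
  · exact contDiff_zero.2 h.differentiable.continuous
  · obtain ⟨m, rfl⟩ : ∃ m : ℕ∞, r = m + 1 := by
      induction r using ENat.recTopCoe with
      | top => exact ⟨⊤, rfl⟩
      | coe k =>
        obtain ⟨j, rfl⟩ := Nat.exists_eq_succ_of_ne_zero (by simpa using hr : k ≠ 0)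
        exact ⟨j, by simp⟩
    push_cast at hφ ⊢
    have h1 := contDiff_succ_iff_fderiv.1 hφ
    refine contDiff_succ_iff_fderiv.2 ⟨h.differentiable, by simp, ?_⟩
    rw [funext h.fderiv_eq]
    have h2 : ContDiff ℝ m φ := hφ.of_le le_self_add
    exact (((((omegaL n).contDiff).comp h2).clm_comp h1.2.2).sub (omegaL n).contDiff).const_smul _

end lift

/-! ### A Goursat type theorem for one-forms -/

section goursat
variable {X : Type*} [NormedAddCommGroup X] [NormedSpace ℝ X]

/-- The integral of a one-form along the segment from `x` to `y`. -/
def segInt (α : X → X →L[ℝ] ℝ) (x y : X) : ℝ := ∫ t in (0 : ℝ)..1, α (x + t • (y - x)) (y - x)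

/-- The one-form `α` is integrable along all segments. -/
def SegIntegrable (α : X → X →L[ℝ] ℝ) : Prop :=
  ∀ x y, IntervalIntegrable (fun t : ℝ => α (x + t • (y - x)) (y - x)) volume 0 1

/-- Near every point `x₀`, the one-form `α` differs from an exact one by `o(‖w - x₀‖)`. -/
def LocallyAlmostExact (α : X → X →L[ℝ] ℝ) : Prop :=
  ∀ x₀, ∀ ε > 0, ∃ δ > 0, ∃ (B : X → ℝ) (B' : X → X →L[ℝ] ℝ), ∀ w ∈ Metric.ball x₀ δ,
    HasFDerivAt B (B' w) w ∧ ‖α w - B' w‖ ≤ ε * ‖w - x₀‖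

theorem segInt_symm (α : X → X →L[ℝ] ℝ) (x y : X) : segInt α y x = -segInt α x y := by
  have h := intervalIntegral.integral_comp_sub_left
    (fun t : ℝ => α (x + t • (y - x)) (y - x)) (a := 0) (b := 1) 1
  simp only [sub_self, sub_zero] at h
  rw [segInt, segInt, ← h, ← intervalIntegral.integral_neg]
  refine intervalIntegral.integral_congr fun t _ => ?_
  have : y + t • (x - y) = x + (1 - t) • (y - x) := by module
  simp only [this]
  rw [← neg_sub y x, map_neg]

theorem segInt_midpoint {α : X → X →L[ℝ] ℝ} (hα : SegIntegrable α) (x y : X) :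
    segInt α x y = segInt α x (midpoint ℝ x y) + segInt α (midpoint ℝ x y) y := by
  have hm : midpoint ℝ x y = x + (1 / 2 : ℝ) • (y - x) := by
    rw [midpoint_eq_smul_add]; simp only [invOf_eq_inv]; module
  set G : ℝ → ℝ := fun t => α (x + t • (y - x)) (y - x) with hG
  have h1 : segInt α x (midpoint ℝ x y) = ∫ t in (0 : ℝ)..(1 / 2), G t := by
    have h := intervalIntegral.integral_comp_div G (a := 0) (b := 1) (two_ne_zero)
    simp only [zero_div] at h
    have h' : segInt α x (midpoint ℝ x y) = (1 / 2) * ∫ t in (0 : ℝ)..1, G (t / 2) := by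
      rw [segInt, ← intervalIntegral.integral_const_mul]
      refine intervalIntegral.integral_congr fun t _ => ?_
      have e1 : x + t • (midpoint ℝ x y - x) = x + (t / 2) • (y - x) := by rw [hm]; module
      have e2 : midpoint ℝ x y - x = (1 / 2 : ℝ) • (y - x) := by rw [hm]; module
      simp only [e1, hG]
      rw [e2, map_smul, smul_eq_mul]
    rw [h', h, smul_eq_mul]; ring
  have h2 : segInt α (midpoint ℝ x y) y = ∫ t in (1 / 2 : ℝ)..1, G t := by
    have h := intervalIntegral.integral_comp_div_add G (a := 0) (b := 1) (two_ne_zero) (1 / 2)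
    have h' : segInt α (midpoint ℝ x y) y = (1 / 2) * ∫ t in (0 : ℝ)..1, G (t / 2 + 1 / 2) := by
      rw [segInt, ← intervalIntegral.integral_const_mul]
      refine intervalIntegral.integral_congr fun t _ => ?_
      have e1 : midpoint ℝ x y + t • (y - midpoint ℝ x y) = x + (t / 2 + 1 / 2) • (y - x) := by
        rw [hm]; module
      have e2 : y - midpoint ℝ x y = (1 / 2 : ℝ) • (y - x) := by rw [hm]; module
      simp only [e1, hG]
      rw [e2, map_smul, smul_eq_mul]
    rw [h', h, smul_eq_mul]
    norm_num
    ring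
  have hi : IntervalIntegrable G volume 0 1 := hα x y
  rw [h1, h2]
  refine (intervalIntegral.integral_add_adjacent_intervals ?_ ?_).symm
  · exact hi.mono_set (by rw [uIcc_of_le (by norm_num), uIcc_of_le (by norm_num)]
                          exact Icc_subset_Icc_right (by norm_num))
  · exact hi.mono_set (by rw [uIcc_of_le (by norm_num), uIcc_of_le (by norm_num)]
                          exact Icc_subset_Icc_left (by norm_num))

/-- The exact part integrates to the difference of the values of `B`. The remainder is at most `ε ρ`
in norm along the segment, which stays in the ball of radius `ρ` by convexity. -/
theorem abs_segInt_sub_le {α : X → X →L[ℝ] ℝ} (hα : SegIntegrable α) {x₀ : X} {ε δ ρ : ℝ}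
    {B : X → ℝ} {B' : X → X →L[ℝ] ℝ} (hε : 0 ≤ ε)
    (hB : ∀ w ∈ Metric.ball x₀ δ, HasFDerivAt B (B' w) w ∧ ‖α w - B' w‖ ≤ ε * ‖w - x₀‖)
    (hρ : ρ < δ) {x y : X} (hx : x ∈ Metric.closedBall x₀ ρ) (hy : y ∈ Metric.closedBall x₀ ρ) :
    |segInt α x y - (B y - B x)| ≤ ε * ρ * ‖y - x‖ := by
  have hmem : ∀ t ∈ Icc (0 : ℝ) 1, x + t • (y - x) ∈ Metric.closedBall x₀ ρ := fun t ht =>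
    (convex_closedBall x₀ ρ).add_smul_sub_mem hx hy ht
  have hball : ∀ t ∈ Icc (0 : ℝ) 1, x + t • (y - x) ∈ Metric.ball x₀ δ := fun t ht =>
    Metric.closedBall_subset_ball hρ (hmem t ht)
  have hder : ∀ t ∈ Icc (0 : ℝ) 1, HasDerivAt (fun t : ℝ => B (x + t • (y - x)))
      (B' (x + t • (y - x)) (y - x)) t := by
    intro t ht
    have h1 : HasDerivAt (fun t : ℝ => x + t • (y - x)) (y - x) t := by
      simpa using ((hasDerivAt_id t).smul_const (y - x)).const_add x
    exact (hB _ (hball t ht)).1.comp_hasDerivAt t h1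
  have hbound : ∀ t ∈ Icc (0 : ℝ) 1,
      ‖α (x + t • (y - x)) (y - x) - B' (x + t • (y - x)) (y - x)‖ ≤ ε * ρ * ‖y - x‖ := by
    intro t ht
    have h1 := (hB _ (hball t ht)).2
    have h2 : ‖x + t • (y - x) - x₀‖ ≤ ρ := by
      rw [← dist_eq_norm]; exact hmem t ht
    rw [← sub_apply]
    refine (ContinuousLinearMap.le_opNorm _ _).trans ?_
    gcongr
    exact h1.trans (by gcongr)
  -- `B'` is not assumed continuous. Along the segment it is a derivative, hence measurable, and it
  -- is integrable because it differs from the integrable `α` by a bounded measurable function.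
  have hmeas : AEStronglyMeasurable (fun t : ℝ => B' (x + t • (y - x)) (y - x))
      (volume.restrict (uIoc (0 : ℝ) 1)) := by
    refine (aestronglyMeasurable_deriv (fun t : ℝ => B (x + t • (y - x))) _).congr ?_
    filter_upwards [ae_restrict_mem measurableSet_uIoc] with t ht
    rw [uIoc_of_le zero_le_one] at ht
    exact (hder t (Ioc_subset_Icc_self ht)).deriv
  have hdiff : IntervalIntegrable (fun t : ℝ => α (x + t • (y - x)) (y - x) -
      B' (x + t • (y - x)) (y - x)) volume 0 1 := by
    rw [intervalIntegrable_iff]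
    refine Integrable.mono' (g := fun _ => ε * ρ * ‖y - x‖) (integrableOn_const (by simp)) ?_ ?_
    · exact ((intervalIntegrable_iff.1 (hα x y)).aestronglyMeasurable).sub hmeas
    · filter_upwards [ae_restrict_mem measurableSet_uIoc] with t ht
      rw [uIoc_of_le zero_le_one] at ht
      exact hbound t (Ioc_subset_Icc_self ht)
  have hint : IntervalIntegrable (fun t : ℝ => B' (x + t • (y - x)) (y - x)) volume 0 1 := by
    have := (hα x y).sub hdiff
    refine this.congr fun t _ => ?_
    simp
  have hftc : ∫ t in (0 : ℝ)..1, B' (x + t • (y - x)) (y - x) = B y - B x := by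
    rw [intervalIntegral.integral_eq_sub_of_hasDerivAt (f := fun t : ℝ => B (x + t • (y - x)))
      (fun t ht => hder t (by rwa [uIcc_of_le zero_le_one] at ht)) hint]
    simp
  rw [segInt, ← hftc, ← intervalIntegral.integral_sub (hα x y) hint]
  have := intervalIntegral.norm_integral_le_of_norm_le_const
    (a := 0) (b := 1) (C := ε * ρ * ‖y - x‖)
    (f := fun t : ℝ => α (x + t • (y - x)) (y - x) - B' (x + t • (y - x)) (y - x))
    (fun t ht => by
      rw [uIoc_of_le zero_le_one] at ht
      exact hbound t (Ioc_subset_Icc_self ht))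
  simpa using this

/-- The integral of a one-form along the boundary of a triangle. -/
def triInt (α : X → X →L[ℝ] ℝ) (T : X × X × X) : ℝ :=
  segInt α T.1 T.2.1 + segInt α T.2.1 T.2.2 + segInt α T.2.2 T.1

/-- The perimeter of a triangle. -/
def perimeter (T : X × X × X) : ℝ := dist T.1 T.2.1 + dist T.2.1 T.2.2 + dist T.2.2 T.1

/-- Midpoint subdivision as in Goursat's theorem: the inner edges cancel, so one of the four
triangles carries at least a quarter of the integral. The vertices are ordered so that the first
vertex of each small triangle is `x` or the midpoint of an edge at `x`, which makes the sequence of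
first vertices Cauchy under iteration. -/
theorem exists_quarter_triangle {α : X → X →L[ℝ] ℝ} (hα : SegIntegrable α) (T : X × X × X) :
    ∃ T' : X × X × X, |triInt α T| ≤ 4 * |triInt α T'| ∧ perimeter T' = perimeter T / 2 ∧
      dist T.1 T'.1 ≤ perimeter T / 2 := by
  obtain ⟨x, y, z⟩ := T
  set a := midpoint ℝ x y
  set b := midpoint ℝ y z
  set c := midpoint ℝ z x
  have ha : a = (1 / 2 : ℝ) • (x + y) := by simp [a, midpoint_eq_smul_add]
  have hb : b = (1 / 2 : ℝ) • (y + z) := by simp [b, midpoint_eq_smul_add]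
  have hc : c = (1 / 2 : ℝ) • (z + x) := by simp [c, midpoint_eq_smul_add]
  have hsum : triInt α (x, y, z) = triInt α (x, a, c) + triInt α (a, y, b) + triInt α (c, b, z) +
      triInt α (a, b, c) := by
    simp only [triInt]
    rw [segInt_midpoint hα x y, segInt_midpoint hα y z, segInt_midpoint hα z x,
      segInt_symm α a c, segInt_symm α b a, segInt_symm α c b]
    ring
  have half : ∀ p q u v : X, p - q = (1 / 2 : ℝ) • (u - v) → dist p q = dist u v / 2 := by
    intro p q u v h
    rw [dist_eq_norm, h, norm_smul, dist_eq_norm]; norm_num; ring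
  have dxa := half x a x y (by rw [ha]; module)
  have dac := half a c y z (by rw [ha, hc]; module)
  have dcx := half c x z x (by rw [hc]; module)
  have day := half a y x y (by rw [ha]; module)
  have dyb := half y b y z (by rw [hb]; module)
  have dba := half b a z x (by rw [hb, ha]; module)
  have dcb := half c b x y (by rw [hc, hb]; module)
  have dbz := half b z y z (by rw [hb]; module)
  have dzc := half z c z x (by rw [hc]; module)
  have dab := half a b x z (by rw [ha, hb]; module)
  have dbc := half b c y x (by rw [hb, hc]; module)
  have dca := half c a z y (by rw [hc, ha]; module)
  have dxc : dist x c = dist z x / 2 := by rw [dist_comm]; exact dcx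
  have p1 := dist_nonneg (x := x) (y := y)
  have p2 := dist_nonneg (x := y) (y := z)
  have p3 := dist_nonneg (x := z) (y := x)
  by_contra! hcon
  have e1 : 4 * |triInt α (x, a, c)| < |triInt α (x, y, z)| := by
    by_contra! h
    have := hcon (x, a, c) h (by simp only [perimeter]; rw [dxa, dac, dcx]; ring)
    simp only [perimeter, dist_self] at this
    linarith
  have e2 : 4 * |triInt α (a, y, b)| < |triInt α (x, y, z)| := by
    by_contra! h
    have := hcon (a, y, b) h (by simp only [perimeter]; rw [day, dyb, dba]; ring)
    simp only [perimeter] at this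
    linarith
  have e3 : 4 * |triInt α (c, b, z)| < |triInt α (x, y, z)| := by
    by_contra! h
    have := hcon (c, b, z) h (by simp only [perimeter]; rw [dcb, dbz, dzc]; ring)
    simp only [perimeter] at this
    linarith
  have e4 : 4 * |triInt α (a, b, c)| < |triInt α (x, y, z)| := by
    by_contra! h
    have := hcon (a, b, c) h (by
      simp only [perimeter]
      rw [dab, dbc, dca, dist_comm x z, dist_comm y x, dist_comm z y]; ring)
    simp only [perimeter] at this
    linarith
  have e5 : |triInt α (x, y, z)| ≤ |triInt α (x, a, c)| + |triInt α (a, y, b)| +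
      |triInt α (c, b, z)| + |triInt α (a, b, c)| := by
    rw [hsum]
    exact (abs_add_le _ _).trans (add_le_add_left ((abs_add_le _ _).trans
      (add_le_add_left (abs_add_le _ _) _)) _)
  linarith

/-- After `k` subdivisions the integral has lost at most a factor `4 ^ k`. Near the limit point
almost exactness bounds it by `ε` times radius times perimeter, and both are of order `2 ^ (-k)`.
The powers cancel and `ε` is arbitrary. -/
theorem triInt_eq_zero [CompleteSpace X] {α : X → X →L[ℝ] ℝ} (hα : SegIntegrable α)
    (hα' : LocallyAlmostExact α) (T : X × X × X) : triInt α T = 0 := by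
  choose next h1 h2 h3 using exists_quarter_triangle hα
  let S : ℕ → X × X × X := fun k => next^[k] T
  have hS : ∀ k, S (k + 1) = next (S k) := fun k => Function.iterate_succ_apply' next k T
  have hper : ∀ k, perimeter (S k) = perimeter T / 2 ^ k := by
    intro k
    induction k with
    | zero => simp [S]
    | succ k ih => rw [hS, h2, ih, pow_succ]; field_simp
  have htri : ∀ k, |triInt α T| ≤ 4 ^ k * |triInt α (S k)| := by
    intro k
    induction k with
    | zero => simp [S]
    | succ k ih =>
      refine ih.trans ?_
      rw [hS, pow_succ, mul_assoc]
      gcongr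
      exact h1 _
  have hdist : ∀ k, dist (S k).1 (S (k + 1)).1 ≤ perimeter T / 2 / 2 ^ k := by
    intro k
    rw [hS]
    refine (h3 _).trans (le_of_eq ?_)
    rw [hper]; ring
  obtain ⟨x₀, hx₀⟩ := cauchySeq_tendsto_of_complete (cauchySeq_of_le_geometric_two hdist)
  have hlim : ∀ k, dist (S k).1 x₀ ≤ perimeter T / 2 ^ k :=
    fun k => dist_le_of_le_geometric_two_of_tendsto hdist hx₀ k
  have hP : 0 ≤ perimeter T := by unfold perimeter; positivity
  set P := perimeter T
  have hmain : ∀ ε > 0, |triInt α T| ≤ 4 * P ^ 2 * ε := by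
    intro ε hε
    obtain ⟨δ, hδ, B, B', hB⟩ := hα' x₀ ε hε
    have ht : Filter.Tendsto (fun k : ℕ => 2 * P / 2 ^ k) Filter.atTop (𝓝 0) := by
      have := (tendsto_pow_atTop_nhds_zero_of_lt_one (r := (1 / 2 : ℝ)) (by norm_num)
        (by norm_num)).const_mul (2 * P)
      simpa [div_eq_mul_inv] using this
    obtain ⟨k, hk⟩ := (ht.eventually_lt_const hδ).exists
    -- The first vertex is within `P / 2 ^ k` of the limit point and the other two are within one
    -- perimeter, again `P / 2 ^ k`, of the first.
    set ρ := 2 * P / 2 ^ k with hρ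
    have hpk : 0 ≤ P / 2 ^ k := by positivity
    have hρ2 : ρ = P / 2 ^ k + P / 2 ^ k := by rw [hρ]; ring
    obtain ⟨x, y, z, hT⟩ : ∃ x y z, S k = (x, y, z) := ⟨_, _, _, rfl⟩
    have hp := hper k
    have hl := hlim k
    rw [hT] at hp hl
    simp only [perimeter] at hp
    have q1 := dist_nonneg (x := x) (y := y)
    have q2 := dist_nonneg (x := y) (y := z)
    have q3 := dist_nonneg (x := z) (y := x)
    have mx : x ∈ Metric.closedBall x₀ ρ := by
      rw [Metric.mem_closedBall]; change dist x x₀ ≤ _ at hl; linarith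
    have my : y ∈ Metric.closedBall x₀ ρ := by
      rw [Metric.mem_closedBall]; change dist x x₀ ≤ _ at hl
      have := dist_triangle y x x₀
      rw [dist_comm y x] at this
      linarith
    have mz : z ∈ Metric.closedBall x₀ ρ := by
      rw [Metric.mem_closedBall]; change dist x x₀ ≤ _ at hl
      have := dist_triangle z x x₀
      linarith
    have b1 := abs_segInt_sub_le hα hε.le hB hk mx my
    have b2 := abs_segInt_sub_le hα hε.le hB hk my mz
    have b3 := abs_segInt_sub_le hα hε.le hB hk mz mx
    rw [← dist_eq_norm] at b1 b2 b3
    have hfin : |triInt α (S k)| ≤ ε * ρ * (P / 2 ^ k) := by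
      rw [hT]
      have : triInt α (x, y, z) = (segInt α x y - (B y - B x)) + (segInt α y z - (B z - B y)) +
          (segInt α z x - (B x - B z)) := by simp only [triInt]; ring
      rw [this, ← hp]
      refine (abs_add_three _ _ _).trans ?_
      rw [dist_comm y x] at b1
      rw [dist_comm z y] at b2
      rw [dist_comm x z] at b3
      rw [mul_add, mul_add]
      exact add_le_add (add_le_add b1 b2) b3
    refine (htri k).trans ?_
    calc 4 ^ k * |triInt α (S k)| ≤ 4 ^ k * (ε * ρ * (P / 2 ^ k)) := by gcongr
      _ = 2 * P ^ 2 * ε := by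
        have : (4 : ℝ) ^ k = 2 ^ k * 2 ^ k := by rw [← mul_pow]; norm_num
        rw [this, hρ]; field_simp
      _ ≤ 4 * P ^ 2 * ε := by nlinarith [sq_nonneg P, mul_nonneg (sq_nonneg P) hε.le]
  have hz : |triInt α T| ≤ 0 := by
    refine le_of_forall_pos_le_add fun η hη => ?_
    have hq : 0 < 4 * P ^ 2 + 1 := by positivity
    refine (hmain (η / (4 * P ^ 2 + 1)) (by positivity)).trans ?_
    rw [zero_add, ← mul_div_assoc, div_le_iff₀ hq]
    nlinarith [sq_nonneg P]
  exact abs_nonpos_iff.1 hz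

/-- A one-form which is exact up to `o(‖w - x₀‖)` near every point `x₀` is exact. -/
theorem exists_primitive_of_locallyAlmostExact [CompleteSpace X] {α : X → X →L[ℝ] ℝ}
    (hα : SegIntegrable α) (hα' : LocallyAlmostExact α) :
    ∃ F : X → ℝ, ∀ x, HasFDerivAt F (α x) x := by
  refine ⟨fun x => segInt α 0 x, fun x₀ => ?_⟩
  have hF : ∀ y, segInt α 0 y - segInt α 0 x₀ = segInt α x₀ y := by
    intro y
    have := triInt_eq_zero hα hα' (0, x₀, y)
    simp only [triInt] at this
    rw [segInt_symm α 0 y] at this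
    linarith
  obtain ⟨δ, hδ, B, B', hB⟩ := hα' x₀ 1 one_pos
  have h0 := hB x₀ (Metric.mem_ball_self hδ)
  have hB0 : B' x₀ = α x₀ := by
    have := h0.2
    rw [sub_self, norm_zero, mul_zero] at this
    exact (sub_eq_zero.1 (norm_le_zero_iff.1 this)).symm
  -- Since triangle integrals vanish, increments of the candidate primitive from `x₀` are segment
  -- integrals. The estimate with `ε = 1` and `ρ = dist y x₀` then makes the difference from `B`
  -- quadratically small, so both functions have the same derivative at `x₀`.
  have h1 : HasFDerivAt (fun y => segInt α 0 y - B y) (0 : X →L[ℝ] ℝ) x₀ := by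
    have hO : (fun y => segInt α 0 y - B y - (segInt α 0 x₀ - B x₀)) =O[𝓝 x₀]
        fun y => ‖y - x₀‖ ^ 2 := by
      refine Asymptotics.IsBigO.of_bound 1 ?_
      filter_upwards [Metric.ball_mem_nhds x₀ hδ] with y hy
      have := abs_segInt_sub_le hα zero_le_one hB (ρ := dist y x₀) hy
        (Metric.mem_closedBall_self dist_nonneg) (Metric.mem_closedBall.2 le_rfl)
      rw [← hF y] at this
      rw [Real.norm_eq_abs, norm_pow, norm_norm, sq, one_mul]
      rw [dist_eq_norm, one_mul] at this
      refine le_trans (le_of_eq ?_) this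
      congr 1; ring
    rw [hasFDerivAt_iff_isLittleO]
    simp only [zero_apply, sub_zero]
    refine hO.trans_isLittleO ?_
    have := (Asymptotics.isLittleO_norm_pow_id (E' := X) one_lt_two).comp_tendsto
      (tendsto_sub_nhds_zero_iff.2 (Filter.tendsto_id (x := 𝓝 x₀)))
    simpa [Function.comp_def] using this
  have h2 := h1.add h0.1
  rw [hB0, zero_add] at h2
  refine h2.congr_of_eventuallyEq (Filter.Eventually.of_forall fun y => ?_)
  simp

end goursat

/-! ### Existence and uniqueness of contact lifts -/

section contact
variable {n : ℕ}

/-- The differential of the vertical part of a contact lift of `φ`. -/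
def contactForm (φ : E n → E n) (x : E n) : E n →L[ℝ] ℝ :=
  (1 / 2 : ℝ) • ((omegaL n (φ x)).comp (fderiv ℝ φ x) - omegaL n x)

theorem PreservesOmega.hasFDerivAt {φ : E n → E n} (h : PreservesOmega φ) (x : E n) :
    HasFDerivAt φ (fderiv ℝ φ x) x := by
  obtain ⟨L, hL, -⟩ := h x
  rw [hL.fderiv]; exact hL

theorem PreservesOmega.omega_fderiv {φ : E n → E n} (h : PreservesOmega φ) (x u v : E n) :
    omega (fderiv ℝ φ x u) (fderiv ℝ φ x v) = omega u v := by
  obtain ⟨L, hL, hL'⟩ := h x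
  rw [hL.fderiv]; exact hL' u v

/-- Along a segment the differential of `φ` applied to the direction is the derivative of a function
of one variable, hence measurable, and the local Lipschitz property bounds it. -/
theorem segIntegrable_contactForm {φ : E n → E n} (hφ : LocallyLipschitz φ)
    (h : PreservesOmega φ) : SegIntegrable (contactForm φ) := by
  have hD := h.hasFDerivAt
  intro x y
  have hγ : ∀ t : ℝ, HasDerivAt (fun t : ℝ => x + t • (y - x)) (y - x) t := fun t => by
    simpa using ((hasDerivAt_id t).smul_const (y - x)).const_add x
  have hγc : Continuous fun t : ℝ => x + t • (y - x) := by fun_prop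
  have hφc : Continuous fun t : ℝ => φ (x + t • (y - x)) := hφ.continuous.comp hγc
  have hd : ∀ t : ℝ, deriv (fun t : ℝ => φ (x + t • (y - x))) t =
      fderiv ℝ φ (x + t • (y - x)) (y - x) :=
    fun t => ((hD _).comp_hasDerivAt t (hγ t)).deriv
  have hm : Measurable fun t : ℝ => fderiv ℝ φ (x + t • (y - x)) (y - x) := by
    simp_rw [← hd]
    exact measurable_deriv _
  have hrepr : (fun t : ℝ => contactForm φ (x + t • (y - x)) (y - x)) = fun t : ℝ => (1 / 2 : ℝ) *
      (omegaL n (φ (x + t • (y - x))) (fderiv ℝ φ (x + t • (y - x)) (y - x)) -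
        omegaL n (x + t • (y - x)) (y - x)) := by
    funext t; simp [contactForm]
  rw [hrepr, intervalIntegrable_iff]
  obtain ⟨K, hK, hK'⟩ := hφ.exists_norm_fderiv_le x (‖y - x‖ + 1)
  have hball : ∀ t ∈ Icc (0 : ℝ) 1, x + t • (y - x) ∈ Metric.ball x (‖y - x‖ + 1) := by
    intro t ht
    rw [Metric.mem_ball, dist_eq_norm, add_sub_cancel_left, norm_smul, Real.norm_of_nonneg ht.1]
    nlinarith [norm_nonneg (y - x), ht.2]
  obtain ⟨M, hM⟩ := (isCompact_Icc (a := (0 : ℝ)) (b := 1)).exists_bound_of_continuousOn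
    hφc.continuousOn
  obtain ⟨M', hM'⟩ := (isCompact_Icc (a := (0 : ℝ)) (b := 1)).exists_bound_of_continuousOn
    hγc.continuousOn
  refine Integrable.mono' (g := fun _ => (1 / 2) * (‖omegaL n‖ * M * (K * ‖y - x‖) +
    ‖omegaL n‖ * M' * ‖y - x‖)) (integrableOn_const (by simp)) ?_ ?_
  · have h1 := (omegaL n).aestronglyMeasurable_comp₂ hφc.aestronglyMeasurable
      hm.aestronglyMeasurable (μ := volume.restrict (uIoc (0 : ℝ) 1))
    have h2 : Continuous fun t : ℝ => omegaL n (x + t • (y - x)) (y - x) := by fun_prop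
    exact (h1.sub h2.aestronglyMeasurable).const_mul _
  · filter_upwards [ae_restrict_mem measurableSet_uIoc] with t ht
    rw [uIoc_of_le zero_le_one] at ht
    replace ht := Ioc_subset_Icc_self ht
    have hM0 : 0 ≤ M := (norm_nonneg _).trans (hM t ht)
    rw [norm_mul, Real.norm_of_nonneg (by norm_num : (0 : ℝ) ≤ 1 / 2)]
    gcongr
    refine (norm_sub_le _ _).trans (add_le_add ?_ ?_)
    · refine ((omegaL n).le_opNorm₂ _ _).trans ?_
      gcongr
      · exact hM t ht
      · refine (ContinuousLinearMap.le_opNorm _ _).trans ?_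
        gcongr
        exact hK' _ (hball t ht)
    · refine ((omegaL n).le_opNorm₂ _ _).trans ?_
      gcongr
      exact hM' t ht

/-- Write `φ = P + R` with `P w = p₀ + L w` the affine approximation at `x₀`. Since `L` is
symplectic, `ω(w, v) = ω(L w, L v)`, and expanding `φ*λ - λ` leaves the exact form `½ d(ω(p₀, L w) +
ω(P, R))` plus the error `½ω(R, (Dφ + L) ·)`. The derivative of `R`, which need not be small, occurs
in the exact part. The error is small because `R` is `o(‖w - x₀‖)` and `Dφ` is bounded. -/
theorem locallyAlmostExact_contactForm {φ : E n → E n} (hφ : LocallyLipschitz φ)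
    (h : PreservesOmega φ) : LocallyAlmostExact (contactForm φ) := by
  have hD := h.hasFDerivAt
  have hS := h.omega_fderiv
  intro x₀ ε hε
  obtain ⟨K, -, hK⟩ := hφ.exists_norm_fderiv_le x₀ 1
  set L := fderiv ℝ φ x₀ with hL
  set p₀ := φ x₀ - L x₀ with hp₀
  -- `C` dominates the factor multiplying `‖R‖` in the error. The added 1 makes it positive, so that
  -- `R` can be required to be at most `ε / C` times the distance.
  set C := (1 / 2) * ‖omegaL n‖ * (K + ‖L‖) + 1 with hC
  have hCpos : 0 < C := by positivity
  have ho := (hasFDerivAt_iff_isLittleO.1 (hD x₀)).bound (div_pos hε hCpos)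
  obtain ⟨δ, hδ, hball⟩ := Metric.mem_nhds_iff.1 ho
  refine ⟨min δ 1, lt_min hδ one_pos,
    fun w => (1 / 2 : ℝ) * (omegaL n p₀ (L w) + omegaL n (p₀ + L w) (φ w - (p₀ + L w))),
    fun w => (1 / 2 : ℝ) • ((omegaL n p₀).comp L + (((omegaL n).flip (φ w - (p₀ + L w))).comp L +
      (omegaL n (p₀ + L w)).comp (fderiv ℝ φ w - L))), fun w hw => ⟨?_, ?_⟩⟩
  · have hLw : HasFDerivAt (fun w => L w) L w := L.hasFDerivAt
    have hP : HasFDerivAt (fun w => p₀ + L w) L w := hLw.const_add _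
    have hR : HasFDerivAt (fun w => φ w - (p₀ + L w)) (fderiv ℝ φ w - L) w := (hD w).sub hP
    have h1 : HasFDerivAt (fun w => omegaL n p₀ (L w)) ((omegaL n p₀).comp L) w :=
      (omegaL n p₀).hasFDerivAt.comp w hLw
    have h2 := ((omegaL n).hasFDerivAt.comp w hP).clm_apply hR
    refine ((h1.add h2).const_mul (1 / 2 : ℝ)).congr_fderiv ?_
    ext v
    simp
    ring
  · have hR : ‖φ w - (p₀ + L w)‖ ≤ ε / C * ‖w - x₀‖ := by
      have := hball (Metric.ball_subset_ball (min_le_left _ _) hw)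
      simp only [mem_ofPred_eq] at this
      have e : φ w - (p₀ + L w) = φ w - φ x₀ - L (w - x₀) := by rw [hp₀, map_sub]; abel
      rwa [e]
    have heq : contactForm φ w - (1 / 2 : ℝ) • ((omegaL n p₀).comp L +
        (((omegaL n).flip (φ w - (p₀ + L w))).comp L +
        (omegaL n (p₀ + L w)).comp (fderiv ℝ φ w - L))) =
        (1 / 2 : ℝ) • (omegaL n (φ w - (p₀ + L w))).comp (fderiv ℝ φ w + L) := by
      ext v
      have e1 := hS x₀ w v
      rw [← hL] at e1
      simp [contactForm, e1,
        omega_swap (L v)]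
      ring
    rw [heq, norm_smul, Real.norm_of_nonneg (by norm_num)]
    have hKw := hK w (Metric.ball_subset_ball (min_le_right _ _) hw)
    calc (1 / 2) * ‖(omegaL n (φ w - (p₀ + L w))).comp (fderiv ℝ φ w + L)‖
        ≤ (1 / 2) * (‖omegaL n‖ * (ε / C * ‖w - x₀‖) * (K + ‖L‖)) := by
          gcongr
          refine (ContinuousLinearMap.opNorm_comp_le _ _).trans ?_
          gcongr
          · exact ((omegaL n).le_opNorm _).trans (by gcongr)
          · exact (norm_add_le _ _).trans (by gcongr)
      _ = ε * ‖w - x₀‖ * (((1 / 2) * ‖omegaL n‖ * (K + ‖L‖)) / C) := by ring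
      _ ≤ ε * ‖w - x₀‖ * 1 := by
          gcongr
          rw [div_le_one hCpos, hC]
          linarith
      _ = ε * ‖w - x₀‖ := mul_one _

theorem exists_isContactLift {φ : E n → E n} (hφ : LocallyLipschitz φ) (h : PreservesOmega φ) :
    ∃ F : E n → ℝ, IsContactLift φ F := by
  obtain ⟨F, hF⟩ := exists_primitive_of_locallyAlmostExact (segIntegrable_contactForm hφ h)
    (locallyAlmostExact_contactForm hφ h)
  exact ⟨F, fun x => ⟨_, h.hasFDerivAt x, h.omega_fderiv x, hF x⟩⟩

theorem IsContactLift.ext {φ : E n → E n} {F G : E n → ℝ} (hF : IsContactLift φ F)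
    (hG : IsContactLift φ G) {x₀ : E n} (h : F x₀ = G x₀) : F = G := by
  have h1 : ∀ x, fderiv ℝ (F - G) x = 0 := fun x => by
    rw [fderiv_sub (hF.differentiable x) (hG.differentiable x), hF.fderiv_eq, hG.fderiv_eq, sub_self]
  funext x
  have := is_const_of_fderiv_eq_zero (hF.differentiable.sub hG.differentiable) h1 x x₀
  simp only [Pi.sub_apply, h, sub_self] at this
  linarith

/-- The dimension `2n` is at least 2, so the punctured space is connected. Pushing it radially
outwards by `R` maps it onto the exterior of the ball. -/
theorem isPreconnected_norm_gt [NeZero n] {R : ℝ} (hR : 0 ≤ R) :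
    IsPreconnected {x : E n | R < ‖x‖} := by
  have hrank : 1 < Module.rank ℝ (E n) := by
    rw [← Module.finrank_eq_rank, finrank_euclideanSpace]
    have := NeZero.pos n
    rw [Fintype.card_sum, Fintype.card_fin]
    exact_mod_cast (by omega : 1 < n + n)
  have h0 : IsPreconnected ({0}ᶜ : Set (E n)) :=
    (isConnected_compl_singleton_of_one_lt_rank hrank 0).isPreconnected
  have himg : {x : E n | R < ‖x‖} = (fun x : E n => ((R + ‖x‖) / ‖x‖) • x) '' {0}ᶜ := by
    ext y
    constructor
    · intro hy
      have hy' : R < ‖y‖ := hy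
      have hy0 : ‖y‖ ≠ 0 := by linarith
      have hpos : 0 < ‖y‖ - R := by linarith
      refine ⟨((‖y‖ - R) / ‖y‖) • y, ?_, ?_⟩
      · simp only [mem_compl_iff, mem_singleton_iff, smul_eq_zero, not_or]
        exact ⟨div_ne_zero hpos.ne' hy0, norm_ne_zero_iff.1 hy0⟩
      · have hn : ‖((‖y‖ - R) / ‖y‖) • y‖ = ‖y‖ - R := by
          rw [norm_smul, Real.norm_of_nonneg (by positivity)]; field_simp
        simp only [hn, smul_smul]
        have : (R + (‖y‖ - R)) / (‖y‖ - R) * ((‖y‖ - R) / ‖y‖) = 1 := by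
          field_simp; ring
        rw [this, one_smul]
    · rintro ⟨x, hx, rfl⟩
      have hx0 : 0 < ‖x‖ := norm_pos_iff.2 hx
      change R < ‖((R + ‖x‖) / ‖x‖) • x‖
      rw [norm_smul, Real.norm_of_nonneg (by positivity), div_mul_cancel₀ _ hx0.ne']
      linarith
  rw [himg]
  refine h0.image _ ?_
  have hc : ContinuousOn (fun x : E n => (R + ‖x‖) / ‖x‖) {0}ᶜ :=
    ContinuousOn.div (by fun_prop) (by fun_prop) fun x hx => norm_ne_zero_iff.2 hx
  exact hc.smul continuousOn_id

theorem IsContactLift.fderiv_eq_zero {φ : E n → E n} {F : E n → ℝ} (hF : IsContactLift φ F)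
    {x : E n} (h : φ =ᶠ[𝓝 x] id) : fderiv ℝ F x = 0 := by
  rw [hF.fderiv_eq, h.fderiv_eq, h.eq_of_nhds, fderiv_id]
  ext v; simp

/-- A symplectic map which is the identity outside a ball has a contact lift whose vertical part
vanishes outside this ball. -/
theorem exists_isContactLift_of_support [NeZero n] {φ : E n → E n} (hφ : LocallyLipschitz φ)
    (h : PreservesOmega φ) {R : ℝ} (hR : 0 ≤ R) (hsupp : ∀ x, R < ‖x‖ → φ x = x) :
    ∃ F : E n → ℝ, IsContactLift φ F ∧ ∀ x, R < ‖x‖ → F x = 0 := by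
  obtain ⟨F, hF⟩ := exists_isContactLift hφ h
  have hopen : IsOpen {x : E n | R < ‖x‖} := isOpen_lt continuous_const continuous_norm
  obtain ⟨x₀, hx₀⟩ : ∃ x₀ : E n, R < ‖x₀‖ := NormedSpace.exists_lt_norm ℝ _ R
  refine ⟨fun x => F x - F x₀, fun x => ?_, fun x hx => ?_⟩
  · obtain ⟨L, h1, h2, h3⟩ := hF x
    exact ⟨L, h1, h2, h3.sub_const _⟩
  · have hz : ∀ y ∈ {x : E n | R < ‖x‖}, fderiv ℝ F y = 0 := fun y hy =>
      hF.fderiv_eq_zero (Filter.mem_of_superset (hopen.mem_nhds hy) fun z hz => hsupp z hz)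
    change F x - F x₀ = 0
    rw [hopen.is_const_of_fderiv_eq_zero (isPreconnected_norm_gt hR)
      hF.differentiable.differentiableOn hz hx hx₀, sub_self]

end contact

/-! ### Absolutely continuous curves -/

section ac
variable {X Y : Type*} [PseudoMetricSpace X] [PseudoMetricSpace Y]

theorem _root_.LipschitzOnWith.comp_absolutelyContinuousOnInterval {g : X → Y} {K : ℝ≥0}
    {s : Set X} (hg : LipschitzOnWith K g s) {c : ℝ → X} {a b : ℝ}
    (hc : AbsolutelyContinuousOnInterval c a b) (hs : MapsTo c (uIcc a b) s) :
    AbsolutelyContinuousOnInterval (g ∘ c) a b := by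
  rw [absolutelyContinuousOnInterval_iff] at hc ⊢
  intro ε hε
  have hK : (0 : ℝ) < K + 1 := by positivity
  obtain ⟨δ, hδ, h⟩ := hc (ε / (K + 1)) (by positivity)
  refine ⟨δ, hδ, fun I hI hlen => ?_⟩
  have h1 := h I hI hlen
  rw [lt_div_iff₀ hK, Finset.sum_mul] at h1
  refine lt_of_le_of_lt (Finset.sum_le_sum fun i hi => ?_) h1
  have := hI.1 i hi
  calc dist (g (c (I.2 i).1)) (g (c (I.2 i).2)) ≤ K * dist (c (I.2 i).1) (c (I.2 i).2) :=
        hg.dist_le_mul _ (hs this.1) _ (hs this.2)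
    _ ≤ dist (c (I.2 i).1) (c (I.2 i).2) * (K + 1) := by
        nlinarith [dist_nonneg (x := c (I.2 i).1) (y := c (I.2 i).2)]

theorem _root_.AbsolutelyContinuousOnInterval.ae_differentiableAt_Icc {V : Type*}
    [NormedAddCommGroup V] [NormedSpace ℝ V] [FiniteDimensional ℝ V] {c : ℝ → V} {a b : ℝ}
    (hc : AbsolutelyContinuousOnInterval c a b) :
    ∀ᵐ t ∂(volume.restrict (Icc a b)), DifferentiableAt ℝ c t := by
  have h1 := hc.boundedVariationOn.locallyBoundedVariationOn.ae_differentiableWithinAt_of_mem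
  rw [← restrict_Ioo_eq_restrict_Icc]
  filter_upwards [ae_restrict_of_ae h1, ae_restrict_mem measurableSet_Ioo] with t ht hmem
  refine (ht ?_).differentiableAt ?_
  · exact Icc_subset_uIcc (Ioo_subset_Icc_self hmem)
  · exact Filter.mem_of_superset (Icc_mem_nhds hmem.1 hmem.2) Icc_subset_uIcc

/-- The fundamental theorem of calculus for absolutely continuous functions. Extended norms let the
bound be applied to curves of possibly infinite length. -/
theorem _root_.AbsolutelyContinuousOnInterval.enorm_sub_le {f : ℝ → ℝ}
    (hf : AbsolutelyContinuousOnInterval f 0 1) {g : ℝ → ℝ≥0∞}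
    (h : ∀ᵐ t ∂(volume.restrict (Icc (0 : ℝ) 1)), ‖deriv f t‖ₑ ≤ g t) {t : ℝ}
    (ht : t ∈ Icc (0 : ℝ) 1) : ‖f t - f 0‖ₑ ≤ ∫⁻ s in Icc (0 : ℝ) 1, g s := by
  have hsub : uIcc 0 t ⊆ uIcc (0 : ℝ) 1 := by
    rw [uIcc_of_le ht.1, uIcc_of_le zero_le_one]
    exact Icc_subset_Icc_right ht.2
  rw [← (hf.mono hsub).integral_deriv_eq_sub, intervalIntegral.integral_of_le ht.1]
  refine (enorm_integral_le_lintegral_enorm _).trans ?_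
  refine (lintegral_mono_set ((Ioc_subset_Icc_self).trans (Icc_subset_Icc_right ht.2))).trans ?_
  exact lintegral_mono_ae h

end ac

/-! ### The Carnot-Caratheodory distance -/

section cc
variable {n : ℕ}

/-- The length of a curve in `H(n)`, as used in the Carnot-Caratheodory distance. -/
def ccLength (c : ℝ → H n) : ℝ≥0∞ := ∫⁻ t in Icc (0 : ℝ) 1, ‖(deriv c t).1‖ₑ

theorem ccDist_le_ccLength {c : ℝ → H n} (hc : IsHorizontalCurve c) :
    ccDist (c 0) (c 1) ≤ ccLength c :=
  iInf₂_le_of_le c hc (iInf₂_le_of_le rfl rfl le_rfl)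

theorem exists_curve_of_ccDist_lt {p q : H n} {b : ℝ≥0∞} (h : ccDist p q < b) :
    ∃ c : ℝ → H n, IsHorizontalCurve c ∧ c 0 = p ∧ c 1 = q ∧ ccLength c < b := by
  simp only [ccDist, iInf_lt_iff] at h
  obtain ⟨c, h1, h2, h3, h4⟩ := h
  exact ⟨c, h1, h2, h3, h4⟩

theorem ac_clm {V : Type*} [NormedAddCommGroup V] [NormedSpace ℝ V] {c : ℝ → V} (T : V →L[ℝ] ℝ)
    (hc : AbsolutelyContinuousOnInterval c 0 1) :
    AbsolutelyContinuousOnInterval (fun t => T (c t)) 0 1 :=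
  T.lipschitz.lipschitzOnWith (s := univ) |>.comp_absolutelyContinuousOnInterval hc (mapsTo_univ _ _)

/-- Pairing the curve with its own displacement `v` reduces to a scalar function: `‖v‖²` is at most
`‖v‖` times the length. -/
theorem IsHorizontalCurve.enorm_fst_sub_le {c : ℝ → H n} (hc : IsHorizontalCurve c) {t : ℝ}
    (ht : t ∈ Icc (0 : ℝ) 1) : ‖(c t).1 - (c 0).1‖ₑ ≤ ccLength c := by
  set v := (c t).1 - (c 0).1 with hv
  rcases eq_or_ne v 0 with h0 | h0
  · rw [h0]; simp
  have h1 := (ac_clm ((innerSL ℝ v).comp (ContinuousLinearMap.fst ℝ (E n) ℝ)) hc.1).enorm_sub_le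
    (g := fun t => ‖v‖ₑ * ‖(deriv c t).1‖ₑ) ?_ ht
  · rw [lintegral_const_mul' _ _ enorm_ne_top] at h1
    simp only [ContinuousLinearMap.comp_apply, ContinuousLinearMap.coe_fst'] at h1
    rw [← map_sub, ← hv, innerSL_apply_apply, real_inner_self_eq_norm_sq, sq, enorm_mul,
      enorm_norm] at h1
    exact (ENNReal.mul_le_mul_iff_right (by simpa using h0) enorm_ne_top).1 h1
  · filter_upwards [hc.1.ae_differentiableAt_Icc] with s hs
    have := (((innerSL ℝ v).comp
      (ContinuousLinearMap.fst ℝ (E n) ℝ)).hasFDerivAt.comp_hasDerivAt s hs.hasDerivAt).deriv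
    simp only [Function.comp_def] at this
    rw [this]
    simp only [ContinuousLinearMap.comp_apply, ContinuousLinearMap.coe_fst', innerSL_apply_apply]
    rw [← enorm_norm v, ← enorm_norm (deriv c s).1, ← enorm_mul]
    exact enorm_le_iff_norm_le.2 ((norm_inner_le_norm _ _).trans (Real.le_norm_self _))

theorem enorm_omega_le (x y : E n) : ‖omega x y‖ₑ ≤ ‖omegaL n‖ₑ * ‖x‖ₑ * ‖y‖ₑ := by
  rw [← enorm_norm (omegaL n), ← enorm_norm x, ← enorm_norm y, ← enorm_mul, ← enorm_mul]
  refine enorm_le_iff_norm_le.2 ((abs_omega_le x y).trans (Real.le_norm_self _))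

/-- Up to a constant, `T` is the height after left translation of the starting point to the origin.
Along the curve its derivative is `½ω(x(s) - x(0), ẋ(s))`, in which the displacement is itself
bounded by the length. This is the reason why the height is quadratic in the length. -/
theorem IsHorizontalCurve.enorm_snd_le {c : ℝ → H n} (hc : IsHorizontalCurve c) :
    ‖(hmul (hinv (c 0)) (c 1)).2‖ₑ ≤ ‖omegaL n‖ₑ * ccLength c ^ 2 := by
  let T : H n →L[ℝ] ℝ := ContinuousLinearMap.snd ℝ (E n) ℝ -
    (1 / 2 : ℝ) • (omegaL n (c 0).1).comp (ContinuousLinearMap.fst ℝ (E n) ℝ)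
  have hT : ∀ p : H n, T p = p.2 - (1 / 2) * omega (c 0).1 p.1 := fun p => by simp [T]
  rcases eq_or_ne (ccLength c) ⊤ with htop | htop
  -- For infinite length the right side is `⊤`, except when `ω = 0`, where `0 * ⊤ = 0` and a
  -- separate argument is needed: every horizontal curve then has constant height.
  · rcases eq_or_ne ‖omegaL n‖ₑ 0 with h0 | h0
    · have hω : ∀ x y : E n, omega x y = 0 := fun x y => by
        have := enorm_omega_le x y
        rw [h0] at this
        simpa using this
      have h1 := (ac_clm T hc.1).enorm_sub_le (g := fun _ => 0) ?_ (right_mem_Icc.2 zero_le_one)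
      · simp only [hT, hω, lintegral_zero, mul_zero, sub_zero] at h1
        simp only [hmul, hinv, hω, h0, zero_mul]
        convert h1 using 2; ring
      · filter_upwards [hc.1.ae_differentiableAt_Icc, hc.2] with s hs hh
        have := (T.hasFDerivAt.comp_hasDerivAt s hs.hasDerivAt).deriv
        simp only [Function.comp_def] at this
        rw [this, hT, hh]
        simp [hω]
    · rw [htop]; simp [ENNReal.mul_top, h0]
  have h1 := (ac_clm T hc.1).enorm_sub_le
    (g := fun t => (‖omegaL n‖ₑ * ccLength c) * ‖(deriv c t).1‖ₑ) ?_ (right_mem_Icc.2 zero_le_one)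
  · rw [lintegral_const_mul' _ _ (ENNReal.mul_ne_top enorm_ne_top htop)] at h1
    rw [sq, ← mul_assoc]
    refine le_trans (le_of_eq ?_) h1
    congr 1
    simp only [hT, hmul, hinv, omega_neg_left, omega_self]
    ring
  · filter_upwards [hc.1.ae_differentiableAt_Icc, hc.2, ae_restrict_mem measurableSet_Icc]
      with s hs hh hs'
    have := (T.hasFDerivAt.comp_hasDerivAt s hs.hasDerivAt).deriv
    simp only [Function.comp_def] at this
    rw [this, hT, hh]
    have e : (1 / 2) * omega (c s).1 (deriv c s).1 - (1 / 2) * omega (c 0).1 (deriv c s).1 =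
        (1 / 2) * omega ((c s).1 - (c 0).1) (deriv c s).1 := by rw [omega_sub_left]; ring
    rw [e, enorm_mul]
    calc ‖(1 / 2 : ℝ)‖ₑ * ‖omega ((c s).1 - (c 0).1) (deriv c s).1‖ₑ
        ≤ 1 * (‖omegaL n‖ₑ * ‖(c s).1 - (c 0).1‖ₑ * ‖(deriv c s).1‖ₑ) := by
          gcongr
          · have : ‖(1 / 2 : ℝ)‖ₑ ≤ ‖(1 : ℝ)‖ₑ := enorm_le_iff_norm_le.2 (by norm_num)
            rwa [enorm_one] at this
          · exact enorm_omega_le _ _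
      _ ≤ ‖omegaL n‖ₑ * ccLength c * ‖(deriv c s).1‖ₑ := by
          rw [one_mul]
          gcongr
          exact hc.enorm_fst_sub_le hs'

/-- A `C^1` horizontal curve bounds the Carnot-Caratheodory distance of its end points. -/
theorem ccDist_le_of_hasDerivAt {c c' : ℝ → H n} (hc : ∀ t, HasDerivAt c (c' t) t)
    (hc' : Continuous c') (hh : ∀ t, IsHorizontalVec (c t) (c' t)) {M : ℝ≥0∞}
    (hM : ∀ t ∈ Icc (0 : ℝ) 1, ‖(c' t).1‖ₑ ≤ M) : ccDist (c 0) (c 1) ≤ M := by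
  have hd : deriv c = c' := funext fun t => (hc t).deriv
  have hcd : ContDiff ℝ 1 c :=
    contDiff_one_iff_deriv.2 ⟨fun t => (hc t).differentiableAt, by rwa [hd]⟩
  refine (ccDist_le_ccLength ⟨hcd.contDiffOn.absolutelyContinuousOnInterval, ?_⟩).trans ?_
  · rw [hd]; exact Filter.Eventually.of_forall hh
  · rw [ccLength, hd]
    calc ∫⁻ t in Icc (0 : ℝ) 1, ‖(c' t).1‖ₑ ≤ ∫⁻ _ in Icc (0 : ℝ) 1, M :=
          setLIntegral_mono measurable_const hM
      _ = M := by simp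

theorem ccDist_line_le (p : H n) (u : E n) : ccDist p (hmul p (u, 0)) ≤ ‖u‖ₑ := by
  have := ccDist_le_of_hasDerivAt (c := fun t : ℝ => p + t • ((u, (1 / 2) * omega p.1 u) : H n))
    (c' := fun _ => (u, (1 / 2) * omega p.1 u)) (M := ‖u‖ₑ)
    (fun t => by
      simpa using ((hasDerivAt_id t).smul_const ((u, (1 / 2) * omega p.1 u) : H n)).const_add p)
    continuous_const
    (fun t => by simp [IsHorizontalVec, omega_add_left, omega_smul_left, omega_self])
    (fun _ _ => le_rfl)
  simp only [zero_smul, add_zero, one_smul] at this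
  convert this using 2
  ext1 <;> simp [hmul]

/-- An explicit polynomial horizontal curve joins `p` to `q`: the straight segment between the
projections, perturbed in a symplectic plane spanned by `e` and `f` so as to sweep the area that
corrects the height. Its speed is continuous in the end points, hence bounded on compact sets. -/
theorem exists_ccDist_le [NeZero n] (R : ℝ) : ∃ M : ℝ≥0, ∀ p q : H n, p ∈ Metric.closedBall 0 R →
    q ∈ Metric.closedBall 0 R → ccDist p q ≤ M := by
  let e : E n := EuclideanSpace.single (Sum.inl (0 : Fin n)) 1
  let f : E n := EuclideanSpace.single (Sum.inr (0 : Fin n)) 1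
  have hef : omega e f = 1 := by simp [e, f, omega]
  -- The coefficient of `f` solves a linear equation. With the perturbations `t - t²` along `e` and
  -- `b t (1 - t)(1 - 2t)` along `f`, the extra height `z` at time 1 is `-ω(u, e)/6 - b/30`. The
  -- cubic is odd about `t = 1/2`, so that `ω(u, f)` drops out of this value.
  let B : H n × H n → ℝ := fun z => -30 * (z.2.2 - z.1.2 - (1 / 2) * omegaL n z.1.1 z.2.1) -
    5 * omegaL n (z.2.1 - z.1.1) e
  let N : H n × H n → ℝ := fun z => ‖z.2.1 - z.1.1‖ + ‖e‖ + |B z| * ‖f‖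
  have hB : Continuous B := by fun_prop
  have hN : Continuous N := by fun_prop
  obtain ⟨M, hM⟩ := ((isCompact_closedBall (0 : H n) R).prod
    (isCompact_closedBall (0 : H n) R)).exists_bound_of_continuousOn hN.continuousOn
  refine ⟨M.toNNReal, fun p q hp hq => ?_⟩
  set u := q.1 - p.1 with hu
  set b := B (p, q) with hb
  let ℓ : ℝ → E n := fun t => t • u + (t - t ^ 2) • e + (b * (t - 3 * t ^ 2 + 2 * t ^ 3)) • f
  let ℓ' : ℝ → E n := fun t => (1 : ℝ) • u + (1 - 2 * t) • e + (b * (1 - 6 * t + 6 * t ^ 2)) • f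
  let z : ℝ → ℝ := fun t => (1 / 2) * (omega u e * (-t ^ 3 / 3) + b * omega u f * (-t ^ 3 + t ^ 4) +
    b * (-2 * t ^ 3 / 3 + t ^ 4 - 2 * t ^ 5 / 5))
  let z' : ℝ → ℝ := fun t => (1 / 2) * (omega u e * (-t ^ 2) + b * omega u f * (-3 * t ^ 2 + 4 * t ^ 3)
    + b * (-2 * t ^ 2 + 4 * t ^ 3 - 2 * t ^ 4))
  have hpow : ∀ (k : ℕ) (t : ℝ), HasDerivAt (fun t : ℝ => t ^ k) (k * t ^ (k - 1)) t :=
    fun k t => hasDerivAt_pow k t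
  have hℓ : ∀ t, HasDerivAt ℓ (ℓ' t) t := by
    intro t
    refine (((hasDerivAt_id t).smul_const u).add (HasDerivAt.smul_const ?_ e)).add
      (HasDerivAt.smul_const (HasDerivAt.const_mul b ?_) f)
    · refine ((hasDerivAt_id t).sub (hpow 2 t)).congr_deriv ?_
      norm_num
    · refine (((hasDerivAt_id t).sub ((hpow 2 t).const_mul 3)).add
        ((hpow 3 t).const_mul 2)).congr_deriv ?_
      norm_num; ring
  have hz : ∀ t, HasDerivAt z (z' t) t := by
    intro t
    refine HasDerivAt.const_mul _ (((HasDerivAt.const_mul _ ?_).add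
      (HasDerivAt.const_mul _ ?_)).add (HasDerivAt.const_mul _ ?_))
    · refine ((hpow 3 t).neg.div_const 3).congr_deriv ?_
      norm_num; ring
    · refine ((hpow 3 t).neg.add (hpow 4 t)).congr_deriv ?_
      norm_num
    · refine (((((hpow 3 t).const_mul (-2)).div_const 3).add (hpow 4 t)).sub
        (((hpow 5 t).const_mul 2).div_const 5)).congr_deriv ?_
      norm_num; ring
  have key := ccDist_le_of_hasDerivAt
    (c := fun t => (p.1 + ℓ t, p.2 + (1 / 2) * omegaL n p.1 (ℓ t) + z t))
    (c' := fun t => (ℓ' t, (1 / 2) * omegaL n p.1 (ℓ' t) + z' t)) (M := (M.toNNReal : ℝ≥0∞))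
    (fun t => ((hℓ t).const_add _).prodMk
      (((((omegaL n p.1).hasFDerivAt.comp_hasDerivAt t (hℓ t)).const_mul _).const_add _).add (hz t)))
    (by fun_prop) ?_ ?_
  · have e0 : ((p.1 + ℓ 0, p.2 + (1 / 2) * omegaL n p.1 (ℓ 0) + z 0) : H n) = p := by
      ext1 <;> simp [ℓ, z, omega_zero_right]
    have e1 : ((p.1 + ℓ 1, p.2 + (1 / 2) * omegaL n p.1 (ℓ 1) + z 1) : H n) = q := by
      have hℓ1 : ℓ 1 = u := by simp [ℓ]; norm_num
      ext1
      · simp [hℓ1, hu]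
      · simp only [hℓ1, z, hb, B, omegaL_apply, ← hu]
        rw [hu, omega_sub_right, omega_self]
        ring
    rwa [e0, e1] at key
  · intro t
    simp only [IsHorizontalVec, omegaL_apply, ℓ', ℓ, z', omega_add_left, omega_add_right,
      omega_smul_left, omega_smul_right, omega_self, omega_swap e u, omega_swap f u,
      omega_swap f e, hef]
    ring
  · intro t ht
    rw [ENNReal.ofNNReal_toNNReal, ← ofReal_norm]
    refine ENNReal.ofReal_le_ofReal ?_
    have h1 : N (p, q) ≤ M := (Real.le_norm_self _).trans (hM (p, q) ⟨hp, hq⟩)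
    refine le_trans ?_ h1
    refine (norm_add_le _ _).trans (add_le_add ((norm_add_le _ _).trans (add_le_add ?_ ?_)) ?_)
    · rw [one_smul]
    · rw [norm_smul]
      refine mul_le_of_le_one_left (norm_nonneg _) ?_
      rw [Real.norm_eq_abs, abs_le]
      constructor <;> linarith [ht.1, ht.2]
    · rw [norm_smul, norm_mul, Real.norm_eq_abs, ← hb]
      gcongr
      refine mul_le_of_le_one_right (abs_nonneg _) ?_
      rw [Real.norm_eq_abs, abs_le]
      constructor <;> nlinarith [ht.1, ht.2, sq_nonneg (2 * t - 1),
        mul_nonneg ht.1 (sub_nonneg.2 ht.2)]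

/-- Contact maps over locally Lipschitz maps are locally Lipschitz for the Carnot-Caratheodory
distance. -/
theorem IsContactLift.ccLocallyLipschitz [NeZero n] {φ : E n → E n} {F : E n → ℝ}
    (h : IsContactLift φ F) (hφ : LocallyLipschitz φ) :
    CCLocallyLipschitz (fun p : H n => (φ p.1, p.2 + F p.1)) := by
  intro p₀
  -- Points near `p₀` are joined by curves of length less than `M + 1`. These stay over the ball of
  -- radius `‖p₀‖ + M + 3`, on which a single bound `K` for the differential of `φ` applies.
  obtain ⟨M, hM⟩ := exists_ccDist_le (n := n) (‖p₀‖ + 1)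
  obtain ⟨K, hK, hK'⟩ := hφ.exists_norm_fderiv_le 0 (‖p₀‖ + M + 3)
  have hlip := locallyLipschitz_lift hφ (h.locallyLipschitz hφ)
  have hU : ∀ p ∈ Metric.ball p₀ 1, p ∈ Metric.closedBall (0 : H n) (‖p₀‖ + 1) := by
    intro p hp
    rw [mem_closedBall_zero_iff]
    have := norm_le_norm_add_norm_sub' p p₀
    rw [Metric.mem_ball, dist_eq_norm] at hp
    linarith
  refine ⟨K, Metric.ball p₀ 1, Metric.ball_mem_nhds p₀ one_pos, fun x hx y hy => ?_⟩
  have hfin : ccDist x y < M + 1 :=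
    (hM x y (hU x hx) (hU y hy)).trans_lt (ENNReal.lt_add_right ENNReal.coe_ne_top one_ne_zero)
  -- By the contact equation the image curve is horizontal, and its horizontal speed is multiplied
  -- by at most `K`. The Lipschitz constant `K₁` of the lift on the trace of the curve serves only
  -- to keep the image absolutely continuous.
  have step : ∀ c : ℝ → H n, IsHorizontalCurve c → c 0 = x → c 1 = y → ccLength c < M + 1 →
      ccDist (φ x.1, x.2 + F x.1) (φ y.1, y.2 + F y.1) ≤ K * ccLength c := by
    intro c hc h0 h1 hlen
    have hmem : ∀ t ∈ Icc (0 : ℝ) 1, (c t).1 ∈ Metric.ball (0 : E n) (‖p₀‖ + M + 3) := by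
      intro t ht
      have h2 := (hc.enorm_fst_sub_le ht).trans hlen.le
      rw [h0, ← ofReal_norm, ← ENNReal.coe_one, ← ENNReal.coe_add,
        ENNReal.ofReal_le_iff_le_toReal ENNReal.coe_ne_top] at h2
      simp only [ENNReal.coe_toReal, NNReal.coe_add, NNReal.coe_one] at h2
      have h3 : ‖x.1‖ ≤ ‖p₀‖ + 1 := (norm_fst_le x).trans (mem_closedBall_zero_iff.1 (hU x hx))
      rw [mem_ball_zero_iff]
      have := norm_le_norm_add_norm_sub' (c t).1 x.1
      linarith
    have hcc : ContinuousOn c (uIcc 0 1) := hc.1.continuousOn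
    obtain ⟨K₁, hK₁⟩ := hlip.locallyLipschitzOn.exists_lipschitzOnWith_of_compact
      (isCompact_uIcc.image_of_continuousOn hcc)
    have hder : ∀ᵐ t ∂(volume.restrict (Icc (0 : ℝ) 1)),
        IsHorizontalVec (φ (c t).1, (c t).2 + F (c t).1)
          (deriv (fun t => ((φ (c t).1, (c t).2 + F (c t).1) : H n)) t) ∧
        ‖(deriv (fun t => ((φ (c t).1, (c t).2 + F (c t).1) : H n)) t).1‖ₑ ≤
          K * ‖(deriv c t).1‖ₑ := by
      filter_upwards [hc.1.ae_differentiableAt_Icc, hc.2, ae_restrict_mem measurableSet_Icc]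
        with t ht hh ht'
      obtain ⟨L, hL, -, hF⟩ := h (c t).1
      have d1 : HasDerivAt (fun t => (c t).1) (deriv c t).1 t :=
        (ContinuousLinearMap.fst ℝ (E n) ℝ).hasFDerivAt.comp_hasDerivAt t ht.hasDerivAt
      have d2 : HasDerivAt (fun t => (c t).2) (deriv c t).2 t :=
        (ContinuousLinearMap.snd ℝ (E n) ℝ).hasFDerivAt.comp_hasDerivAt t ht.hasDerivAt
      have d3 := hL.comp_hasDerivAt t d1
      have d4 := d2.add (hF.comp_hasDerivAt t d1)
      have d5 := (d3.prodMk d4).deriv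
      simp only [Function.comp_def] at d5
      rw [show (fun t => ((φ (c t).1, (c t).2 + F (c t).1) : H n)) = fun x => (φ (c x).1,
        ((fun t => (c t).2) + fun x => F (c x).1) x) from rfl, d5]
      refine ⟨?_, ?_⟩
      · simp only [IsHorizontalVec] at hh ⊢
        rw [hh]
        simp
        ring
      · have hLK : ‖L‖ ≤ K := by
          rw [← hL.fderiv]; exact hK' _ (hmem t ht')
        have : ‖L (deriv c t).1‖ ≤ K * ‖(deriv c t).1‖ :=
          (L.le_opNorm _).trans (by gcongr)
        rw [← ofReal_norm, ← ofReal_norm, ← ENNReal.ofReal_coe_nnreal,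
          ← ENNReal.ofReal_mul K.coe_nonneg]
        exact ENNReal.ofReal_le_ofReal this
    have hcurve : IsHorizontalCurve (fun t => ((φ (c t).1, (c t).2 + F (c t).1) : H n)) :=
      ⟨hK₁.comp_absolutelyContinuousOnInterval hc.1 (mapsTo_image _ _), hder.mono fun t ht => ht.1⟩
    have := ccDist_le_ccLength hcurve
    rw [h0, h1] at this
    refine this.trans ?_
    rw [ccLength, ccLength, ← lintegral_const_mul' _ _ ENNReal.coe_ne_top]
    exact lintegral_mono_ae (hder.mono fun t ht => ht.2)
  -- Passing to the infimum over curves divides by `K`, so `K = 0` is treated apart with one curve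
  -- of finite length.
  rcases eq_or_ne (K : ℝ≥0∞) 0 with hK0 | hK0
  · obtain ⟨c, hc, h0, h1, hlen⟩ := exists_curve_of_ccDist_lt hfin
    have := step c hc h0 h1 hlen
    rw [hK0, zero_mul] at this ⊢
    exact this
  · rw [mul_comm, ← ENNReal.div_le_iff hK0 ENNReal.coe_ne_top]
    refine le_of_forall_gt fun b hb => ?_
    obtain ⟨c, hc, h0, h1, hlen⟩ := exists_curve_of_ccDist_lt (lt_min hb hfin)
    refine lt_of_le_of_lt ?_ (hlen.trans_le (min_le_left _ _))
    rw [ENNReal.div_le_iff hK0 ENNReal.coe_ne_top, mul_comm]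
    exact step c hc h0 h1 (hlen.trans_le (min_le_right _ _))

/-- The bracket derivative of a map which is locally Lipschitz for the Carnot-Caratheodory distance
preserves the horizontal directions. -/
theorem CCLocallyLipschitz.snd_horizontal_eq_zero {f : H n → H n} (hf : CCLocallyLipschitz f)
    {p : H n} {L : H n →L[ℝ] H n}
    (hL : HasFDerivAt (fun y => hmul (hinv (f p)) (f (hmul p y))) L 0) (u : E n) :
    (L (u, 0)).2 = 0 := by
  obtain ⟨K, U, hU, h⟩ := hf p
  let g : ℝ → ℝ := fun s => (hmul (hinv (f p)) (f (hmul p (s • ((u, 0) : H n))))).2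
  have hg : HasDerivAt g (L (u, 0)).2 0 :=
    (ContinuousLinearMap.snd ℝ (E n) ℝ).hasFDerivAt.comp_hasDerivAt (0 : ℝ)
      (hasDerivAt_along hL (u, 0))
  have hg0 : HasDerivAt g 0 0 := by
    have hcont : Continuous fun s : ℝ => hmul p (s • ((u, 0) : H n)) := by
      have : Continuous fun s : ℝ => ((p.1 + s • u, p.2 + s * 0 + 1 / 2 * omegaL n p.1 (s • u)) : H n) := by
        fun_prop
      exact this
    have hmem : ∀ᶠ s in 𝓝 (0 : ℝ), hmul p (s • ((u, 0) : H n)) ∈ U := by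
      refine hcont.continuousAt.eventually_mem ?_
      simpa [hmul_zero_right] using hU
    have hgz : g 0 = 0 := by
      change (hmul (hinv (f p)) (f (hmul p ((0 : ℝ) • ((u, 0) : H n))))).2 = 0
      rw [zero_smul, hmul_zero_right, hmul_hinv_self]
      rfl
    -- The segment from `p` in direction `s u` has length `|s| ‖u‖`, so the images of its end points
    -- are at distance at most `K |s| ‖u‖`, and the relative height is quadratic in that distance.
    -- The added 1 in the constant leaves room for a curve that only nearly realises the infimum.
    have hO : g =O[𝓝 0] fun s : ℝ => s ^ 2 := by
      refine Asymptotics.IsBigO.of_bound (‖omegaL n‖ * (K * ‖u‖ + 1) ^ 2) ?_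
      filter_upwards [hmem] with s hs
      rcases eq_or_ne s 0 with rfl | hs0
      · simp [hgz]
      have hspos : 0 < |s| := abs_pos.2 hs0
      have h1 := h p (mem_of_mem_nhds hU) _ hs
      have h2 : ccDist p (hmul p (s • ((u, 0) : H n))) ≤ ‖s • u‖ₑ := by
        simpa using ccDist_line_le p (s • u)
      have h3 : ccDist (f p) (f (hmul p (s • ((u, 0) : H n)))) <
          ENNReal.ofReal (|s| * (K * ‖u‖ + 1)) := by
        refine (h1.trans (mul_le_mul_right h2 _)).trans_lt ?_
        rw [← ofReal_norm, ← ENNReal.ofReal_coe_nnreal, ← ENNReal.ofReal_mul K.coe_nonneg,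
          norm_smul, Real.norm_eq_abs]
        refine (ENNReal.ofReal_lt_ofReal_iff (by positivity)).2 ?_
        nlinarith
      obtain ⟨c, hc, c0, c1, hlen⟩ := exists_curve_of_ccDist_lt h3
      have h4 := hc.enorm_snd_le
      rw [c0, c1] at h4
      have h5 : ‖g s‖ₑ ≤ ENNReal.ofReal (‖omegaL n‖ * (|s| * (K * ‖u‖ + 1)) ^ 2) := by
        refine h4.trans ?_
        rw [ENNReal.ofReal_mul (norm_nonneg (omegaL n)), ofReal_norm, ENNReal.ofReal_pow (by positivity)]
        gcongr
      rw [← ofReal_norm, ENNReal.ofReal_le_ofReal_iff (by positivity)] at h5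
      refine h5.trans (le_of_eq ?_)
      rw [norm_pow, Real.norm_eq_abs]; ring
    rw [hasDerivAt_iff_isLittleO]
    simp only [hgz, sub_zero, smul_zero]
    refine hO.trans_isLittleO ?_
    exact Asymptotics.isLittleO_pow_id one_lt_two
  exact hg.unique hg0

end cc

/-! ### Volume preserving maps and symplectic maps -/

section structure_theorem
variable {n : ℕ}

/-- The map induced on `ℝ^{2n}` by a map of `H(n)` which preserves the vertical lines. -/
def baseMap (f : H n → H n) (x : E n) : E n := (f (x, 0)).1

theorem fst_apply_eq_baseMap [NeZero n] {f : H n → H n} (hf : BracketDerivable f) (p : H n) :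
    (f p).1 = baseMap f p.1 :=
  hf.fst_eq p.1 p.2 0

theorem baseMap_comp [NeZero n] {f : H n → H n} (hf : BracketDerivable f) (g : H n → H n)
    (x : E n) : baseMap (f ∘ g) x = baseMap f (baseMap g x) :=
  fst_apply_eq_baseMap hf (g (x, 0))

theorem hasFDerivAt_horizontal {f : H n → H n} {p : H n} {L : H n →L[ℝ] H n}
    (hL : HasFDerivAt (fun y => hmul (hinv (f p)) (f (hmul p y))) L 0) :
    HasFDerivAt (fun u : E n => hmul (hinv (f p)) (f (hmul p (u, 0))))
      (L.comp (ContinuousLinearMap.inl ℝ (E n) ℝ)) 0 :=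
  HasFDerivAt.comp (g := fun y => hmul (hinv (f p)) (f (hmul p y))) (0 : E n) hL
    (ContinuousLinearMap.inl ℝ (E n) ℝ).hasFDerivAt

theorem _root_.HasFDerivAt.of_comp_const_add {X Y : Type*} [NormedAddCommGroup X]
    [NormedSpace ℝ X] [NormedAddCommGroup Y] [NormedSpace ℝ Y] {g : X → Y} {g' : X →L[ℝ] Y} {x : X}
    (h : HasFDerivAt (fun u => g (x + u)) g' 0) : HasFDerivAt g g' x := by
  have h1 : HasFDerivAt (fun y => y - x) (ContinuousLinearMap.id ℝ X) x :=
    (hasFDerivAt_id x).sub_const x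
  have h2 := HasFDerivAt.comp (g := fun u => g (x + u)) x (by rw [sub_self]; exact h) h1
  rw [ContinuousLinearMap.comp_id] at h2
  refine h2.congr_of_eventuallyEq (Filter.Eventually.of_forall fun y => ?_)
  simp

/-- The product `(x, 0)(u, 0)` lies over `x + u` at some height, and the first component of `f`
ignores the height. -/
theorem hasFDerivAt_baseMap [NeZero n] {f : H n → H n} (hf : BracketDerivable f) {x : E n}
    {L : H n →L[ℝ] H n}
    (hL : HasFDerivAt (fun y => hmul (hinv (f (x, 0))) (f (hmul (x, 0) y))) L 0) :
    HasFDerivAt (baseMap f) ((ContinuousLinearMap.fst ℝ (E n) ℝ).comp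
      (L.comp (ContinuousLinearMap.inl ℝ (E n) ℝ))) x := by
  apply HasFDerivAt.of_comp_const_add
  have h := ((ContinuousLinearMap.fst ℝ (E n) ℝ).hasFDerivAt.comp (0 : E n)
    (hasFDerivAt_horizontal hL)).const_add (baseMap f x)
  refine h.congr_of_eventuallyEq (Filter.Eventually.of_forall fun u => ?_)
  simp only [Function.comp_def, ContinuousLinearMap.coe_fst', hmul, hinv, baseMap,
    add_neg_cancel_left]
  exact hf.fst_eq _ _ _

/-- The product of two horizontal vectors has height `½ω(u, v)`. Linearity and multiplicativity of
`L` evaluate its image in two ways. -/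
theorem omega_bracket {L : H n →L[ℝ] H n} (hL : ∀ u v, L (hmul u v) = hmul (L u) (L v))
    (u v : E n) : omega (L (u, 0)).1 (L (v, 0)).1 = (L (0, 1)).2 * omega u v := by
  have huv : hmul ((u, 0) : H n) (v, 0) = (u, 0) + (v, 0) + ((1 / 2) * omega u v) • ((0, 1) : H n) := by
    ext1 <;> simp [hmul]
  have h := congrArg Prod.snd (hL (u, 0) (v, 0))
  rw [huv] at h
  simp only [map_add, map_smul, hmul, Prod.snd_add, Prod.smul_snd, smul_eq_mul] at h
  linarith

/-- An element of `Diff(H(n), vol)_c` is a contact lift of a symplectic map. -/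
theorem volDiffC_structure [NeZero n] {r : ℕ∞} {f : H n ≃ₜ H n} (hf : f ∈ volDiffC r n) :
    IsContactLift (baseMap f) (fun x => (f (x, 0)).2) ∧
      ∀ p, f p = (baseMap f p.1, p.2 + (f (p.1, 0)).2) := by
  obtain ⟨⟨⟨-, -, ⟨hb, -⟩, -⟩, -, hcc, -⟩, K, hK, hsupp⟩ := hf
  have hfst := fst_apply_eq_baseMap hb
  choose a ha using fun x => hb.snd_eq x
  have ha0 : ∀ x s, (f (x, s)).2 = (f (x, 0)).2 + a x * s := fun x s => by
    have := ha x 0 s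
    rwa [zero_add] at this
  choose L hL hL' using hb
  set φ := baseMap f with hφ
  have hφd : ∀ x, HasFDerivAt φ ((ContinuousLinearMap.fst ℝ (E n) ℝ).comp
      ((L (x, 0)).comp (ContinuousLinearMap.inl ℝ (E n) ℝ))) x :=
    fun x => hasFDerivAt_baseMap (fun p => ⟨L p, hL p, hL' p⟩) (hL' (x, 0))
  -- The vertical component of the differential on horizontal directions vanishes at every height
  -- `s`. Expressed through the affine form of `f` on the fibres, this is a family of equations
  -- depending affinely on `s`.
  have hvert : ∀ x s, HasFDerivAt (fun u : E n => (f (x + u, 0)).2 + a (x + u) *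
      (s + (1 / 2) * omega x u) - (1 / 2) * omega (φ x) (φ (x + u))) (0 : E n →L[ℝ] ℝ) 0 := by
    intro x s
    have h := ((ContinuousLinearMap.snd ℝ (E n) ℝ).hasFDerivAt.comp (0 : E n)
      (hasFDerivAt_horizontal (hL' (x, s)))).const_add (f (x, s)).2
    have hz : (ContinuousLinearMap.snd ℝ (E n) ℝ).comp
        ((L (x, s)).comp (ContinuousLinearMap.inl ℝ (E n) ℝ)) = 0 := by
      ext u
      simpa using hcc.snd_horizontal_eq_zero (hL' (x, s)) u
    rw [hz] at h
    refine h.congr_of_eventuallyEq (Filter.Eventually.of_forall fun u => ?_)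
    simp only [Function.comp_def, ContinuousLinearMap.coe_snd', hmul, hinv, add_zero]
    rw [hfst, hfst (x + u, _), ha0 (x + u) (s + _), omega_neg_left]
    ring
  -- Subtracting the equations at heights 1 and 0 leaves the slope alone.
  have ha' : ∀ x, HasFDerivAt a (0 : E n →L[ℝ] ℝ) x := by
    intro x
    apply HasFDerivAt.of_comp_const_add
    have := (hvert x 1).sub (hvert x 0)
    rw [sub_zero] at this
    refine this.congr_of_eventuallyEq (Filter.Eventually.of_forall fun u => ?_)
    simp only [Pi.sub_apply]
    ring
  obtain ⟨x₀, hx₀⟩ : ∃ x₀, x₀ ∉ K := by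
    obtain ⟨R, hR⟩ := hK.isBounded.subset_closedBall 0
    obtain ⟨x, hx⟩ := NormedSpace.exists_lt_norm ℝ (E n) R
    exact ⟨x, fun h => not_le.2 hx (mem_closedBall_zero_iff.1 (hR h))⟩
  have ha1 : ∀ x, a x = 1 := by
    intro x
    rw [is_const_of_fderiv_eq_zero (fun x => (ha' x).differentiableAt) (fun x => (ha' x).fderiv) x x₀]
    have := ha0 x₀ 1
    rw [hsupp _ hx₀, hsupp _ hx₀] at this
    simpa using this.symm
  refine ⟨fun x => ⟨_, hφd x, fun u v => ?_, ?_⟩, fun p => ?_⟩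
  -- Slope 1 on the fibres means that the differential fixes the central direction, so
  -- `omega_bracket` becomes preservation of `ω`.
  · have h1 : ((L (x, 0)) (0, 1)).2 = 1 := by
      have h := hasDerivAt_along_snd (hL' (x, 0)) (0, 1)
      have h2 : HasDerivAt (fun s : ℝ => (f (x, 0)).2 + s) 1 0 := by
        simpa using (hasDerivAt_id (0 : ℝ)).const_add (f (x, 0)).2
      refine h.unique (h2.congr_of_eventuallyEq (Filter.Eventually.of_forall fun s => ?_))
      simp only [hmul, hinv, Prod.smul_mk, smul_zero, add_zero, omega_zero_right, smul_eq_mul,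
        mul_one, mul_zero, zero_add]
      rw [ha0 x s, hfst, hfst (x, s), omega_neg_left, omega_self, ha1]
      ring
    simpa [h1] using omega_bracket (hL (x, 0)) u v
  -- The equation at height 0, with slope 1, is the contact equation.
  · apply HasFDerivAt.of_comp_const_add
    have h1 : HasFDerivAt (fun u => φ (x + u)) _ 0 :=
      HasFDerivAt.comp (g := φ) (0 : E n) (by simpa using hφd x)
        ((hasFDerivAt_id (0 : E n)).const_add x)
    have h2 := ((omegaL n (φ x)).hasFDerivAt.comp (0 : E n) h1).const_mul (1 / 2 : ℝ)
    have h3 := ((omegaL n x).hasFDerivAt (x := (0 : E n))).const_mul (1 / 2 : ℝ)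
    refine (((hvert x 0).add h2).sub h3).congr_fderiv ?_ |>.congr_of_eventuallyEq
      (Filter.Eventually.of_forall fun u => ?_)
    · ext v
      simp
      ring
    · simp [ha1]
  · ext1
    · exact hfst p
    · change (f (p.1, p.2)).2 = _
      rw [ha0, ha1]
      ring

theorem liftHomeo_mem_volDiff [NeZero n] {r : ℕ∞} {φ : E n ≃ₜ E n} {F : E n → ℝ}
    (hφ : φ ∈ sympl r n) (hF : IsContactLift φ F) :
    liftHomeo φ F hF.differentiable.continuous ∈ volDiff r n := by
  refine ⟨liftHomeo_mem_bracketDiff hφ (hF.locallyLipschitz hφ.1.1) hF.differentiable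
    (hF.contDiff hφ.2.2.1), measurePreserving_liftHomeo _ _ _ hφ.2.1.1,
    hF.ccLocallyLipschitz hφ.1.1, ?_⟩
  rw [liftHomeo_symm]
  exact (hF.symm hφ.2.1.2).ccLocallyLipschitz hφ.1.2

theorem liftHomeo_mem_cylSupport {φ : E n ≃ₜ E n} {F : E n → ℝ} (hF : Continuous F)
    (hφ : ∃ K, IsCompact K ∧ ∀ x, x ∉ K → φ x = x) (hF' : ∃ K, IsCompact K ∧ ∀ x, x ∉ K → F x = 0) :
    liftHomeo φ F hF ∈ cylSupport n := by
  obtain ⟨K, hK, h⟩ := hφ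
  obtain ⟨K', hK', h'⟩ := hF'
  refine ⟨K ∪ K', hK.union hK', fun p hp => ?_⟩
  rw [mem_union, not_or] at hp
  ext1
  · exact h _ hp.1
  · simp [h' _ hp.2]

theorem liftHomeo_mem_volDiffC [NeZero n] {r : ℕ∞} {φ : E n ≃ₜ E n} {F : E n → ℝ}
    (hφ : φ ∈ symplC r n) (hF : IsContactLift φ F) (hF' : ∃ K, IsCompact K ∧ ∀ x, x ∉ K → F x = 0) :
    liftHomeo φ F hF.differentiable.continuous ∈ volDiffC r n :=
  ⟨liftHomeo_mem_volDiff hφ.1 hF, liftHomeo_mem_cylSupport _ hφ.2 hF'⟩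

theorem liftHomeo_refl_mem_vertDiff {r : ℕ∞} {F : E n → ℝ} (hr : ContDiff ℝ r F)
    (hd : Differentiable ℝ F) (hL : LocallyLipschitz F) :
    liftHomeo (Homeomorph.refl _) F hL.continuous ∈ vertDiff r n :=
  ⟨liftHomeo_mem_bracketDiff (one_mem (sympl r n)) hL hd hr, F, fun _ => rfl⟩

theorem exists_closedBall_of_isCompact {K : Set (E n)} (hK : IsCompact K) :
    ∃ R, 0 ≤ R ∧ ∀ x : E n, R < ‖x‖ → x ∉ K := by
  obtain ⟨R, hR⟩ := hK.isBounded.subset_closedBall 0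
  refine ⟨max R 0, le_max_right _ _, fun x hx h => ?_⟩
  have := mem_closedBall_zero_iff.1 (hR h)
  exact not_lt.2 (this.trans (le_max_left _ _)) hx

theorem exists_isContactLift_symplC [NeZero n] {r : ℕ∞} {φ : E n ≃ₜ E n} (hφ : φ ∈ symplC r n) :
    ∃ F : E n → ℝ, IsContactLift φ F ∧ ∃ K, IsCompact K ∧ ∀ x, x ∉ K → F x = 0 := by
  obtain ⟨hφ, K, hK, h⟩ := hφ
  obtain ⟨R, hR, hRK⟩ := exists_closedBall_of_isCompact hK
  obtain ⟨F, hF, hF'⟩ := exists_isContactLift_of_support hφ.1.1 hφ.2.1.1 hR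
    fun x hx => h x (hRK x hx)
  refine ⟨F, hF, Metric.closedBall 0 R, isCompact_closedBall _ _, fun x hx => hF' x ?_⟩
  simpa using hx

/-- The homeomorphism of `ℝ^{2n}` induced by an element of `Diff(H(n), vol, bracket)`. -/
def baseHomeo [NeZero n] {r : ℕ∞} (f : H n ≃ₜ H n) (hf : f ∈ bracketDiff r n) : E n ≃ₜ E n where
  toFun := baseMap f
  invFun := baseMap f.symm
  left_inv x := by
    rw [← baseMap_comp hf.2.2.1.2]
    simp [baseMap]
  right_inv x := by
    rw [← baseMap_comp hf.2.2.1.1]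
    simp [baseMap]
  continuous_toFun := continuous_fst.comp (f.continuous.comp (by fun_prop))
  continuous_invFun := continuous_fst.comp (f.symm.continuous.comp (by fun_prop))

theorem locallyLipschitz_baseMap {f : H n → H n} (hf : LocallyLipschitz f) :
    LocallyLipschitz (baseMap f) :=
  (LipschitzWith.prod_fst.locallyLipschitz).comp
    (hf.comp (LocallyLipschitz.id.prodMk (LocallyLipschitz.const 0)))

theorem contDiff_baseMap {r : ℕ∞} {f : H n → H n} (hf : ContDiff ℝ r f) :
    ContDiff ℝ r (baseMap f) :=
  contDiff_fst.comp (hf.comp (contDiff_id.prodMk contDiff_const))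

theorem baseHomeo_mem_symplC [NeZero n] {r : ℕ∞} {f : H n ≃ₜ H n} (hf : f ∈ volDiffC r n) :
    baseHomeo f hf.1.1 ∈ symplC r n := by
  have h1 := (volDiffC_structure hf).1.preservesOmega
  have h2 := (volDiffC_structure (inv_mem hf)).1.preservesOmega
  obtain ⟨⟨⟨-, ⟨l1, l2⟩, -, d1, d2⟩, -⟩, K, hK, hsupp⟩ := hf
  refine ⟨⟨⟨locallyLipschitz_baseMap l1, locallyLipschitz_baseMap l2⟩, ⟨h1, h2⟩,
    contDiff_baseMap d1, contDiff_baseMap d2⟩, K, hK, fun x hx => ?_⟩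
  change (f (x, 0)).1 = x
  rw [hsupp (x, 0) hx]

/-- The morphism from `HAM(H(n))_c` to the symplectic maps with compact support. -/
def hamToSympl (r : ℕ∞) (n : ℕ) [NeZero n] : HAMc r n →* symplC r n where
  toFun g := ⟨baseHomeo g.1.right g.2.1.1.1, baseHomeo_mem_symplC g.2.1⟩
  map_one' := by
    apply Subtype.ext
    exact Homeomorph.ext fun x => rfl
  map_mul' g h := by
    apply Subtype.ext
    exact Homeomorph.ext fun x => baseMap_comp g.2.1.1.1.2.2.1.1 h.1.right x

theorem hamToSympl_apply [NeZero n] {r : ℕ∞} (g : HAMc r n) (x : E n) :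
    (hamToSympl r n g).1 x = baseMap g.1.right x := rfl

/-- The vertical part of the first component of an element of `HAM(H(n))_c` is determined by the
induced symplectic map. -/
theorem contactLift_unique [NeZero n] {φ : E n → E n} {F G : E n → ℝ} (hF : IsContactLift φ F)
    (hG : IsContactLift φ G) (hF' : ∃ K, IsCompact K ∧ ∀ x, x ∉ K → F x = 0)
    (hG' : ∃ K, IsCompact K ∧ ∀ x, x ∉ K → G x = 0) : F = G := by
  obtain ⟨K, hK, h⟩ := hF'
  obtain ⟨K', hK', h'⟩ := hG'
  obtain ⟨R, -, hR⟩ := exists_closedBall_of_isCompact (hK.union hK')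
  obtain ⟨x, hx⟩ := NormedSpace.exists_lt_norm ℝ (E n) R
  have := hR x hx
  rw [mem_union, not_or] at this
  exact hF.ext hG (x₀ := x) (by rw [h x this.1, h' x this.2])

theorem volDiffC_vertical_support {r : ℕ∞} {f : H n ≃ₜ H n} (hf : f ∈ volDiffC r n) :
    ∃ K, IsCompact K ∧ ∀ x, x ∉ K → (f (x, 0)).2 = 0 := by
  obtain ⟨K, hK, h⟩ := hf.2
  exact ⟨K, hK, fun x hx => by rw [h (x, 0) hx]⟩

/-- Two vertical parts over the same symplectic map have equal differentials, and both vanish far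
away. Hence the induced symplectic map leaves no freedom in `f`; this yields the kernel and, later,
the starting point of lifted curves. -/
theorem eq_liftHomeo_of_volDiffC [NeZero n] {r : ℕ∞} {f : H n ≃ₜ H n} (hf : f ∈ volDiffC r n)
    {φ : E n ≃ₜ E n} {F : E n → ℝ} (hφ : ∀ x, baseMap f x = φ x) (hF : IsContactLift φ F)
    (hF' : ∃ K, IsCompact K ∧ ∀ x, x ∉ K → F x = 0) :
    f = liftHomeo φ F hF.differentiable.continuous := by
  obtain ⟨h1, h2⟩ := volDiffC_structure hf
  rw [funext hφ] at h1
  have h3 := contactLift_unique h1 hF (volDiffC_vertical_support hf) hF'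
  refine Homeomorph.ext fun p => ?_
  rw [h2, hφ]
  exact Prod.ext rfl (congrArg (fun G : E n → ℝ => p.2 + G p.1) h3)

theorem hamToSympl_ker [NeZero n] (r : ℕ∞) : (hamToSympl r n).ker = vertInHAMc r n := by
  ext g
  rw [MonoidHom.mem_ker]
  change _ ↔ g.1.right = 1
  constructor
  · intro h
    have hφ : ∀ x, baseMap g.1.right x = (Homeomorph.refl (E n)) x := fun x => by
      rw [← hamToSympl_apply, h]; rfl
    have h0 : IsContactLift (Homeomorph.refl (E n)) (fun _ => 0) := fun x =>
      ⟨ContinuousLinearMap.id ℝ _, hasFDerivAt_id x, fun _ _ => rfl,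
        (hasFDerivAt_const (0 : ℝ) x).congr_fderiv (by ext v; simp)⟩
    rw [eq_liftHomeo_of_volDiffC g.2.1 hφ h0 ⟨∅, isCompact_empty, fun _ _ => rfl⟩]
    exact Homeomorph.ext fun p => by ext1 <;> simp
  · intro h
    refine Subtype.ext (Homeomorph.ext fun x => ?_)
    rw [hamToSympl_apply, h]
    rfl

theorem hamToSympl_surjective [NeZero n] (r : ℕ∞) : Function.Surjective (hamToSympl r n) := by
  intro φ
  obtain ⟨F, hF, hF'⟩ := exists_isContactLift_symplC φ.2
  refine ⟨⟨⟨1, liftHomeo φ.1 F hF.differentiable.continuous⟩,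
    liftHomeo_mem_volDiffC φ.2 hF hF', one_mem _⟩, ?_⟩
  exact Subtype.ext (Homeomorph.ext fun x => rfl)

/-- The isomorphism of the quotient of `HAM(H(n))_c` by its vertical subgroup with the group of
symplectic maps with compact support. -/
def quotientEquivSympl (r : ℕ∞) (n : ℕ) [NeZero n] : (HAMc r n ⧸ vertInHAMc r n) ≃* symplC r n :=
  (QuotientGroup.quotientMulEquivOfEq (hamToSympl_ker r).symm).trans
    (QuotientGroup.quotientKerEquivOfSurjective _ (hamToSympl_surjective r))

theorem quotientEquivSympl_mk [NeZero n] {r : ℕ∞} (g : HAMc r n) :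
    quotientEquivSympl r n (g : HAMc r n ⧸ vertInHAMc r n) = hamToSympl r n g := rfl

end structure_theorem

/-! ### Orbits of the vertical groups -/

section orbits
variable {n : ℕ}

/-- A bump function times the height difference is a smooth, compactly supported shift. It works for
every `r` at once and gives the three groups the same orbits. -/
theorem exists_vertDiffC_apply_eq (r : ℕ∞) {p q : H n} (h : q.1 = p.1) :
    ∃ f ∈ vertDiffC r n, f p = q := by
  let b : ContDiffBump p.1 := ⟨1, 2, one_pos, one_lt_two⟩
  let F : E n → ℝ := fun x => (q.2 - p.2) * b x
  have hF : ∀ m : ℕ∞, ContDiff ℝ m F := fun m => contDiff_const.mul b.contDiff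
  have hL : LocallyLipschitz F := (hF 1).locallyLipschitz
  refine ⟨liftHomeo (Homeomorph.refl _) F hL.continuous,
    ⟨liftHomeo_refl_mem_vertDiff (hF r) ((hF 1).differentiable one_ne_zero) hL,
    liftHomeo_mem_cylSupport _ ⟨∅, isCompact_empty, fun _ _ => rfl⟩
      ⟨Metric.closedBall p.1 2, isCompact_closedBall _ _, fun x hx => ?_⟩⟩, ?_⟩
  · have : b x = 0 := by
      by_contra h0
      have hx' : x ∈ Function.support b := h0
      rw [b.support_eq] at hx'
      exact hx (Metric.ball_subset_closedBall hx')
    simp [F, this]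
  · have : b p.1 = 1 := b.one_of_mem_closedBall (Metric.mem_closedBall_self zero_le_one)
    ext1
    · simp [h]
    · simp [F, this]

theorem orbit_vertDiff (r : ℕ∞) (p : H n) :
    MulAction.orbit (vertDiff r n) p = {q | q.1 = p.1} := by
  ext q
  constructor
  · rintro ⟨⟨f, hf, F, hF⟩, rfl⟩
    change (f p).1 = p.1
    rw [hF]
  · intro h
    obtain ⟨f, hf, hfq⟩ := exists_vertDiffC_apply_eq r h
    exact ⟨⟨f, hf.1⟩, hfq⟩

theorem orbit_vertDiffC (r : ℕ∞) (p : H n) :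
    MulAction.orbit (vertDiffC r n) p = {q | q.1 = p.1} := by
  ext q
  constructor
  · rintro ⟨⟨f, ⟨hf, F, hF⟩, hc⟩, rfl⟩
    change (f p).1 = p.1
    rw [hF]
  · intro h
    obtain ⟨f, hf, hfq⟩ := exists_vertDiffC_apply_eq r h
    exact ⟨⟨f, hf⟩, hfq⟩

theorem left_fst [NeZero n] {r : ℕ∞} (g : HAMc r n) (p : H n) : (g.1.left p).1 = p.1 := by
  obtain ⟨F, hF⟩ := g.2.2.1.2
  rw [hF]

theorem orbit_vertInHAMc [NeZero n] (r : ℕ∞) (p : H n) :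
    MulAction.orbit (vertInHAMc r n) p = {q | q.1 = p.1} := by
  ext q
  constructor
  · rintro ⟨⟨g, hg⟩, rfl⟩
    change (g.1.left (g.1.right p)).1 = p.1
    have : g.1.right = 1 := hg
    rw [left_fst, this]
    rfl
  · intro h
    obtain ⟨f, hf, hfq⟩ := exists_vertDiffC_apply_eq r h
    exact ⟨⟨⟨⟨f, 1⟩, one_mem _, hf⟩, rfl⟩, hfq⟩

/-- The quotient of `H(n)` by the vertical maps is `ℝ^{2n}`. -/
def orbitHomeo (r : ℕ∞) (n : ℕ) : MulAction.orbitRel.Quotient (vertDiff r n) (H n) ≃ₜ E n where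
  toFun := Quotient.lift Prod.fst fun p q h => by
    have h' : p ∈ MulAction.orbit (vertDiff r n) q := MulAction.orbitRel_apply.1 h
    rwa [orbit_vertDiff] at h'
  invFun x := Quotient.mk _ (x, 0)
  left_inv := by
    rintro ⟨p⟩
    refine Quotient.sound (MulAction.orbitRel_apply.2 ?_)
    rw [orbit_vertDiff]
    rfl
  right_inv x := rfl
  continuous_toFun := continuous_fst.quotient_lift _
  continuous_invFun := continuous_quotient_mk'.comp (by fun_prop)

end orbits

/-! ### Invariants -/

section invariants
variable {n : ℕ}

/-- Every element of `G'` lifts to an element of `G`. -/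
def Lifts (G : Subgroup (H n ≃ₜ H n)) (G' : Subgroup (E n ≃ₜ E n)) : Prop :=
  ∀ φ ∈ G', ∃ f ∈ G, ∀ p, (f p).1 = φ p.1

theorem lifts_sympl [NeZero n] (r : ℕ∞) : Lifts (volDiff r n) (sympl r n) := fun φ hφ => by
  obtain ⟨F, hF⟩ := exists_isContactLift hφ.1.1 hφ.2.1.1
  exact ⟨_, liftHomeo_mem_volDiff hφ hF, fun _ => rfl⟩

theorem lifts_symplC [NeZero n] (r : ℕ∞) : Lifts (volDiffC r n) (symplC r n) := fun φ hφ => by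
  obtain ⟨F, hF, hF'⟩ := exists_isContactLift_symplC hφ
  exact ⟨_, liftHomeo_mem_volDiffC hφ hF hF', fun _ => rfl⟩

theorem image_preimage_fst {f : H n ≃ₜ H n} {φ : E n ≃ₜ E n} (h : ∀ p, (f p).1 = φ p.1)
    (A : Set (E n)) : f '' (Prod.fst ⁻¹' A) = Prod.fst ⁻¹' (φ '' A) := by
  ext q
  constructor
  · rintro ⟨p, hp, rfl⟩
    exact ⟨p.1, hp, (h p).symm⟩
  · rintro ⟨x, hx, hxq⟩
    refine ⟨f.symm q, ?_, f.apply_symm_apply q⟩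
    have h1 := h (f.symm q)
    rw [f.apply_symm_apply, ← hxq] at h1
    rwa [mem_preimage, ← φ.injective h1]

theorem fst_image_image {f : H n → H n} {φ : E n → E n} (h : ∀ p, (f p).1 = φ p.1)
    (B : Set (H n)) : Prod.fst '' (f '' B) = φ '' (Prod.fst '' B) := by
  simp only [image_image, h]

theorem fst_symm {f : H n ≃ₜ H n} {φ : E n ≃ₜ E n} (h : ∀ p, (f p).1 = φ p.1) (q : H n) :
    (f.symm q).1 = φ.symm q.1 := by
  rw [eq_comm, Homeomorph.symm_apply_eq, ← h, f.apply_symm_apply]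

theorem measurableSet_image_homeo {X : Type*} [TopologicalSpace X] [MeasurableSpace X]
    [BorelSpace X] (f : X ≃ₜ X) {A : Set X} (hA : MeasurableSet A) : MeasurableSet (f '' A) :=
  f.toMeasurableEquiv.measurableEmbedding.measurableSet_image.2 hA

theorem image_mem_bddBorelSets {X : Type*} [PseudoMetricSpace X] [ProperSpace X]
    [MeasurableSpace X] [BorelSpace X] (f : X ≃ₜ X) {A : Set X} (hA : A ∈ bddBorelSets X) :
    f '' A ∈ bddBorelSets X :=
  ⟨measurableSet_image_homeo f hA.1,
    (hA.2.isCompact_closure.image f.continuous).isBounded.subset (image_mono subset_closure)⟩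

theorem isInvariant_descend {G : Subgroup (H n ≃ₜ H n)} {G' : Subgroup (E n ≃ₜ E n)}
    (hG : Lifts G G') {Y : Type*} {c : Set (H n) → Y} (hc : IsInvariant G (borelSets _) c) :
    IsInvariant G' (borelSets _) (descend c) := by
  intro φ hφ A hA
  obtain ⟨f, hf, h⟩ := hG φ hφ
  rw [descend, descend, ← image_preimage_fst h]
  exact hc f hf _ (measurable_fst hA)

/-- A lift of `φ` puts the bounded Borel sets over `A` in bijection with those over `φ(A)`, without
changing the value of `c`. -/
theorem isInvariant_fibreValues {G : Subgroup (H n ≃ₜ H n)} {G' : Subgroup (E n ≃ₜ E n)}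
    (hG : Lifts G G') {Y : Type*} {c : Set (H n) → Y} (hc : IsInvariant G (bddBorelSets _) c) :
    IsInvariant G' (bddBorelSets _) (fibreValues c) := by
  intro φ hφ A _
  obtain ⟨f, hf, h⟩ := hG φ hφ
  ext y
  constructor
  · rintro ⟨B, hB, hBA, rfl⟩
    have hB' := image_mem_bddBorelSets f.symm hB
    refine ⟨f.symm '' B, hB', ?_, ?_⟩
    · rw [fst_image_image (fst_symm h), hBA, ← image_comp]
      simp
    · rw [← hc f hf _ hB', ← image_comp]
      simp
  · rintro ⟨B, hB, rfl, rfl⟩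
    exact ⟨f '' B, image_mem_bddBorelSets f hB, fst_image_image h B, hc f hf B hB⟩

theorem isMonotoneUnder_descend {G : Subgroup (H n ≃ₜ H n)} {G' : Subgroup (E n ≃ₜ E n)}
    (hG : Lifts G G') {c : Set (H n) → ℝ≥0∞} (hc : IsMonotoneUnder G (borelSets _) c) :
    IsMonotoneUnder G' (borelSets _) (descend c) := by
  intro φ hφ A hA B hB hAB
  obtain ⟨f, hf, h⟩ := hG φ hφ
  refine hc f hf _ (measurable_fst hA) _ (measurable_fst hB) ?_
  rw [image_preimage_fst h]
  exact preimage_mono hAB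

/-- Given `C` over `B`, the part of the preimage of `C` under the lift that lies over `A` still
projects onto all of `A`, since `φ(A) ⊆ B`. It competes in the infimum for `A`, and the lift maps it
into `C`. -/
theorem isMonotoneUnder_fibreValues {G : Subgroup (H n ≃ₜ H n)} {G' : Subgroup (E n ≃ₜ E n)}
    (hG : Lifts G G') {c : Set (H n) → ℝ≥0∞} (hc : IsMonotoneUnder G (bddBorelSets _) c) :
    IsMonotoneUnder G' (bddBorelSets _) (fun A => sInf (fibreValues c A)) := by
  intro φ hφ A hA B _ hAB
  obtain ⟨f, hf, h⟩ := hG φ hφ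
  refine le_sInf ?_
  rintro _ ⟨C, hC, rfl, rfl⟩
  have hC' := image_mem_bddBorelSets f.symm hC
  have hD : f.symm '' C ∩ Prod.fst ⁻¹' A ∈ bddBorelSets (H n) :=
    ⟨hC'.1.inter (measurable_fst hA.1), hC'.2.subset inter_subset_left⟩
  have hDA : Prod.fst '' (f.symm '' C ∩ Prod.fst ⁻¹' A) = A := by
    rw [image_inter_preimage, fst_image_image (fst_symm h), inter_eq_right]
    intro x hx
    obtain ⟨q, hq, hqx⟩ := hAB ⟨x, hx, rfl⟩
    exact ⟨φ x, ⟨q, hq, hqx⟩, φ.symm_apply_apply x⟩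
  refine (sInf_le (show c _ ∈ fibreValues c A from ⟨_, hD, hDA, rfl⟩)).trans
    (hc f hf _ hD C hC ((image_mono inter_subset_left).trans ?_))
  rw [← image_comp]
  simp

theorem neg_mem_sympl (r : ℕ∞) : Homeomorph.neg (E n) ∈ sympl r n := by
  have h : PreservesOmega (fun x : E n => -x) := fun x =>
    ⟨-ContinuousLinearMap.id ℝ _, (hasFDerivAt_id x).neg, fun u v => by
      simp [omega_neg_left, omega_neg_right]⟩
  have h2 : LocallyLipschitz (fun x : E n => -x) := LocallyLipschitz.id.neg
  exact ⟨⟨h2, h2⟩, ⟨h, h⟩, contDiff_neg, contDiff_neg⟩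

/-- A monotone function on the subsets of `ℝ^{2n}` is conformal as soon as it is so for positive
factors. -/
theorem isConformalE_of_pos {r : ℕ∞} {D : Set (Set (E n))} {c : Set (E n) → ℝ≥0∞}
    (hD : ∀ ε : ℝ, ε ≠ 0 → ∀ A ∈ D, (fun x => ε • x) '' A ∈ D)
    (hm : IsMonotoneUnder (sympl r n) D c)
    (hc : ∀ ε : ℝ, 0 < ε → ∀ A ∈ D, c ((fun x => ε • x) '' A) ≤ ENNReal.ofReal (ε ^ 2) * c A) :
    IsConformalE D c := by
  have hpos : ∀ ε : ℝ, 0 < ε → ∀ A ∈ D,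
      c ((fun x => ε • x) '' A) = ENNReal.ofReal (ε ^ 2) * c A := by
    intro ε hε A hA
    refine le_antisymm (hc ε hε A hA) ?_
    -- The reverse inequality is the given one for the inverse factor, applied to the scaled set.
    have h1 := hc ε⁻¹ (inv_pos.2 hε) _ (hD ε hε.ne' A hA)
    rw [← image_comp] at h1
    have h2 : ((fun x : E n => ε⁻¹ • x) ∘ fun x => ε • x) = id := by
      funext x; simp [smul_smul, hε.ne']
    rw [h2, image_id] at h1
    calc ENNReal.ofReal (ε ^ 2) * c A
        ≤ ENNReal.ofReal (ε ^ 2) * (ENNReal.ofReal (ε⁻¹ ^ 2) * c ((fun x => ε • x) '' A)) := by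
          gcongr
      _ = c ((fun x => ε • x) '' A) := by
          rw [← mul_assoc, ← ENNReal.ofReal_mul (by positivity), ← mul_pow,
            mul_inv_cancel₀ hε.ne', one_pow, ENNReal.ofReal_one, one_mul]
  intro ε hε A hA
  rcases lt_or_gt_of_ne hε with h | h
  · have hN : (fun x : E n => -x) '' A ∈ D := by
      simpa using hD (-1) (by norm_num) A hA
    -- `-id` is symplectic, so monotonicity in both directions makes `c` even. Negative factors
    -- reduce to positive ones.
    have e : c ((fun x : E n => -x) '' A) = c A := by
      refine le_antisymm (hm _ (neg_mem_sympl r) _ hN _ hA ?_) (hm _ (neg_mem_sympl r) _ hA _ hN ?_)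
      · rintro _ ⟨_, ⟨x, hx, rfl⟩, rfl⟩
        simpa using hx
      · exact subset_rfl
    have e2 : (fun x : E n => ε • x) '' A = (fun x => (-ε) • x) '' ((fun x : E n => -x) '' A) := by
      rw [← image_comp]
      refine image_congr fun x _ => ?_
      simp
    rw [e2, hpos (-ε) (neg_pos.2 h) _ hN, e, neg_sq]
  · exact hpos ε h A hA

theorem smul_mem_borelSets (ε : ℝ) (hε : ε ≠ 0) (A : Set (E n)) (hA : A ∈ borelSets (E n)) :
    (fun x => ε • x) '' A ∈ borelSets (E n) :=
  measurableSet_image_homeo (Homeomorph.smulOfNeZero ε hε) (show MeasurableSet A from hA)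

theorem smul_mem_bddBorelSets (ε : ℝ) (hε : ε ≠ 0) (A : Set (E n)) (hA : A ∈ bddBorelSets (E n)) :
    (fun x => ε • x) '' A ∈ bddBorelSets (E n) :=
  image_mem_bddBorelSets (Homeomorph.smulOfNeZero ε hε) hA

/-- The dilations as homeomorphisms. -/
def dilHomeo (ε : ℝ) (hε : ε ≠ 0) : H n ≃ₜ H n where
  toFun := dil ε
  invFun := dil ε⁻¹
  left_inv p := by ext1 <;> simp [dil, smul_smul, hε]
  right_inv p := by ext1 <;> simp [dil, smul_smul, hε]
  continuous_toFun := by unfold dil; fun_prop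
  continuous_invFun := by unfold dil; fun_prop

theorem isConformalE_descend {r : ℕ∞} {c : Set (H n) → ℝ≥0∞}
    (hm : IsMonotoneUnder (sympl r n) (borelSets _) (descend c))
    (hc : IsConformalH (borelSets _) c) : IsConformalE (borelSets _) (descend c) := by
  refine isConformalE_of_pos smul_mem_borelSets hm fun ε hε A hA => ?_
  rw [descend, descend, ← hc ε hε _ (measurable_fst hA)]
  exact le_of_eq (congrArg c (image_preimage_fst (f := dilHomeo ε hε.ne')
    (φ := Homeomorph.smulOfNeZero ε hε.ne') (fun _ => rfl) A).symm)

theorem isConformalE_fibreValues {r : ℕ∞} {c : Set (H n) → ℝ≥0∞}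
    (hm : IsMonotoneUnder (sympl r n) (bddBorelSets _) (fun A => sInf (fibreValues c A)))
    (hc : IsConformalH (bddBorelSets _) c) :
    IsConformalE (bddBorelSets _) (fun A => sInf (fibreValues c A)) := by
  refine isConformalE_of_pos smul_mem_bddBorelSets hm fun ε hε A hA => ?_
  have h0 : ENNReal.ofReal (ε ^ 2) ≠ 0 := by simpa using hε.ne'
  rw [mul_comm, ← ENNReal.div_le_iff h0 ENNReal.ofReal_ne_top]
  refine le_sInf ?_
  rintro _ ⟨B, hB, rfl, rfl⟩
  rw [ENNReal.div_le_iff h0 ENNReal.ofReal_ne_top, mul_comm, ← hc ε hε B hB]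
  refine sInf_le ⟨_, image_mem_bddBorelSets (dilHomeo ε hε.ne') hB, ?_, rfl⟩
  exact fst_image_image (f := dil ε) (φ := fun x => ε • x) (fun _ => rfl) B

end invariants

/-! ### Integrals depending on a parameter -/

section parametric

/-- A function whose partial derivatives are jointly `C^m` is jointly `C^{m+1}`. -/
theorem contDiff_succ_of_partials {V W F : Type*} [NormedAddCommGroup V] [NormedSpace ℝ V]
    [NormedAddCommGroup W] [NormedSpace ℝ W] [NormedAddCommGroup F] [NormedSpace ℝ F] {m : ℕ∞}
    {f : V → W → F} {f₁ : V → W → V →L[ℝ] F} {f₂ : V → W → W →L[ℝ] F}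
    (h₁ : ∀ v w, HasFDerivAt (fun x => f x w) (f₁ v w) v)
    (h₂ : ∀ v w, HasFDerivAt (fun y => f v y) (f₂ v w) w)
    (c₁ : ContDiff ℝ m fun q : V × W => f₁ q.1 q.2) (c₂ : ContDiff ℝ m fun q : V × W => f₂ q.1 q.2) :
    ContDiff ℝ (m + 1) fun q : V × W => f q.1 q.2 := by
  have key : ∀ q : V × W, HasFDerivAt (fun q : V × W => f q.1 q.2)
      ((f₁ q.1 q.2).comp (ContinuousLinearMap.fst ℝ V W) +
        (f₂ q.1 q.2).comp (ContinuousLinearMap.snd ℝ V W)) q := by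
    intro q
    have := (hasStrictFDerivAt_uncurry_coprod (𝕜 := ℝ) (u := q) (f := f) (f₁ := f₁) (f₂ := f₂)
      (Filter.Eventually.of_forall fun v => h₁ v.1 v.2)
      (Filter.Eventually.of_forall fun v => h₂ v.1 v.2)
      c₁.continuous.continuousAt c₂.continuous.continuousAt).hasFDerivAt
    exact this.congr_fderiv (by ext <;> simp [Function.HasUncurry.uncurry])
  refine contDiff_succ_iff_fderiv.2 ⟨fun q => (key q).differentiableAt, by simp, ?_⟩
  rw [funext fun q => (key q).fderiv]
  exact (c₁.clm_comp contDiff_const).add (c₂.clm_comp contDiff_const)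

theorem hasFDerivAt_intervalIntegral_of_continuous {Z Y : Type*} [NormedAddCommGroup Z]
    [NormedSpace ℝ Z] [ProperSpace Z] [NormedAddCommGroup Y] [NormedSpace ℝ Y]
    {v : Z → ℝ → Y} {v' : Z → ℝ → Z →L[ℝ] Y} (hv : Continuous fun q : Z × ℝ => v q.1 q.2)
    (hv' : Continuous fun q : Z × ℝ => v' q.1 q.2)
    (h : ∀ z s, HasFDerivAt (fun z => v z s) (v' z s) z) (a b : ℝ) (z : Z) :
    HasFDerivAt (fun z => ∫ s in a..b, v z s) (∫ s in a..b, v' z s) z := by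
  obtain ⟨C, hC⟩ := ((isCompact_closedBall z 1).prod (isCompact_uIcc (a := a) (b := b)))
    |>.exists_bound_of_continuousOn hv'.continuousOn
  have c1 : ∀ z, Continuous (v z) := fun z => hv.comp (by fun_prop : Continuous fun s : ℝ => (z, s))
  have c2 : ∀ z, Continuous (v' z) := fun z => hv'.comp (by fun_prop : Continuous fun s : ℝ => (z, s))
  refine intervalIntegral.hasFDerivAt_integral_of_dominated_of_fderiv_le
    (bound := fun _ => C) (Metric.ball_mem_nhds z one_pos)
    (Filter.Eventually.of_forall fun z => (c1 z).aestronglyMeasurable)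
    ((c1 z).intervalIntegrable _ _) (c2 z).aestronglyMeasurable ?_ intervalIntegrable_const
    (Filter.Eventually.of_forall fun s _ x _ => h x s)
  exact Filter.Eventually.of_forall fun s hs x hx =>
    hC (x, s) ⟨Metric.ball_subset_closedBall hx, uIoc_subset_uIcc hs⟩

/-- Induction on the order: the derivative in `z` is an integral of the same kind with values in `Z
→L[ℝ] Y`, and the derivative in the upper limit is the integrand. The target space therefore has to
vary in the induction. -/
theorem contDiff_intervalIntegral {Z Y : Type} [NormedAddCommGroup Z] [NormedSpace ℝ Z]
    [ProperSpace Z] [NormedAddCommGroup Y] [NormedSpace ℝ Y] [CompleteSpace Y] {m : ℕ∞}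
    {v : Z → ℝ → Y} (hv : ContDiff ℝ m fun q : Z × ℝ => v q.1 q.2) :
    ContDiff ℝ m fun q : Z × ℝ => ∫ s in (0 : ℝ)..q.2, v q.1 s := by
  have nat : ∀ (k : ℕ) {Y : Type} [NormedAddCommGroup Y] [NormedSpace ℝ Y] [CompleteSpace Y]
      {v : Z → ℝ → Y}, ContDiff ℝ k (fun q : Z × ℝ => v q.1 q.2) →
      ContDiff ℝ k fun q : Z × ℝ => ∫ s in (0 : ℝ)..q.2, v q.1 s := by
    intro k
    induction k with
    | zero =>
      intro Y _ _ _ v hv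
      refine contDiff_zero.2 ?_
      exact intervalIntegral.continuous_parametric_intervalIntegral_of_continuous
        (f := fun (q : Z × ℝ) s => v q.1 s)
        (hv.continuous.comp (by fun_prop : Continuous fun p : (Z × ℝ) × ℝ => (p.1.1, p.2)))
        continuous_snd
    | succ k ih =>
      intro Y _ _ _ v hv
      let v' : Z → ℝ → Z →L[ℝ] Y := fun z s =>
        (fderiv ℝ (fun q : Z × ℝ => v q.1 q.2) (z, s)).comp (ContinuousLinearMap.inl ℝ Z ℝ)
      have hk : ContDiff ℝ k fun q : Z × ℝ => v q.1 q.2 := hv.of_le (by simp)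
      have hv1 : ContDiff ℝ k fun q : Z × ℝ => v' q.1 q.2 :=
        (hv.fderiv_right (by simp)).clm_comp contDiff_const
      have hd : ∀ z s, HasFDerivAt (fun z => v z s) (v' z s) z := by
        intro z s
        have h1 : HasFDerivAt (fun q : Z × ℝ => v q.1 q.2) _ (z, s) :=
          (hv.differentiable (by simp) (z, s)).hasFDerivAt
        exact HasFDerivAt.comp (g := fun q : Z × ℝ => v q.1 q.2) (f := fun z => (z, s)) z h1
          (hasFDerivAt_prodMk_left z s)
      have := contDiff_succ_of_partials (m := (k : ℕ∞))
        (f := fun z t => ∫ s in (0 : ℝ)..t, v z s)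
        (f₁ := fun z t => ∫ s in (0 : ℝ)..t, v' z s)
        (f₂ := fun z t => ContinuousLinearMap.toSpanSingleton ℝ (v z t))
        (fun z t => hasFDerivAt_intervalIntegral_of_continuous hv.continuous hv1.continuous hd 0 t z)
        (fun z t => ?_) (ih hv1) ?_
      · exact_mod_cast this
      · have hc : Continuous (v z) := hv.continuous.comp (by fun_prop : Continuous fun s : ℝ => (z, s))
        exact (hc.integral_hasStrictDerivAt 0 t).hasDerivAt.hasFDerivAt
      · exact ((ContinuousLinearMap.toSpanSingletonCLE (𝕜 := ℝ) (E := Y)).contDiff).comp hk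
  induction m using ENat.recTopCoe with
  | top =>
    refine contDiff_infty.2 fun k => nat k (hv.of_le ?_)
    exact_mod_cast le_top
  | coe k => exact_mod_cast nat k (by exact_mod_cast hv)

/-- The primitive of a smooth family of exact one-forms, normalised at a point, is smooth. -/
theorem contDiff_primitive {P V : Type} [NormedAddCommGroup P] [NormedSpace ℝ P] [ProperSpace P]
    [NormedAddCommGroup V] [NormedSpace ℝ V] [ProperSpace V] {m : ℕ∞} {g : P → V → ℝ}
    {β : P → V → V →L[ℝ] ℝ} (hβ : ContDiff ℝ m fun q : P × V => β q.1 q.2)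
    (hg : ∀ t x, HasFDerivAt (g t) (β t x) x) {x₀ : V} (h₀ : ∀ t, g t x₀ = 0) :
    ContDiff ℝ m fun q : P × V => g q.1 q.2 := by
  -- Integrating along the ray from `x₀` recovers `g` from `β`, so `g` inherits the joint regularity
  -- of `β`, including regularity in `t`, about which nothing is assumed for `g`.
  have hrepr : ∀ t x, g t x = ∫ τ in (0 : ℝ)..1, β t (x₀ + τ • (x - x₀)) (x - x₀) := by
    intro t x
    have hc : Continuous fun τ : ℝ => β t (x₀ + τ • (x - x₀)) (x - x₀) :=
      (hβ.continuous.comp (by fun_prop : Continuous fun τ : ℝ => (t, x₀ + τ • (x - x₀)))).clm_apply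
        continuous_const
    rw [intervalIntegral.integral_eq_sub_of_hasDerivAt (f := fun τ : ℝ => g t (x₀ + τ • (x - x₀)))
      (fun τ _ => ?_) (hc.intervalIntegrable _ _)]
    · simp [h₀]
    · have h1 : HasDerivAt (fun τ : ℝ => x₀ + τ • (x - x₀)) (x - x₀) τ := by
        simpa using ((hasDerivAt_id τ).smul_const (x - x₀)).const_add x₀
      exact (hg t _).comp_hasDerivAt τ h1
  have hv : ContDiff ℝ m fun q : (P × V) × ℝ =>
      β q.1.1 (x₀ + q.2 • (q.1.2 - x₀)) (q.1.2 - x₀) :=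
    (hβ.comp (by fun_prop : ContDiff ℝ m fun q : (P × V) × ℝ =>
      (q.1.1, x₀ + q.2 • (q.1.2 - x₀)))).clm_apply (by fun_prop)
  have h1 := contDiff_intervalIntegral
    (v := fun (q : P × V) τ => β q.1 (x₀ + τ • (q.2 - x₀)) (q.2 - x₀)) hv
  have h2 := h1.comp (by fun_prop : ContDiff ℝ m fun q : P × V => (q, (1 : ℝ)))
  rw [funext fun q : P × V => hrepr q.1 q.2]
  exact h2

/-- Carathéodory's criterion: a difference quotient that extends continuously to `x` has the
derivative as its value there. -/
theorem hasFDerivAt_of_eq_apply_sub {V : Type*} [NormedAddCommGroup V] [NormedSpace ℝ V]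
    {g : V → ℝ} {J : V → V →L[ℝ] ℝ} {x : V} (hJ : ContinuousAt J x)
    (h : ∀ y, g y - g x = J y (y - x)) : HasFDerivAt g (J x) x := by
  rw [hasFDerivAt_iff_isLittleO]
  have h1 : (fun y => g y - g x - J x (y - x)) = fun y => (J y - J x) (y - x) := by
    funext y; rw [h, sub_apply]
  rw [h1, Asymptotics.isLittleO_iff]
  intro ε hε
  have h2 : ∀ᶠ y in 𝓝 x, ‖J y - J x‖ < ε := by
    have := Metric.tendsto_nhds.1 hJ ε hε
    simpa [dist_eq_norm] using this
  filter_upwards [h2] with y hy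
  exact (ContinuousLinearMap.le_opNorm _ _).trans (by gcongr)

/-- The time derivative of the primitive of a `C^1` family of exact one-forms is a primitive of the
time derivative of the family. -/
theorem hasFDerivAt_deriv_primitive {V : Type} [NormedAddCommGroup V] [NormedSpace ℝ V]
    [ProperSpace V] {g : ℝ → V → ℝ} {β β' : ℝ → V → V →L[ℝ] ℝ}
    (hβ : Continuous fun q : ℝ × V => β q.1 q.2) (hβ' : Continuous fun q : ℝ × V => β' q.1 q.2)
    (hd : ∀ t x, HasDerivAt (fun s => β s x) (β' t x) t)
    (hg : ∀ t x, HasFDerivAt (g t) (β t x) x)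
    {g' : ℝ → V → ℝ} (hg' : ∀ t x, HasDerivAt (fun s => g s x) (g' t x) t) (t : ℝ) (x : V) :
    HasFDerivAt (g' t) (β' t x) x := by
  -- `J y` averages `β'` over the segment from `x` to `y`. Differentiating the segment formula for
  -- `g s y - g s x` under the integral sign identifies `J y (y - x)` with the increment of `g'`,
  -- with no second derivative of `g` required.
  let J : V → V →L[ℝ] ℝ := fun y => ∫ τ in (0 : ℝ)..1, β' t (x + τ • (y - x))
  have hJ : Continuous J :=
    intervalIntegral.continuous_parametric_intervalIntegral_of_continuous'
      (f := fun y τ => β' t (x + τ • (y - x)))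
      (hβ'.comp (by fun_prop : Continuous fun p : V × ℝ => (t, x + p.2 • (p.1 - x)))) 0 1
  have hJx : J x = β' t x := by simp [J]
  have hcτ : ∀ (B : ℝ → V → V →L[ℝ] ℝ), (Continuous fun q : ℝ × V => B q.1 q.2) → ∀ s y,
      Continuous fun τ : ℝ => B s (x + τ • (y - x)) := fun B hB s y =>
    hB.comp (by fun_prop : Continuous fun τ : ℝ => (s, x + τ • (y - x)))
  rw [← hJx]
  refine hasFDerivAt_of_eq_apply_sub hJ.continuousAt fun y => ?_
  have hrepr : ∀ s, g s y - g s x = ∫ τ in (0 : ℝ)..1, β s (x + τ • (y - x)) (y - x) := by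
    intro s
    rw [intervalIntegral.integral_eq_sub_of_hasDerivAt (f := fun τ : ℝ => g s (x + τ • (y - x)))
      (fun τ _ => ?_) (((hcτ β hβ s y).clm_apply continuous_const).intervalIntegrable _ _)]
    · simp
    · have h1 : HasDerivAt (fun τ : ℝ => x + τ • (y - x)) (y - x) τ := by
        simpa using ((hasDerivAt_id τ).smul_const (y - x)).const_add x
      exact (hg s _).comp_hasDerivAt τ h1
  have e1 : HasDerivAt (fun s => g s y - g s x) (g' t y - g' t x) t := (hg' t y).sub (hg' t x)
  have e2 : HasDerivAt (fun s => g s y - g s x) (J y (y - x)) t := by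
    rw [funext hrepr]
    have hv : ∀ B : ℝ → V → V →L[ℝ] ℝ, (Continuous fun q : ℝ × V => B q.1 q.2) →
        Continuous fun q : ℝ × ℝ => B q.1 (x + q.2 • (y - x)) (y - x) := fun B hB =>
      (hB.comp (by fun_prop : Continuous fun q : ℝ × ℝ => (q.1, x + q.2 • (y - x)))).clm_apply
        continuous_const
    have h3 := hasFDerivAt_intervalIntegral_of_continuous
      (v := fun s τ => β s (x + τ • (y - x)) (y - x))
      (v' := fun s τ => ContinuousLinearMap.toSpanSingleton ℝ (β' s (x + τ • (y - x)) (y - x)))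
      (hv β hβ) ((ContinuousLinearMap.toSpanSingletonCLE (𝕜 := ℝ) (E := ℝ)).continuous.comp
        (hv β' hβ')) (fun s τ => ((hd s _).clm_apply (hasDerivAt_const s (y - x))
          |>.congr_deriv (by simp)).hasFDerivAt) 0 1 t
    have h4 := h3.hasDerivAt
    refine h4.congr_deriv ?_
    have i1 : IntervalIntegrable (fun τ => ContinuousLinearMap.toSpanSingleton ℝ
        (β' t (x + τ • (y - x)) (y - x))) volume 0 1 :=
      ((ContinuousLinearMap.toSpanSingletonCLE (𝕜 := ℝ) (E := ℝ)).continuous.comp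
        ((hcτ β' hβ' t y).clm_apply continuous_const)).intervalIntegrable _ _
    have e3 := ContinuousLinearMap.intervalIntegral_apply i1 (1 : ℝ)
    have e4 := ContinuousLinearMap.intervalIntegral_apply
      ((hcτ β' hβ' t y).intervalIntegrable (μ := volume) 0 1) (y - x)
    refine e3.trans (Eq.trans ?_ e4.symm)
    simp
  exact e1.unique e2

end parametric

/-! ### Mixed partial derivatives -/

section mixed
variable {X Y : Type*} [NormedAddCommGroup X] [NormedSpace ℝ X] [NormedAddCommGroup Y]
  [NormedSpace ℝ Y] {S : Set ℝ} {Q : ℝ → X → Y}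

theorem hasDerivWithinAt_partial_fst
    (hQ : DifferentiableOn ℝ (fun q : ℝ × X => Q q.1 q.2) (S ×ˢ univ)) {t : ℝ} (ht : t ∈ S) (x : X) :
    HasDerivWithinAt (fun s => Q s x)
      (fderivWithin ℝ (fun q : ℝ × X => Q q.1 q.2) (S ×ˢ univ) (t, x) (1, 0)) S t := by
  have h1 := (hQ (t, x) ⟨ht, mem_univ _⟩).hasFDerivWithinAt
  have h2 : HasDerivWithinAt (fun s : ℝ => (s, x)) ((1 : ℝ), (0 : X)) S t :=
    (hasDerivWithinAt_id t S).prodMk (hasDerivWithinAt_const t S x)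
  exact HasFDerivWithinAt.comp_hasDerivWithinAt (l := fun q : ℝ × X => Q q.1 q.2) t h1 h2
    (show MapsTo (fun s : ℝ => (s, x)) S (S ×ˢ univ) from fun s hs => ⟨hs, mem_univ _⟩)

theorem hasFDerivAt_partial_snd
    (hQ : DifferentiableOn ℝ (fun q : ℝ × X => Q q.1 q.2) (S ×ˢ univ)) {t : ℝ} (ht : t ∈ S) (x : X) :
    HasFDerivAt (Q t) ((fderivWithin ℝ (fun q : ℝ × X => Q q.1 q.2) (S ×ˢ univ) (t, x)).comp
      (ContinuousLinearMap.inr ℝ ℝ X)) x := by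
  have h1 := (hQ (t, x) ⟨ht, mem_univ _⟩).hasFDerivWithinAt
  rw [← hasFDerivWithinAt_univ]
  exact HasFDerivWithinAt.comp (g := fun q : ℝ × X => Q q.1 q.2) (f := fun y => (t, y)) x h1
    (hasFDerivAt_prodMk_right t x).hasFDerivWithinAt fun y _ => ⟨ht, mem_univ _⟩

/-- Symmetry of the mixed partial derivatives. -/
theorem exists_mixed_partial (hQ : ContDiffOn ℝ 2 (fun q : ℝ × X => Q q.1 q.2) (S ×ˢ univ))
    (hS : UniqueDiffOn ℝ S) {t : ℝ} (ht : t ∈ S) (ht' : t ∈ closure (interior S)) (x : X) :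
    ∃ M : X →L[ℝ] Y, HasFDerivAt (fun y => derivWithin (fun s => Q s y) S t) M x ∧
      HasDerivWithinAt (fun s => fderiv ℝ (Q s) x) M S t := by
  set q₀ : ℝ × X := (t, x)
  have hT : UniqueDiffOn ℝ (S ×ˢ (univ : Set X)) := hS.prod uniqueDiffOn_univ
  have hq : q₀ ∈ S ×ˢ (univ : Set X) := ⟨ht, mem_univ _⟩
  have hd : DifferentiableOn ℝ (fun q : ℝ × X => Q q.1 q.2) (S ×ˢ univ) :=
    hQ.differentiableOn (by simp)
  set G := fderivWithin ℝ (fun q : ℝ × X => Q q.1 q.2) (S ×ˢ univ) with hG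
  have hG1 : ContDiffOn ℝ 1 G (S ×ˢ univ) := hQ.fderivWithin hT (by norm_num)
  have hB := (hG1.differentiableOn (by simp) q₀ hq).hasFDerivWithinAt
  set B := fderivWithin ℝ G (S ×ˢ univ) q₀
  -- At an end point of the time interval, symmetry of the second derivative follows from the
  -- interior by closure.
  have hcl : q₀ ∈ closure (interior (S ×ˢ (univ : Set X))) := by
    rw [interior_prod_eq, closure_prod_eq, interior_univ, closure_univ]
    exact ⟨ht', mem_univ _⟩
  have hsymm : ∀ a b, B a b = B b a := fun a b =>
    ((hQ q₀ hq).isSymmSndFDerivWithinAt (by simp) hT hcl hq).eq a b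
  have e1 : (fun y => derivWithin (fun s => Q s y) S t) = fun y => G (t, y) (1, 0) :=
    funext fun y => (hasDerivWithinAt_partial_fst hd ht y).derivWithin (hS t ht)
  refine ⟨(B (1, 0)).comp (ContinuousLinearMap.inr ℝ ℝ X), ?_, ?_⟩
  · rw [e1, ← hasFDerivWithinAt_univ]
    have h1 : HasFDerivWithinAt (fun y : X => G (t, y)) (B.comp (ContinuousLinearMap.inr ℝ ℝ X))
        univ x := HasFDerivWithinAt.comp (g := G) (f := fun y => (t, y)) x hB
      (hasFDerivAt_prodMk_right t x).hasFDerivWithinAt fun y _ => ⟨ht, mem_univ _⟩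
    refine (h1.clm_apply (hasFDerivWithinAt_const ((1 : ℝ), (0 : X)) x univ)).congr_fderiv ?_
    ext u
    simp [hsymm (0, u)]
  · have h2 : HasDerivWithinAt (fun s : ℝ => (s, x)) ((1 : ℝ), (0 : X)) S t :=
      (hasDerivWithinAt_id t S).prodMk (hasDerivWithinAt_const t S x)
    have h1 : HasDerivWithinAt (fun s : ℝ => G (s, x)) (B (1, 0)) S t :=
      HasFDerivWithinAt.comp_hasDerivWithinAt (l := G) t hB h2
        (show MapsTo (fun s : ℝ => (s, x)) S (S ×ˢ univ) from fun s hs => ⟨hs, mem_univ _⟩)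
    have h3 := h1.clm_comp (hasDerivWithinAt_const t S (ContinuousLinearMap.inr ℝ ℝ X))
    refine (h3.congr_of_mem (fun s hs => (hasFDerivAt_partial_snd hd hs x).fderiv) ht).congr_deriv ?_
    simp

end mixed

/-! ### The Hamiltonian of a family of contact lifts -/

section hamiltonian
variable {n : ℕ}

/-- Cartan's formula for the pull backs by a family of symplectic maps of the primitive of `ω`. -/
theorem hasFDerivAt_sub_half_omega {S : Set ℝ} {t : ℝ} (hS : UniqueDiffWithinAt ℝ S t)
    {φ : ℝ → E n → E n} {φ' : E n → E n} {F' : E n → ℝ} {x : E n} {M : E n →L[ℝ] E n}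
    (h1 : HasDerivWithinAt (fun s => φ s x) (φ' x) S t) (h2 : HasFDerivAt φ' M x)
    (h3 : HasDerivWithinAt (fun s => fderiv ℝ (φ s) x) M S t) (h4 : DifferentiableAt ℝ (φ t) x)
    {A' : E n →L[ℝ] ℝ} (h5 : HasDerivWithinAt (fun s => contactForm (φ s) x) A' S t)
    (h6 : HasFDerivAt F' A' x) :
    HasFDerivAt (fun y => F' y - (1 / 2) * omega (φ t y) (φ' y))
      ((omegaL n (φ' x)).comp (fderiv ℝ (φ t) x)) x := by
  -- Product rule for `½(ω(φ, Dφ ·) - ω(x, ·))`. When the differential of `½ω(φ, φ')` is subtracted,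
  -- the terms with `M` cancel and the two remaining halves add up to `ω(φ', Dφ ·)`.
  have hA : A' = (1 / 2 : ℝ) • ((omegaL n (φ' x)).comp (fderiv ℝ (φ t) x) +
      (omegaL n (φ t x)).comp M) := by
    refine hS.eq_deriv _ h5 ?_
    have e1 : HasDerivWithinAt (fun s => omegaL n (φ s x)) (omegaL n (φ' x)) S t :=
      (omegaL n).hasFDerivAt.comp_hasDerivWithinAt t h1
    exact ((e1.clm_comp h3).sub_const _).const_smul (1 / 2 : ℝ)
  have e2 : HasFDerivAt (fun y => omegaL n (φ t y)) ((omegaL n).comp (fderiv ℝ (φ t) x)) x :=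
    (omegaL n).hasFDerivAt.comp x h4.hasFDerivAt
  have e3 := (e2.clm_apply h2).const_mul (1 / 2 : ℝ)
  refine (h6.sub e3).congr_fderiv ?_
  ext u
  rw [hA]
  simp [omega_swap (fderiv ℝ (φ t) x u) (φ' x)]
  ring

variable {m : ℕ∞} {φ : ℝ → E n → E n}

theorem contDiff_fderiv_snd (hφ : ContDiff ℝ (m + 1) fun q : ℝ × E n => φ q.1 q.2) :
    ContDiff ℝ m fun q : ℝ × E n => fderiv ℝ (φ q.1) q.2 := by
  have h := (hφ.fderiv_right (m := m) le_rfl).clm_comp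
    (contDiff_const (c := ContinuousLinearMap.inr ℝ ℝ (E n)))
  have hd : DifferentiableOn ℝ (fun q : ℝ × E n => φ q.1 q.2) (univ ×ˢ univ) :=
    (hφ.differentiable (by simp)).differentiableOn
  have e : (fun q : ℝ × E n => fderiv ℝ (φ q.1) q.2) = fun q =>
      (fderiv ℝ (fun q : ℝ × E n => φ q.1 q.2) q).comp (ContinuousLinearMap.inr ℝ ℝ (E n)) := by
    funext q
    rw [(hasFDerivAt_partial_snd hd (mem_univ q.1) q.2).fderiv, univ_prod_univ, fderivWithin_univ]
  rw [e]
  exact h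

theorem contDiff_deriv_fst {W : Type*} [NormedAddCommGroup W] [NormedSpace ℝ W] {f : ℝ → E n → W}
    (hf : ContDiff ℝ (m + 1) fun q : ℝ × E n => f q.1 q.2) :
    ContDiff ℝ m fun q : ℝ × E n => deriv (fun s => f s q.2) q.1 := by
  have h := (hf.fderiv_right (m := m) le_rfl).clm_apply
    (contDiff_const (c := ((1 : ℝ), (0 : E n))))
  have hd : DifferentiableOn ℝ (fun q : ℝ × E n => f q.1 q.2) (univ ×ˢ univ) :=
    (hf.differentiable (by simp)).differentiableOn
  have e : (fun q : ℝ × E n => deriv (fun s => f s q.2) q.1) = fun q =>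
      fderiv ℝ (fun q : ℝ × E n => f q.1 q.2) q (1, 0) := by
    funext q
    have := hasDerivWithinAt_partial_fst hd (mem_univ q.1) q.2
    rw [hasDerivWithinAt_univ] at this
    rw [this.deriv, univ_prod_univ, fderivWithin_univ]
  rw [e]
  exact h

theorem hasDerivAt_of_contDiff {W : Type*} [NormedAddCommGroup W] [NormedSpace ℝ W]
    {f : ℝ → E n → W} (hf : ContDiff ℝ 1 fun q : ℝ × E n => f q.1 q.2) (t : ℝ) (x : E n) :
    HasDerivAt (fun s => f s x) (deriv (fun s => f s x) t) t :=
  ((hf.differentiable (by simp)).comp (by fun_prop : Differentiable ℝ fun s : ℝ => (s, x)) t).hasDerivAt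

/-- The contact lifts of a smooth family of symplectic maps, and the associated Hamiltonians. -/
theorem exists_hamiltonian [NeZero n] (hm : 1 ≤ m) (hφ : ContDiff ℝ (m + 1) fun q : ℝ × E n => φ q.1 q.2)
    {F : ℝ → E n → ℝ} (hF : ∀ t, IsContactLift (φ t) (F t)) {R : ℝ}
    (hφR : ∀ t x, R < ‖x‖ → φ t x = x) (hFR : ∀ t x, R < ‖x‖ → F t x = 0) :
    ContDiff ℝ (m + 1) (fun q : ℝ × E n => F q.1 q.2) ∧
    ∃ k : ℝ → E n → ℝ, ContDiff ℝ m (fun q : ℝ × E n => k q.1 q.2) ∧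
      (∀ t x, HasDerivAt (fun s => F s x)
        ((1 / 2) * omega (φ t x) (deriv (fun s => φ s x) t) + k t x) t) ∧
      (∀ t x, HasFDerivAt (k t)
        ((omegaL n (deriv (fun s => φ s x) t)).comp (fderiv ℝ (φ t) x)) x) ∧
      ∀ t x, R < ‖x‖ → k t x = 0 := by
  obtain ⟨x₀, hx₀⟩ := NormedSpace.exists_lt_norm ℝ (E n) R
  have hm1 : (1 : WithTop ℕ∞) ≤ m := by exact_mod_cast hm
  have hm2 : (2 : WithTop ℕ∞) ≤ m + 1 := by
    have : (1 : WithTop ℕ∞) + 1 ≤ m + 1 := by gcongr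
    rwa [one_add_one_eq_two] at this
  have hφm : ContDiff ℝ m fun q : ℝ × E n => φ q.1 q.2 := hφ.of_le le_self_add
  have hD := contDiff_fderiv_snd hφ
  have hV := contDiff_deriv_fst hφ
  have hα : ContDiff ℝ m fun q : ℝ × E n => contactForm (φ q.1) q.2 :=
    ((((omegaL n).contDiff.comp hφm).clm_comp hD).sub
      ((omegaL n).contDiff.comp contDiff_snd)).const_smul _
  have hFd : ∀ t x, HasFDerivAt (F t) (contactForm (φ t) x) x := fun t x => by
    rw [contactForm, ← (hF t).fderiv_eq]
    exact ((hF t).differentiable x).hasFDerivAt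
  -- The forms `dF` are only of class `C^m`, so one order in time is still missing here. It is
  -- recovered below through `k`.
  have hFm : ContDiff ℝ m fun q : ℝ × E n => F q.1 q.2 :=
    contDiff_primitive hα hFd fun t => hFR t x₀ hx₀
  let F' : ℝ → E n → ℝ := fun t x => deriv (fun s => F s x) t
  let α' : ℝ → E n → E n →L[ℝ] ℝ := fun t x => deriv (fun s => contactForm (φ s) x) t
  have hα1 : ContDiff ℝ 1 fun q : ℝ × E n => contactForm (φ q.1) q.2 := hα.of_le hm1
  have hF' : ∀ t x, HasDerivAt (fun s => F s x) (F' t x) t :=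
    hasDerivAt_of_contDiff (hFm.of_le hm1)
  have hα' : ∀ t x, HasDerivAt (fun s => contactForm (φ s) x) (α' t x) t :=
    hasDerivAt_of_contDiff (f := fun t x => contactForm (φ t) x) hα1
  have hα'c : Continuous fun q : ℝ × E n => α' q.1 q.2 :=
    (contDiff_deriv_fst (m := 0) (f := fun t x => contactForm (φ t) x) (by simpa using hα1)).continuous
  have hF'd : ∀ t x, HasFDerivAt (F' t) (α' t x) x :=
    hasFDerivAt_deriv_primitive hα.continuous hα'c hα' hFd hF'
  let k : ℝ → E n → ℝ := fun t x => F' t x - (1 / 2) * omega (φ t x) (deriv (fun s => φ s x) t)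
  have hk : ∀ t x, HasFDerivAt (k t)
      ((omegaL n (deriv (fun s => φ s x) t)).comp (fderiv ℝ (φ t) x)) x := by
    intro t x
    obtain ⟨M, hM1, hM2⟩ := exists_mixed_partial (S := univ) (Q := φ)
      (by rw [univ_prod_univ, contDiffOn_univ]; exact hφ.of_le hm2) uniqueDiffOn_univ
      (mem_univ t) (by simp) x
    simp only [derivWithin_univ] at hM1
    exact hasFDerivAt_sub_half_omega (φ := φ) (φ' := fun y => deriv (fun s => φ s y) t)
      (uniqueDiffWithinAt_univ (x := t))
      (hasDerivAt_of_contDiff (hφ.of_le (hm1.trans le_self_add)) t x).hasDerivWithinAt hM1 hM2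
      ((hF t).preservesOmega.hasFDerivAt x).differentiableAt (hα' t x).hasDerivWithinAt (hF'd t x)
  have hkR : ∀ t x, R < ‖x‖ → k t x = 0 := by
    intro t x hx
    have e1 : (fun s => F s x) = fun _ => 0 := funext fun s => hFR s x hx
    have e2 : (fun s => φ s x) = fun _ => x := funext fun s => hφR s x hx
    simp only [k, F', e1, e2, deriv_const, omega_zero_right, mul_zero, sub_zero]
  -- By its definition through `Ḟ`, `k` has one derivative fewer. Its space differential involves
  -- only first derivatives of `φ`, so integrating from a point outside the support makes `k`, and
  -- then `Ḟ`, of class `C^m`.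
  have hkm : ContDiff ℝ m fun q : ℝ × E n => k q.1 q.2 :=
    contDiff_primitive (β := fun t x => (omegaL n (deriv (fun s => φ s x) t)).comp (fderiv ℝ (φ t) x))
      (((omegaL n).contDiff.comp hV).clm_comp hD) hk fun t => hkR t x₀ hx₀
  have hF'k : ∀ t x, F' t x = (1 / 2) * omega (φ t x) (deriv (fun s => φ s x) t) + k t x :=
    fun t x => by simp only [k]; ring
  have hσ : ContDiff ℝ m fun q : ℝ × E n => F' q.1 q.2 := by
    rw [funext fun q : ℝ × E n => hF'k q.1 q.2]
    exact (contDiff_const.mul (((omegaL n).contDiff.comp hφm).clm_apply hV)).add hkm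
  refine ⟨contDiff_succ_of_partials
    (f₁ := fun t x => ContinuousLinearMap.toSpanSingleton ℝ (F' t x))
    (fun t x => (hF' t x).hasFDerivAt) hFd
    ((ContinuousLinearMap.toSpanSingletonCLE (𝕜 := ℝ) (E := ℝ)).contDiff.comp hσ) hα, k, hkm,
    fun t x => ?_, hk, hkR⟩
  rw [← hF'k]
  exact hF' t x

end hamiltonian

/-! ### Curves of symplectic maps -/

section curves
variable {n : ℕ} {r : ℕ∞}

theorem one_le_coe_of_two_le (hr : 2 ≤ r) : (1 : WithTop ℕ∞) ≤ r := by
  exact_mod_cast (by norm_num : (1 : ℕ∞) ≤ 2).trans hr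

theorem exists_eq_add_one_of_two_le (hr : 2 ≤ r) : ∃ m : ℕ∞, 1 ≤ m ∧ (r : WithTop ℕ∞) = m + 1 := by
  induction r using ENat.recTopCoe with
  | top => exact ⟨⊤, le_top, rfl⟩
  | coe k =>
    have hk : 2 ≤ k := by exact_mod_cast hr
    obtain ⟨j, rfl⟩ := Nat.exists_eq_add_of_le' (by omega : 1 ≤ k)
    exact ⟨j, by exact_mod_cast (by omega : 1 ≤ j), by simp⟩

theorem mem_closure_interior_Icc {t : ℝ} (ht : t ∈ Icc (0 : ℝ) 1) :
    t ∈ closure (interior (Icc (0 : ℝ) 1)) := by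
  rwa [interior_Icc, closure_Ioo zero_ne_one]

theorem IsSmoothCurve.hasDerivWithinAt {X : Type*} [NormedAddCommGroup X] [NormedSpace ℝ X]
    {c : ℝ → X → X} (hc : IsSmoothCurve r c) (hr : 2 ≤ r) {t : ℝ} (ht : t ∈ Icc (0 : ℝ) 1) (x : X) :
    HasDerivWithinAt (fun s => c s x) (velocity c t x) (Icc 0 1) t :=
  (hasDerivWithinAt_partial_fst (hc.differentiableOn
    (by have := one_le_coe_of_two_le hr; exact (zero_lt_one.trans_le this).ne')) ht
    x).differentiableWithinAt.hasDerivWithinAt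

theorem velocity_eq {X Y : Type*} [NormedAddCommGroup Y] [NormedSpace ℝ Y] {c : ℝ → X → Y}
    {t : ℝ} (ht : t ∈ Icc (0 : ℝ) 1) {x : X} {v : Y}
    (h : HasDerivWithinAt (fun s => c s x) v (Icc 0 1) t) : velocity c t x = v :=
  h.derivWithin (uniqueDiffOn_Icc zero_lt_one t ht)

/-- A function whose pull back by `φ` is a Hamiltonian for `w`. -/
theorem hasFDerivAt_comp_symm {φ : E n ≃ₜ E n} (hφ : PreservesOmega φ)
    (hφ' : PreservesOmega φ.symm) {k : E n → ℝ} {w x : E n}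
    (hk : HasFDerivAt k ((omegaL n w).comp (fderiv ℝ φ x)) x) :
    HasFDerivAt (fun y => k (φ.symm y)) (omegaL n w) (φ x) := by
  have h1 := hφ'.hasFDerivAt (φ x)
  have h2 : HasFDerivAt φ (fderiv ℝ φ x) (φ.symm (φ x)) := by
    rw [φ.symm_apply_apply]; exact hφ.hasFDerivAt x
  have h3 : HasFDerivAt (φ ∘ φ.symm) ((fderiv ℝ φ x).comp (fderiv ℝ φ.symm (φ x))) (φ x) :=
    h2.comp (φ x) h1
  have h4 : φ ∘ φ.symm = id := by funext y; simp
  rw [h4] at h3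
  have h5 := h3.unique (hasFDerivAt_id (φ x))
  have h6 : HasFDerivAt k ((omegaL n w).comp (fderiv ℝ φ x)) (φ.symm (φ x)) := by
    rwa [φ.symm_apply_apply]
  refine (h6.comp (φ x) h1).congr_fderiv ?_
  rw [ContinuousLinearMap.comp_assoc, h5]
  rfl

theorem exists_radius_symplC (φ : symplC r n) : ∃ R, ∀ x : E n, R < ‖x‖ → φ.1 x = x := by
  obtain ⟨-, K, hK, h⟩ := φ.2
  obtain ⟨R, -, hR⟩ := exists_closedBall_of_isCompact hK
  exact ⟨R, fun x hx => h x (hR x hx)⟩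

/-- The support of a Hamiltonian flow is controlled by the supports of the Hamiltonian and of the
starting point. -/
theorem IsHamiltonianFlow.exists_radius (hr : 2 ≤ r) {c : ℝ → symplC r n} {h : ℝ → E n → ℝ}
    (hc : IsHamiltonianFlow c h) : ∃ R, 0 ≤ R ∧ ∀ t ∈ Icc (0 : ℝ) 1, ∀ x : E n, R < ‖x‖ →
      (c t).1 x = x ∧ h t x = 0 := by
  obtain ⟨h1, ⟨K, hK, hhK⟩, h3⟩ := hc
  obtain ⟨R₁, hR₁, hRK⟩ := exists_closedBall_of_isCompact hK
  obtain ⟨R₂, hR₂⟩ := exists_radius_symplC (c 0)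
  refine ⟨max R₁ R₂, le_max_of_le_left hR₁, ?_⟩
  have hh : ∀ t ∈ Icc (0 : ℝ) 1, ∀ x : E n, max R₁ R₂ < ‖x‖ → h t x = 0 := fun t ht x hx =>
    hhK t ht x (hRK x ((le_max_left _ _).trans_lt hx))
  have hopen : IsOpen {x : E n | max R₁ R₂ < ‖x‖} := isOpen_lt continuous_const continuous_norm
  suffices H : ∀ x : E n, max R₁ R₂ < ‖x‖ → Icc (0 : ℝ) 1 ⊆ {t | (c t).1 x = x} from
    fun t ht x hx => ⟨H x hx ht, hh t ht x hx⟩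
  intro x hx
  have hd := fun t ht => h1.hasDerivWithinAt hr (t := t) ht x
  have hcont : ContinuousOn (fun t => (c t).1 x) (Icc (0 : ℝ) 1) := fun t ht =>
    (hd t ht).continuousWithinAt
  -- A connectedness argument in time: the times at which `x` is fixed form a closed set. Just after
  -- such a time the orbit is still in the open exterior where `h` vanishes, so nondegeneracy of `ω`
  -- makes its velocity zero and it stays at `x`.
  refine IsClosed.Icc_subset_of_forall_mem_nhdsWithin ?_ (hR₂ x ((le_max_right _ _).trans_lt hx)) ?_
  · rw [inter_comm]
    exact hcont.preimage_isClosed_of_isClosed isClosed_Icc isClosed_singleton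
  · rintro t ⟨htx, ht⟩
    have htx' : (c t).1 x = x := htx
    have hnear : ∀ᶠ s in 𝓝[Icc 0 1] t, (c s).1 x ∈ {x : E n | max R₁ R₂ < ‖x‖} :=
      (hcont t (Ico_subset_Icc_self ht)).eventually
        (hopen.mem_nhds (show max R₁ R₂ < ‖(c t).1 x‖ by rwa [htx']))
    obtain ⟨ε, hε, hball⟩ := Metric.mem_nhdsWithin_iff.1 hnear
    have hsub : Icc t (min 1 (t + ε / 2)) ⊆ Icc (0 : ℝ) 1 :=
      Icc_subset_Icc ht.1 (min_le_left _ _)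
    have hlt : t < min 1 (t + ε / 2) := lt_min ht.2 (by linarith)
    have hzero : ∀ s ∈ Icc t (min 1 (t + ε / 2)),
        HasDerivWithinAt (fun s => (c s).1 x) 0 (Icc t (min 1 (t + ε / 2))) s := by
      intro s hs
      have hs' := hsub hs
      have hsb : max R₁ R₂ < ‖(c s).1 x‖ := hball ⟨by
        have := hs.2.trans (min_le_right _ _)
        rw [Metric.mem_ball, Real.dist_eq, abs_of_nonneg (sub_nonneg.2 hs.1)]
        linarith, hs'⟩
      obtain ⟨L, hL, hL'⟩ := h3 s hs' x
      have hL0 : L = 0 := by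
        refine hL.unique ((hasFDerivAt_const (0 : ℝ) ((c s).1 x)).congr_of_eventuallyEq ?_)
        exact Filter.mem_of_superset (hopen.mem_nhds hsb) fun y hy => hh s hs' y hy
      have hv : velocity (fun s y => (c s).1 y) s x = 0 :=
        eq_zero_of_omega_eq_zero fun v => by rw [← hL' v, hL0]; rfl
      have := hd s hs'
      rw [hv] at this
      exact this.mono hsub
    have hconst := constant_of_derivWithin_zero (fun s hs => (hzero s hs).differentiableWithinAt)
      fun s hs => (hzero s (Ico_subset_Icc_self hs)).derivWithin
        (uniqueDiffOn_Icc hlt s (Ico_subset_Icc_self hs))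
    refine Filter.mem_of_superset (Ioc_mem_nhdsGT hlt) fun s hs => ?_
    exact (hconst s (Ioc_subset_Icc_self hs)).trans htx'

end curves

/-! ### Reparametrised isotopies and their lifts -/

section reparam
variable {n : ℕ} {r m : ℕ∞}

theorem smoothTransition_mem (t : ℝ) : Real.smoothTransition t ∈ Icc (0 : ℝ) 1 :=
  ⟨Real.smoothTransition.nonneg t, Real.smoothTransition.le_one t⟩

/-- The contact lifts and the Hamiltonians of an isotopy, reparametrised to be constant near the
end points of the time interval. -/
theorem exists_reparam_lift [NeZero n] (hr : (r : WithTop ℕ∞) = m + 1) (hm : 1 ≤ m)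
    {c : ℝ → symplC r n} (hc : IsSmoothCurve r fun t x => (c t).1 x) {R : ℝ} (hR : 0 ≤ R)
    (hsupp : ∀ t ∈ Icc (0 : ℝ) 1, ∀ x : E n, R < ‖x‖ → (c t).1 x = x) :
    let φ : ℝ → E n → E n := fun t x => (c (Real.smoothTransition t)).1 x
    ContDiff ℝ (m + 1) (fun q : ℝ × E n => φ q.1 q.2) ∧ ∃ F k : ℝ → E n → ℝ,
      ContDiff ℝ (m + 1) (fun q : ℝ × E n => F q.1 q.2) ∧
      (∀ t, IsContactLift (φ t) (F t)) ∧ (∀ t x, R < ‖x‖ → F t x = 0) ∧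
      ContDiff ℝ m (fun q : ℝ × E n => k q.1 q.2) ∧
      (∀ t x, HasDerivAt (fun s => F s x)
        ((1 / 2) * omega (φ t x) (deriv (fun s => φ s x) t) + k t x) t) ∧
      (∀ t x, HasFDerivAt (k t)
        ((omegaL n (deriv (fun s => φ s x) t)).comp (fderiv ℝ (φ t) x)) x) ∧
      ∀ t x, R < ‖x‖ → k t x = 0 := by
  intro φ
  -- `Real.smoothTransition` maps the whole line into `[0, 1]`, which turns regularity on a closed
  -- time interval into regularity for all times.
  have hφ : ContDiff ℝ (m + 1) (fun q : ℝ × E n => φ q.1 q.2) := by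
    rw [← hr]
    exact ContDiffOn.comp_contDiff (f := fun q : ℝ × E n => (Real.smoothTransition q.1, q.2)) hc
      ((Real.smoothTransition.contDiff.comp contDiff_fst).prodMk contDiff_snd)
      fun q => ⟨smoothTransition_mem q.1, mem_univ _⟩
  have hφR : ∀ t x, R < ‖x‖ → φ t x = x := fun t => hsupp _ (smoothTransition_mem t)
  choose F hF hFR using fun t => exists_isContactLift_of_support
    (c (Real.smoothTransition t)).2.1.1.1 (c (Real.smoothTransition t)).2.1.2.1.1 hR (hφR t)
  obtain ⟨h1, k, h2, h3, h4, h5⟩ := exists_hamiltonian hm hφ hF hφR hFR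
  exact ⟨hφ, F, k, h1, hF, hFR, h2, h3, h4, h5⟩

theorem exists_bound_of_support {k : ℝ → E n → ℝ} (hk : Continuous fun q : ℝ × E n => k q.1 q.2)
    {R : ℝ} (hkR : ∀ t x, R < ‖x‖ → k t x = 0) :
    ∃ C : ℝ≥0, ∀ t ∈ Icc (0 : ℝ) 1, ∀ x, ‖k t x‖ ≤ C := by
  obtain ⟨C, hC⟩ := ((isCompact_Icc (a := (0 : ℝ)) (b := 1)).prod
    (isCompact_closedBall (0 : E n) R)).exists_bound_of_continuousOn hk.continuousOn
  refine ⟨C.toNNReal, fun t ht x => ?_⟩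
  by_cases hx : R < ‖x‖
  · rw [hkR t x hx, norm_zero]; exact NNReal.coe_nonneg _
  · exact (hC (t, x) ⟨ht, by simpa using hx⟩).trans (Real.le_coe_toNNReal C)

theorem hasDerivAt_of_contDiff_add_one {W : Type*} [NormedAddCommGroup W] [NormedSpace ℝ W]
    {f : ℝ → E n → W} (hf : ContDiff ℝ (m + 1) fun q : ℝ × E n => f q.1 q.2) (t : ℝ) (x : E n) :
    HasDerivAt (fun s => f s x) (deriv (fun s => f s x) t) t :=
  hasDerivAt_of_contDiff (hf.of_le le_add_self) t x

/-- The end points of an isotopy with compact support have finite Hofer distance. -/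
theorem hoferDist_lt_top_of_isotopy [NeZero n] (hr : 2 ≤ r) {c : ℝ → symplC r n}
    (hc : IsSmoothCurve r fun t x => (c t).1 x)
    (hsupp : ∃ K : Set (E n), IsCompact K ∧ ∀ t ∈ Icc (0 : ℝ) 1, ∀ x, x ∉ K → (c t).1 x = x) :
    hoferDist (c 0) (c 1) < ⊤ := by
  obtain ⟨m, hm, hrm⟩ := exists_eq_add_one_of_two_le hr
  obtain ⟨K, hK, hsupp⟩ := hsupp
  obtain ⟨R, hR, hRK⟩ := exists_closedBall_of_isCompact hK
  obtain ⟨hφ, F, k, -, -, -, hk, -, hk', hkR⟩ := exists_reparam_lift hrm hm hc hR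
    fun t ht x hx => hsupp t ht x (hRK x hx)
  set φ : ℝ → symplC r n := fun t => c (Real.smoothTransition t) with hφdef
  -- Transporting `dk = ω(φ̇, Dφ ·)` by `φ` gives Hamilton's equation, so a compactly supported
  -- isotopy is automatically Hamiltonian.
  let h : ℝ → E n → ℝ := fun t y => k t ((φ t).1.symm y)
  have hsm : IsSmoothCurve r fun t x => (φ t).1 x := by
    rw [IsSmoothCurve, hrm]; exact hφ.contDiffOn
  have hflow : IsHamiltonianFlow φ h := by
    refine ⟨hsm, ⟨Metric.closedBall 0 R, isCompact_closedBall _ _, fun t ht x hx => ?_⟩,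
      fun t ht x => ?_⟩
    · have hx' : R < ‖x‖ := by simpa using hx
      have e : (φ t).1.symm x = x := by
        rw [Homeomorph.symm_apply_eq]
        exact (hsupp _ (smoothTransition_mem t) x (hRK x hx')).symm
      simp only [h, e]
      exact hkR t x hx'
    · refine ⟨_, hasFDerivAt_comp_symm (φ t).2.1.2.1.1 (φ t).2.1.2.1.2 (hk' t x), fun v => ?_⟩
      rw [omegaL_apply, velocity_eq (c := fun s y => (φ s).1 y) ht
        (hasDerivAt_of_contDiff_add_one hφ t x).hasDerivWithinAt]
  obtain ⟨C, hC⟩ := exists_bound_of_support hk.continuous hkR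
  have h0 : φ 0 = c 0 := by simp [hφdef, Real.smoothTransition.zero]
  have h1 : φ 1 = c 1 := by simp [hφdef, Real.smoothTransition.one]
  refine lt_of_le_of_lt (iInf₂_le_of_le φ h (iInf₂_le_of_le hflow h0 (iInf_le_of_le h1 le_rfl))) ?_
  calc ∫⁻ t in Icc (0 : ℝ) 1, ⨆ x, ‖h t x‖ₑ ≤ ∫⁻ _ in Icc (0 : ℝ) 1, (C : ℝ≥0∞) := by
        refine setLIntegral_mono' measurableSet_Icc fun t ht => iSup_le fun x => ?_
        rw [← ofReal_norm]
        exact ENNReal.ofReal_le_of_le_toReal (by simpa using hC t ht _)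
    _ < ⊤ := by simp

/-- A Hamiltonian flow is itself an isotopy. The common compact support, which its definition
imposes only on the Hamiltonian, comes from `IsHamiltonianFlow.exists_radius`. -/
theorem mem_symplC0_of_hoferDist_lt_top (hr : 2 ≤ r) {φ : symplC r n} (h : hoferDist 1 φ < ⊤) :
    φ ∈ symplC0 r n := by
  simp only [hoferDist, iInf_lt_iff] at h
  obtain ⟨c, h, hc, h0, h1, -⟩ := h
  obtain ⟨R, -, hR⟩ := hc.exists_radius hr
  exact ⟨c, hc.1, ⟨Metric.closedBall 0 R, isCompact_closedBall _ _, fun t ht x hx =>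
    (hR t ht x (by simpa using hx)).1⟩, h0, h1⟩

/-- The product `d_t c_{1-t}` joins `φ` to `ψ`. Unlike a concatenation of paths, it stays of class
`C^r` without smoothing. -/
theorem hoferDist_lt_top [NeZero n] (hr : 2 ≤ r) {φ ψ : symplC r n} (hφ : φ ∈ symplC0 r n)
    (hψ : ψ ∈ symplC0 r n) : hoferDist φ ψ < ⊤ := by
  obtain ⟨c, hc, ⟨K, hK, hcK⟩, hc0, hc1⟩ := hφ
  obtain ⟨d, hd, ⟨L, hL, hdL⟩, hd0, hd1⟩ := hψ
  have hrev : ∀ t ∈ Icc (0 : ℝ) 1, 1 - t ∈ Icc (0 : ℝ) 1 := fun t ht =>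
    ⟨by linarith [ht.2], by linarith [ht.1]⟩
  have h := hoferDist_lt_top_of_isotopy hr (c := fun t => d t * c (1 - t)) ?_
    ⟨K ∪ L, hK.union hL, fun t ht x hx => ?_⟩
  · simpa [hc0, hc1, hd0, hd1] using h
  · have e1 : ContDiffOn ℝ r (fun q : ℝ × E n => (c (1 - q.1)).1 q.2) (Icc (0 : ℝ) 1 ×ˢ univ) :=
      ContDiffOn.comp (g := fun q : ℝ × E n => (c q.1).1 q.2)
        (f := fun q : ℝ × E n => (1 - q.1, q.2)) hc
        (by fun_prop) fun q hq => ⟨hrev _ hq.1, mem_univ _⟩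
    exact ContDiffOn.comp (g := fun q : ℝ × E n => (d q.1).1 q.2)
      (f := fun q : ℝ × E n => (q.1, (c (1 - q.1)).1 q.2)) hd
      (contDiff_fst.contDiffOn.prodMk e1) fun q hq => ⟨hq.1, mem_univ _⟩
  · rw [mem_union, not_or] at hx
    change (d t).1 ((c (1 - t)).1 x) = x
    rw [hcK _ (hrev t ht) x hx.1, hdL t ht x hx.2]

end reparam

/-! ### Horizontal curves in `HAM(H(n))_c` and Hamiltonian flows -/

section ham
variable {n : ℕ} {r : ℕ∞}

/-- The function by which a vertical map translates the vertical lines. -/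
def vertPart (f : H n → H n) (x : E n) : ℝ := (f (x, 0)).2

theorem left_apply [NeZero n] (g : HAMc r n) (p : H n) :
    g.1.left p = (p.1, p.2 + vertPart g.1.left p.1) := by
  obtain ⟨F, hF⟩ := g.2.2.1.2
  simp [vertPart, hF]

theorem right_apply [NeZero n] (g : HAMc r n) (p : H n) :
    g.1.right p = ((hamToSympl r n g).1 p.1, p.2 + vertPart g.1.right p.1) :=
  (volDiffC_structure g.2.1).2 p

theorem isContactLift_right [NeZero n] (g : HAMc r n) :
    IsContactLift (hamToSympl r n g).1 (vertPart g.1.right) :=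
  (volDiffC_structure g.2.1).1

theorem enorm_zero_prod (a : ℝ) : ‖((0, a) : H n)‖ₑ = ‖a‖ₑ := by
  rw [← ofReal_norm, ← ofReal_norm, Prod.norm_mk, norm_zero, max_eq_right (norm_nonneg a)]

theorem velocity_left [NeZero n] {g : ℝ → HAMc r n} {t : ℝ} (ht : t ∈ Icc (0 : ℝ) 1) {p : H n} {a : ℝ}
    (h : HasDerivWithinAt (fun s => vertPart (g s).1.left p.1) a (Icc 0 1) t) :
    velocity (fun s q => (g s).1.left q) t p = (0, a) := by
  refine velocity_eq ht ?_
  simp only [left_apply]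
  exact (hasDerivWithinAt_const _ _ _).prodMk (h.const_add _)

theorem velocity_right_left [NeZero n] {g : ℝ → HAMc r n} {t : ℝ} (ht : t ∈ Icc (0 : ℝ) 1) {p : H n}
    {a b : ℝ} {v : E n}
    (ha : HasDerivWithinAt (fun s => vertPart (g s).1.left p.1) a (Icc 0 1) t)
    (hb : HasDerivWithinAt (fun s => vertPart (g s).1.right p.1) b (Icc 0 1) t)
    (hv : HasDerivWithinAt (fun s => (hamToSympl r n (g s)).1 p.1) v (Icc 0 1) t) :
    velocity (fun s q => (g s).1.right ((g s).1.left q)) t p = (v, a + b) := by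
  refine velocity_eq ht ?_
  simp only [left_apply, right_apply]
  exact hv.prodMk ((ha.const_add _).add hb)

theorem contDiffOn_vertPart {c : ℝ → H n → H n} (hc : IsSmoothCurve r c) :
    ContDiffOn ℝ r (fun q : ℝ × E n => vertPart (c q.1) q.2) (Icc (0 : ℝ) 1 ×ˢ univ) :=
  contDiff_snd.comp_contDiffOn (ContDiffOn.comp (g := fun q : ℝ × H n => c q.1 q.2)
    (f := fun q : ℝ × E n => (q.1, (q.2, (0 : ℝ)))) hc (by fun_prop)
    fun q hq => ⟨hq.1, mem_univ _⟩)

theorem isSmoothCurve_base [NeZero n] {g : ℝ → HAMc r n}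
    (hc : IsSmoothCurve r fun t p => (g t).1.right p) :
    IsSmoothCurve r fun t x => (hamToSympl r n (g t)).1 x :=
  contDiff_fst.comp_contDiffOn (ContDiffOn.comp (g := fun q : ℝ × H n => (g q.1).1.right q.2)
    (f := fun q : ℝ × E n => (q.1, (q.2, (0 : ℝ)))) hc (by fun_prop)
    fun q hq => ⟨hq.1, mem_univ _⟩)

/-- Horizontal curves project to Hamiltonian flows of the same length. -/
theorem hoferDist_le_hamLength [NeZero n] (hr : 2 ≤ r) {g : ℝ → HAMc r n}
    (hg : IsHorizontalHAMCurve g) :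
    hoferDist (hamToSympl r n (g 0)) (hamToSympl r n (g 1)) ≤ hamLength g := by
  obtain ⟨hright, hleft, ⟨K, hK, hgK⟩, hhor⟩ := hg
  have h2 : (2 : WithTop ℕ∞) ≤ r := WithTop.coe_le_coe.2 hr
  have hI := uniqueDiffOn_Icc (zero_lt_one' ℝ)
  set φ : ℝ → E n → E n := fun t x => (hamToSympl r n (g t)).1 x with hφ
  have hφs : IsSmoothCurve r φ := isSmoothCurve_base hright
  have hφ2 : ContDiffOn ℝ 2 (fun q : ℝ × E n => φ q.1 q.2) (Icc (0 : ℝ) 1 ×ˢ univ) := hφs.of_le h2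
  let F : ℝ → E n → ℝ := fun t => vertPart (g t).1.right
  let G : ℝ → E n → ℝ := fun t => vertPart (g t).1.left
  have hF2 : ContDiffOn ℝ 2 (fun q : ℝ × E n => F q.1 q.2) (Icc (0 : ℝ) 1 ×ˢ univ) :=
    (contDiffOn_vertPart hright).of_le h2
  have hG2 : ContDiffOn ℝ 2 (fun q : ℝ × E n => G q.1 q.2) (Icc (0 : ℝ) 1 ×ˢ univ) :=
    (contDiffOn_vertPart hleft).of_le h2
  have dφ : ∀ t ∈ Icc (0 : ℝ) 1, ∀ x, HasDerivWithinAt (fun s => φ s x) (velocity φ t x) (Icc 0 1) t :=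
    fun t ht x => (hasDerivWithinAt_partial_fst (hφ2.differentiableOn (by simp))
      ht x).differentiableWithinAt.hasDerivWithinAt
  have dF : ∀ t ∈ Icc (0 : ℝ) 1, ∀ x, HasDerivWithinAt (fun s => F s x) (velocity F t x) (Icc 0 1) t :=
    fun t ht x => (hasDerivWithinAt_partial_fst (hF2.differentiableOn (by simp))
      ht x).differentiableWithinAt.hasDerivWithinAt
  have dG : ∀ t ∈ Icc (0 : ℝ) 1, ∀ x, HasDerivWithinAt (fun s => G s x) (velocity G t x) (Icc 0 1) t :=
    fun t ht x => (hasDerivWithinAt_partial_fst (hG2.differentiableOn (by simp))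
      ht x).differentiableWithinAt.hasDerivWithinAt
  -- Horizontality of the curve through `(x, 0)`, solved for the vertical velocity.
  have hsum : ∀ t ∈ Icc (0 : ℝ) 1, ∀ x,
      -velocity G t x = velocity F t x - (1 / 2) * omega (φ t x) (velocity φ t x) := by
    intro t ht x
    have h := hhor t ht (x, 0)
    rw [velocity_right_left ht (dG t ht x) (dF t ht x) (dφ t ht x), IsHorizontalVec, left_apply,
      right_apply] at h
    change velocity G t x + velocity F t x = (1 / 2) * omega (φ t x) (velocity φ t x) at h
    linarith
  have hlift : ∀ t, IsContactLift (φ t) (F t) := fun t => isContactLift_right (g t)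
  have hham : ∀ t ∈ Icc (0 : ℝ) 1, ∀ x, HasFDerivAt (fun y => -velocity G t y)
      ((omegaL n (velocity φ t x)).comp (fderiv ℝ (φ t) x)) x := by
    intro t ht x
    obtain ⟨M, hM1, hM2⟩ := exists_mixed_partial hφ2 hI ht (mem_closure_interior_Icc ht) x
    obtain ⟨A, hA1, hA2⟩ := exists_mixed_partial hF2 hI ht (mem_closure_interior_Icc ht) x
    rw [funext (hsum t ht)]
    refine hasFDerivAt_sub_half_omega (hI t ht) (dφ t ht x) hM1 hM2
      ((hlift t).preservesOmega.hasFDerivAt x).differentiableAt ?_ hA1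
    simp only [(hlift _).fderiv_eq] at hA2
    exact hA2
  -- By Cartan's formula `-Ġ` is the Hamiltonian in the moving coordinates. Composing with the
  -- inverse of `φ` does not change the sup norm, so the lengths agree.
  let h : ℝ → E n → ℝ := fun t y => -velocity G t ((hamToSympl r n (g t)).1.symm y)
  have hflow : IsHamiltonianFlow (fun t => hamToSympl r n (g t)) h := by
    refine ⟨hφs, ⟨K, hK, fun t ht x hx => ?_⟩, fun t ht x => ?_⟩
    · have e : (hamToSympl r n (g t)).1.symm x = x := by
        rw [Homeomorph.symm_apply_eq, hamToSympl_apply, baseMap, (hgK t ht (x, 0) hx).1]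
      have e2 : HasDerivWithinAt (fun s => G s x) 0 (Icc 0 1) t := by
        refine (hasDerivWithinAt_const t _ (0 : ℝ)).congr_of_mem (fun s hs => ?_) ht
        simp only [G, vertPart, (hgK s hs (x, 0) hx).2]
      simp only [h, e, velocity_eq ht e2, neg_zero]
    · exact ⟨_, hasFDerivAt_comp_symm (hamToSympl r n (g t)).2.1.2.1.1
        (hamToSympl r n (g t)).2.1.2.1.2 (hham t ht x), fun v => omegaL_apply _ _⟩
  refine iInf₂_le_of_le _ h (iInf₂_le_of_le hflow rfl (iInf_le_of_le rfl ?_))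
  refine setLIntegral_mono' measurableSet_Icc fun t ht => iSup_le fun x => ?_
  refine le_iSup_of_le ((hamToSympl r n (g t)).1.symm x, 0) ?_
  rw [velocity_left ht (dG t ht _), enorm_zero_prod, enorm_neg]

theorem contDiff_vertPart {f : H n → H n} (hf : ContDiff ℝ r f) : ContDiff ℝ r (vertPart f) :=
  contDiff_snd.comp (hf.comp (contDiff_id.prodMk contDiff_const))

/-- The length of a reparametrised curve. -/
theorem lintegral_smoothTransition_le (u : ℝ → ℝ≥0∞) :
    ∫⁻ t in Icc (0 : ℝ) 1, ENNReal.ofReal (deriv Real.smoothTransition t) *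
      u (Real.smoothTransition t) ≤ ∫⁻ t in Icc (0 : ℝ) 1, u t := by
  have hd : Differentiable ℝ Real.smoothTransition :=
    (Real.smoothTransition.contDiff (n := 1)).differentiable (by simp)
  rw [← lintegral_image_eq_lintegral_deriv_mul_of_monotoneOn measurableSet_Icc
    (fun t _ => (hd t).hasDerivAt.hasDerivWithinAt) (Real.smoothTransition.monotone.monotoneOn _)]
  refine lintegral_mono_set ?_
  rintro _ ⟨t, -, rfl⟩
  exact smoothTransition_mem t

/-- The Hamiltonian of a reparametrised Hamiltonian flow. -/
theorem eq_deriv_mul_of_reparam [NeZero n] (hr : 2 ≤ r) {c : ℝ → symplC r n} {h : ℝ → E n → ℝ}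
    (hc : IsHamiltonianFlow c h) {R : ℝ}
    (hsupp : ∀ t ∈ Icc (0 : ℝ) 1, ∀ x : E n, R < ‖x‖ → (c t).1 x = x ∧ h t x = 0)
    {t : ℝ} {k : E n → ℝ}
    (hk : ∀ x, HasFDerivAt k ((omegaL n (deriv (fun s => (c (Real.smoothTransition s)).1 x) t)).comp
      (fderiv ℝ (c (Real.smoothTransition t)).1 x)) x)
    (hkR : ∀ x, R < ‖x‖ → k x = 0) (x : E n) :
    k x = deriv Real.smoothTransition t *
      h (Real.smoothTransition t) ((c (Real.smoothTransition t)).1 x) := by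
  set β := Real.smoothTransition
  have hdβ : HasDerivAt β (deriv β t) t :=
    ((Real.smoothTransition.contDiff (n := 1)).differentiable (by simp) t).hasDerivAt
  -- The given `h` has no regularity in time, so it cannot be integrated directly. It is compared
  -- with the regular `k` at fixed time: both sides have the same differential and vanish far away.
  have hdk : ∀ x, HasFDerivAt (fun x => deriv β t * h (β t) ((c (β t)).1 x))
      ((omegaL n (deriv (fun s => (c (β s)).1 x) t)).comp (fderiv ℝ (c (β t)).1 x)) x := by
    intro x
    obtain ⟨L, hL, hL'⟩ := hc.2.2 (β t) (smoothTransition_mem t) x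
    have e1 := (hL.comp x ((c (β t)).2.1.2.1.1.hasFDerivAt x)).const_mul (deriv β t)
    have e2 : HasDerivAt (fun s => (c (β s)).1 x)
        (deriv β t • velocity (fun s y => (c s).1 y) (β t) x) t :=
      HasDerivWithinAt.scomp_hasDerivAt (g₁ := fun s => (c s).1 x) t
        (hc.1.hasDerivWithinAt hr (smoothTransition_mem t) x) hdβ smoothTransition_mem
    refine e1.congr_fderiv ?_
    ext u
    rw [e2.deriv]
    simp [hL']
  obtain ⟨x₀, hx₀⟩ := NormedSpace.exists_lt_norm ℝ (E n) R
  have hz : ∀ y, HasFDerivAt (fun x => k x - deriv β t * h (β t) ((c (β t)).1 x))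
      (0 : E n →L[ℝ] ℝ) y :=
    fun y => ((hk y).sub (hdk y)).congr_fderiv (sub_self _)
  have := is_const_of_fderiv_eq_zero (𝕜 := ℝ) (fun y => (hz y).differentiableAt)
    (fun y => (hz y).fderiv) x x₀
  have hs := hsupp (β t) (smoothTransition_mem t) x₀ hx₀
  rw [hkR x₀ hx₀, hs.1, hs.2] at this
  linarith

/-- The time integral of a function is as smooth as the function and its space derivative. -/
theorem contDiff_sub_integral {m : ℕ∞} {k : ℝ → E n → ℝ} {w : ℝ → E n → E n →L[ℝ] ℝ}
    (hk : ContDiff ℝ m fun q : ℝ × E n => k q.1 q.2)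
    (hw : ContDiff ℝ m fun q : ℝ × E n => w q.1 q.2)
    (hk' : ∀ t x, HasFDerivAt (k t) (w t x) x) {G₀ : E n → ℝ} (hG₀ : ContDiff ℝ (m + 1) G₀) :
    (∀ t x, HasDerivAt (fun t => G₀ x - ∫ s in (0 : ℝ)..t, k s x) (-k t x) t) ∧
      ContDiff ℝ (m + 1) fun q : ℝ × E n => G₀ q.2 - ∫ s in (0 : ℝ)..q.1, k s q.2 := by
  have hGt : ∀ t x, HasDerivAt (fun t => G₀ x - ∫ s in (0 : ℝ)..t, k s x) (-k t x) t := by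
    intro t x
    have hcont : Continuous fun s => k s x :=
      hk.continuous.comp (by fun_prop : Continuous fun s : ℝ => (s, x))
    simpa using (hcont.integral_hasStrictDerivAt 0 t).hasDerivAt.const_sub (G₀ x)
  have c1 : ContDiff ℝ m fun q : E n × ℝ => k q.2 q.1 := hk.comp (contDiff_snd.prodMk contDiff_fst)
  have c2 : ContDiff ℝ m fun q : E n × ℝ => w q.2 q.1 := hw.comp (contDiff_snd.prodMk contDiff_fst)
  have hGx : ∀ t x, HasFDerivAt (fun x => G₀ x - ∫ s in (0 : ℝ)..t, k s x)
      (fderiv ℝ G₀ x - ∫ s in (0 : ℝ)..t, w s x) x := fun t x =>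
    HasFDerivAt.sub (hG₀.differentiable (by simp) x).hasFDerivAt
      (hasFDerivAt_intervalIntegral_of_continuous (v := fun x s => k s x) (v' := fun x s => w s x)
        c1.continuous c2.continuous (fun x s => hk' s x) 0 t x)
  refine ⟨hGt, contDiff_succ_of_partials (f := fun t x => G₀ x - ∫ s in (0 : ℝ)..t, k s x)
    (f₁ := fun t x => ContinuousLinearMap.toSpanSingleton ℝ (-k t x))
    (fun t x => (hGt t x).hasFDerivAt) hGx
    ((ContinuousLinearMap.toSpanSingletonCLE (𝕜 := ℝ) (E := ℝ)).contDiff.comp hk.neg) ?_⟩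
  have e := contDiff_intervalIntegral (v := fun x s => w s x) c2
  exact ((hG₀.fderiv_right le_rfl).comp contDiff_snd).sub
    (e.comp (contDiff_snd.prodMk contDiff_fst))

/-- A Hamiltonian flow lifts to a horizontal curve with given starting point, which is not longer. -/
theorem exists_horizontal_lift [NeZero n] (hr : 2 ≤ r) {c : ℝ → symplC r n} {h : ℝ → E n → ℝ}
    (hc : IsHamiltonianFlow c h) (A : HAMc r n) (hA : hamToSympl r n A = c 0) :
    ∃ g : ℝ → HAMc r n, IsHorizontalHAMCurve g ∧ g 0 = A ∧ hamToSympl r n (g 1) = c 1 ∧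
      hamLength g ≤ ∫⁻ t in Icc (0 : ℝ) 1, ⨆ x, ‖h t x‖ₑ := by
  obtain ⟨m, hm, hrm⟩ := exists_eq_add_one_of_two_le hr
  obtain ⟨R, hR, hsupp⟩ := hc.exists_radius hr
  obtain ⟨hφ, F, k, hF, hlift, hFR, hk, hFk, hk', hkR⟩ := exists_reparam_lift hrm hm hc.1 hR
    fun t ht x hx => (hsupp t ht x hx).1
  set β := Real.smoothTransition with hβ
  set φ : ℝ → E n → E n := fun t x => (c (β t)).1 x with hφdef
  have dφ : ∀ t x, HasDerivAt (fun s => φ s x) (deriv (fun s => φ s x) t) t :=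
    hasDerivAt_of_contDiff_add_one hφ
  have hkh : ∀ t x, k t x = deriv β t * h (β t) (φ t x) := fun t =>
    eq_deriv_mul_of_reparam hr hc hsupp (hk' t) (hkR t)
  obtain ⟨K₀, hK₀, hAK⟩ := A.2.2.2
  let G₀ : E n → ℝ := vertPart A.1.left
  have hG₀ : ContDiff ℝ (m + 1) G₀ := by
    rw [← hrm]; exact contDiff_vertPart A.2.2.1.1.2.2.2.1
  -- Horizontality prescribes `Ġ = -k`, and the initial value is the vertical part of `A`.
  let G : ℝ → E n → ℝ := fun t x => G₀ x - ∫ s in (0 : ℝ)..t, k s x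
  obtain ⟨hGt, hG⟩ := contDiff_sub_integral hk (w := fun t x =>
    (omegaL n (deriv (fun s => φ s x) t)).comp (fderiv ℝ (φ t) x))
    (((omegaL n).contDiff.comp (contDiff_deriv_fst hφ)).clm_comp (contDiff_fderiv_snd hφ)) hk' hG₀
  have hGR : ∀ t x, x ∉ Metric.closedBall (0 : E n) R ∪ K₀ → G t x = 0 := by
    intro t x hx
    rw [mem_union, not_or] at hx
    have hx1 : R < ‖x‖ := by simpa using hx.1
    simp only [G, hkR _ x hx1, intervalIntegral.integral_zero, sub_zero, G₀, vertPart,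
      hAK (x, 0) hx.2]
  have hGr : ∀ t, ContDiff ℝ (m + 1) (G t) := fun t =>
    hG.comp (by fun_prop : ContDiff ℝ (m + 1) fun x : E n => (t, x))
  have hGL : ∀ t, LocallyLipschitz (G t) := fun t => ((hGr t).of_le le_add_self).locallyLipschitz
  have hcomp : IsCompact (Metric.closedBall (0 : E n) R ∪ K₀) := (isCompact_closedBall _ _).union hK₀
  have hFc : ∀ t, ∃ K, IsCompact K ∧ ∀ x, x ∉ K → F t x = 0 := fun t =>
    ⟨Metric.closedBall 0 R, isCompact_closedBall _ _, fun x hx => hFR t x (by simpa using hx)⟩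
  let g : ℝ → HAMc r n := fun t =>
    ⟨⟨liftHomeo (Homeomorph.refl _) (G t) (hGL t).continuous,
      liftHomeo (c (β t)).1 (F t) (hlift t).differentiable.continuous⟩,
      liftHomeo_mem_volDiffC (c (β t)).2 (hlift t) (hFc t),
      liftHomeo_refl_mem_vertDiff (by rw [hrm]; exact hGr t) ((hGr t).differentiable (by simp))
        (hGL t),
      liftHomeo_mem_cylSupport (hGL t).continuous ⟨∅, isCompact_empty, fun _ _ => rfl⟩ ⟨_, hcomp, hGR t⟩⟩
  have gl : ∀ t p, (g t).1.left p = (p.1, p.2 + G t p.1) := fun t p => rfl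
  have gr : ∀ t p, (g t).1.right p = (φ t p.1, p.2 + F t p.1) := fun t p => rfl
  have vl : ∀ t, vertPart (g t).1.left = G t := fun t => by funext x; simp [vertPart, gl]
  have vr : ∀ t, vertPart (g t).1.right = F t := fun t => by funext x; simp [vertPart, gr]
  have hbase : ∀ t, hamToSympl r n (g t) = c (β t) := fun t =>
    Subtype.ext (Homeomorph.ext fun x => rfl)
  have dG : ∀ t x, HasDerivWithinAt (fun s => vertPart (g s).1.left x) (-k t x) (Icc 0 1) t :=
    fun t x => by simp only [vl]; exact (hGt t x).hasDerivWithinAt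
  have hspace : ContDiff ℝ (m + 1) fun q : ℝ × H n => (q.1, q.2.1) := by fun_prop
  have hheight : ContDiff ℝ (m + 1) fun q : ℝ × H n => q.2.2 := by fun_prop
  refine ⟨g, ⟨?_, ?_, ⟨_, hcomp, fun t ht p hp => ⟨?_, ?_⟩⟩, fun t ht p => ?_⟩, ?_, ?_, ?_⟩
  · rw [IsSmoothCurve, hrm]
    exact ((hφ.comp hspace).prodMk (hheight.add (hF.comp hspace))).contDiffOn
  · rw [IsSmoothCurve, hrm]
    exact ((contDiff_fst.comp contDiff_snd).prodMk (hheight.add (hG.comp hspace))).contDiffOn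
  · rw [mem_union, not_or] at hp
    have hp1 : R < ‖p.1‖ := by simpa using hp.1
    rw [gr, hFR t _ hp1, show φ t p.1 = p.1 from (hsupp _ (smoothTransition_mem t) _ hp1).1, add_zero]
  · rw [gl, hGR t _ hp, add_zero]
  · rw [velocity_right_left (b := (1 / 2) * omega (φ t p.1) (deriv (fun s => φ s p.1) t) + k t p.1)
      (v := deriv (fun s => φ s p.1) t) ht (dG t p.1) ?_ ?_, IsHorizontalVec, gl, gr]
    · simp
    · simp only [vr]
      exact (hFk t p.1).hasDerivWithinAt
    · simp only [hbase]
      exact (dφ t p.1).hasDerivWithinAt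
  -- The vertical components agree at time 0 by the choice of `G₀`. The other component of `A` is
  -- not chosen: it is the unique compactly supported contact lift of `c 0`.
  · refine Subtype.ext (SemidirectProduct.ext ?_ ?_)
    · refine Homeomorph.ext fun p => ?_
      rw [gl, left_apply]
      simp [G, G₀]
    · refine (eq_liftHomeo_of_volDiffC A.2.1 (fun x => ?_) (hlift 0) (hFc 0)).symm
      rw [← hamToSympl_apply, hA, hβ, Real.smoothTransition.zero]
  · rw [hbase, hβ, Real.smoothTransition.one]
  -- The vertical speed is `β'` times the Hamiltonian at time `β`, so changing variables bounds the
  -- length by that of the original flow.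
  · refine le_trans ?_ (lintegral_smoothTransition_le _)
    refine setLIntegral_mono' measurableSet_Icc fun t ht => iSup_le fun p => ?_
    rw [velocity_left ht (dG t p.1), enorm_zero_prod, enorm_neg, hkh, enorm_mul,
      Real.enorm_eq_ofReal Real.smoothTransition.monotone.deriv_nonneg]
    gcongr
    exact le_iSup (fun x => ‖h (β t) x‖ₑ) _

/-- The distance of a point to a coset is the Hofer distance of the induced symplectic maps. -/
theorem iInf_hamDist_eq [NeZero n] (hr : 2 ≤ r) (A : HAMc r n) (b : HAMc r n ⧸ vertInHAMc r n) :
    (⨅ (B : HAMc r n) (_ : (B : HAMc r n ⧸ vertInHAMc r n) = b), hamDist A B) =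
      hoferDist (quotientEquivSympl r n A) (quotientEquivSympl r n b) := by
  refine le_antisymm ?_ ?_
  · refine le_iInf₂ fun c h => le_iInf₂ fun hc h0 => le_iInf fun h1 => ?_
    obtain ⟨g, hg, g0, g1, hlen⟩ := exists_horizontal_lift hr hc A h0.symm
    refine iInf₂_le_of_le (g 1) ?_ (le_trans ?_ hlen)
    · apply (quotientEquivSympl r n).injective
      rw [quotientEquivSympl_mk, g1, h1]
    · exact iInf₂_le_of_le g hg (iInf₂_le_of_le g0 rfl le_rfl)
  · refine le_iInf₂ fun B hB => le_iInf₂ fun g hg => le_iInf₂ fun g0 g1 => ?_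
    rw [← hB, quotientEquivSympl_mk, quotientEquivSympl_mk, ← g0, ← g1]
    exact hoferDist_le_hamLength hr hg

theorem hamQuotDist_eq [NeZero n] (hr : 2 ≤ r) (a b : HAMc r n ⧸ vertInHAMc r n) :
    hamQuotDist a b = hoferDist (quotientEquivSympl r n a) (quotientEquivSympl r n b) := by
  refine le_antisymm ?_ ?_
  · obtain ⟨A, rfl⟩ := QuotientGroup.mk_surjective a
    rw [← iInf_hamDist_eq hr A b]
    exact le_iInf₂ fun B hB => iInf₂_le_of_le A B (iInf₂_le_of_le rfl hB le_rfl)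
  · refine le_iInf₂ fun A B => le_iInf₂ fun hA hB => ?_
    rw [← hA, ← iInf_hamDist_eq hr A b]
    exact iInf₂_le B hB

end ham

end Heis

end

/-! ### The descent theorem -/

theorem theorem9p1 (n : ℕ) [NeZero n] (r : ℕ∞) :
    -- the orbits of the vertical groups are the fibres of the projection on `ℝ^{2n}`
    (∀ p : H n, MulAction.orbit (vertDiff r n) p = {q | q.1 = p.1} ∧
      MulAction.orbit (vertDiffC r n) p = {q | q.1 = p.1} ∧
      MulAction.orbit (vertInHAMc r n) p = {q | q.1 = p.1}) ∧
    ∃ (e : MulAction.orbitRel.Quotient (vertDiff r n) (H n) ≃ₜ E n)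
      (Ψ : (HAMc r n ⧸ vertInHAMc r n) ≃* symplC r n),
      -- `H(n) / Diff(H(n), vert) = ℝ^{2n}` through the projection
      (∀ p : H n, e (Quotient.mk _ p) = p.1) ∧
      -- the action of `HAM(H(n))_c` descends to that of the symplectomorphisms
      (∀ (g : HAMc r n) (p : H n),
        e (Quotient.mk _ (g • p)) =
          (Ψ (g : HAMc r n ⧸ vertInHAMc r n)).1 (e (Quotient.mk _ p))) ∧
      -- the path distance descends to the Hofer distance
      (2 ≤ r →
        (∀ a b : HAMc r n ⧸ vertInHAMc r n, hamQuotDist a b = hoferDist (Ψ a) (Ψ b)) ∧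
        (∀ (A : HAMc r n) (b : HAMc r n ⧸ vertInHAMc r n),
          (⨅ (B : HAMc r n) (_ : (B : HAMc r n ⧸ vertInHAMc r n) = b), hamDist A B) =
            hoferDist (Ψ A) (Ψ b)) ∧
        (∀ φ : symplC r n, hoferDist 1 φ < ⊤ ↔ φ ∈ symplC0 r n) ∧
        (∀ φ ∈ symplC0 r n, ∀ ψ ∈ symplC0 r n, hoferDist φ ψ < ⊤)) ∧
      -- volume preserving invariants descend to symplectic invariants
      (∀ (Y : Type*) (c : Set (H n) → Y),
        (IsInvariant (volDiff r n) (borelSets _) c →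
          IsInvariant (sympl r n) (borelSets _) (descend c)) ∧
        (IsInvariant (volDiffC r n) (borelSets _) c →
          IsInvariant (symplC r n) (borelSets _) (descend c)) ∧
        (IsInvariant (volDiff r n) (bddBorelSets _) c →
          IsInvariant (sympl r n) (bddBorelSets _) (fibreValues c)) ∧
        (IsInvariant (volDiffC r n) (bddBorelSets _) c →
          IsInvariant (symplC r n) (bddBorelSets _) (fibreValues c))) ∧
      (∀ c : Set (H n) → ℝ≥0∞,
        (IsMonotoneUnder (volDiff r n) (borelSets _) c → IsConformalH (borelSets _) c →
          IsMonotoneUnder (sympl r n) (borelSets _) (descend c) ∧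
          IsConformalE (borelSets _) (descend c)) ∧
        (IsMonotoneUnder (volDiff r n) (bddBorelSets _) c → IsConformalH (bddBorelSets _) c →
          IsMonotoneUnder (sympl r n) (bddBorelSets _) (fun A => sInf (fibreValues c A)) ∧
          IsConformalE (bddBorelSets _) (fun A => sInf (fibreValues c A)))) := by
  refine ⟨fun p => ⟨orbit_vertDiff r p, orbit_vertDiffC r p, orbit_vertInHAMc r p⟩,
    orbitHomeo r n, quotientEquivSympl r n, fun p => rfl, fun g p => ?_, fun hr => ?_,
    fun Y c => ?_, fun c => ?_⟩
  · change (g.1.left (g.1.right p)).1 = baseMap g.1.right p.1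
    rw [left_fst, fst_apply_eq_baseMap g.2.1.1.1.2.2.1.1]
  · refine ⟨hamQuotDist_eq hr, iInf_hamDist_eq hr,
      fun φ => ⟨mem_symplC0_of_hoferDist_lt_top hr, fun h => hoferDist_lt_top hr ?_ h⟩,
      fun φ hφ ψ hψ => hoferDist_lt_top hr hφ hψ⟩
    -- The constant isotopy puts the identity in the identity component.
    exact ⟨fun _ => 1, contDiff_snd.contDiffOn, ⟨∅, isCompact_empty, fun _ _ _ _ => rfl⟩, rfl, rfl⟩
  · exact ⟨isInvariant_descend (lifts_sympl r), isInvariant_descend (lifts_symplC r),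
      isInvariant_fibreValues (lifts_sympl r), isInvariant_fibreValues (lifts_symplC r)⟩
  · refine ⟨fun hm hc => ?_, fun hm hc => ?_⟩
    · have hm' := isMonotoneUnder_descend (lifts_sympl r) hm
      exact ⟨hm', isConformalE_descend hm' hc⟩
    · have hm' := isMonotoneUnder_fibreValues (lifts_sympl r) hm
      exact ⟨hm', isConformalE_fibreValues hm' hc⟩
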